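/- Let $G_1,G_2$ be finite groups, $A$ a group with monomorphisms $\phi_i\colon A\to G_i$ $(i=1,2)$, and $G=G_1*_A G_2$ the amalgam; $A$ is regarded as a subgroup of $G_1$, $G_2$ and $G$. Let $X_1,X_2$ be disjoint finite generating sets of $G_1,G_2$ (different generators may represent the same element, also $1$), and $X=X_1\cup X_2$. **Graphs.** A pointed graph labelled with $X^{\pm}$ is a set of vertices with a basepoint $v_0$ and a set of edges; an edge $e$ has an initial vertex $\iota(e)$, an inverse edge $\bar e$ with $\bar{\bar e}=e$, a terminal vertex $\tau(e)=\iota(\bar e)$, and a label in $X^{\pm}$ such that $lab(\bar e)=lab(e)^{-1}$. The label of a path is the word read along it. Isomorphisms preserve labels and basepoints. The graph is well-labelled if no two distinct edges have the same initial vertex and the same label. An $X_i$-monochromatic component is a maximal connected subgraph labelled with $X_i^{\pm}$ that has at least one edge. A vertex is bichromatic if edges with labels in $X_1^{\pm}$ and in $X_2^{\pm}$ start at it, and $X_i$-monochromatic if all edges that start at it have labels in $X_i^{\pm}$; $VB(C)$ is the set of the vertices of $C$ that are bichromatic in the whole graph. For a subgroup $S$ of a group $Q$ with given generators, $Cayley(Q,S)$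 has the right cosets $Sq$ as vertices, the basepoint $S\cdot 1$, and for each coset $Sq$ and each generator or inverse generator $x$ one edge labelled $x$ from $Sq$ to $Sqx$; $Cayley(Q)=Cayley(Q,1)$. **Normal core.** A word in $X^{\pm}$ is in normal form if, in its decomposition $w_1\cdots w_n$ $(n\ge 0)$ into maximal subwords over $X_1^{\pm}$ or over $X_2^{\pm}$, no $w_k$ represents $1$ and, if $n\neq 1$, no $w_k$ represents an element of $A$. A path is normal if its label is in normal form. For $H\le G$ the normal core of $Cayley(G,H)$ is the subgraph, with basepoint $H\cdot 1$, that is the union of all normal paths closed at $H\cdot 1$ (with the inverses of their edges). **Algorithm.** The input is a finite set $Y\subseteq G$, whose elements are given by words in $X^{\pm}$. (Folding means identifying two distinct edges with the same initial vertex and the same label, together with their inverses and terminal vertices.) 1. Form a bouquet of loops at a vertex $v_0$ labelled by words that represent the elements of $Y$. 2. Fold edges and cut hairs (delete an edge with its inverse and its terminal vertex, where this vertex has degree $1$ and is not $v_0$) as long as possible. 3. For each $X_i$-monochromatic component of the graph obtained, pick one of its edges $e$ and glue a copy of $Cayley(G_i)$ to the graph by identifying $e$ with the edge of $Cayley(G_i)$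 that starts at $1$ and has the same label; fold as long as possible. 4. For each vertex $v$ that is bichromatic in the graph obtained, whenever two paths $p_1,p_2$ start at $v$, $p_i$ is labelled with $X_i^{\pm}$, $lab(p_1)$ and $lab(p_2)$ represent the same element of $G$, which lies in $A$, and $\tau(p_1)\neq\tau(p_2)$, identify $\tau(p_1)$ with $\tau(p_2)$; fold as long as possible. 5. As long as possible, remove (i.e. delete all edges and all $X_i$-monochromatic vertices of) an $X_i$-monochromatic component $C$ that contains a bichromatic vertex $\vartheta$ such that $(C,\vartheta)\cong Cayley(G_i,K)$ with $K\le A$, $|VB(C)|=[A:K]$, and either $K=1$ and $v_0$ is not an $X_i$-monochromatic vertex of $C$, or $K\ne1$ and $v_0\notin C$. If the resulting graph has no bichromatic vertex and is isomorphic to $Cayley(G_i)$ for some $i$, replace it by the single vertex $v_0$ without edges. 6. If $v_0$ is $X_i$-monochromatic and lies in an $X_i$-monochromatic component $C$ with $(C,v_0)\cong Cayley(G_i,K)$ and $L=K\cap A\neq1$, glue $Cayley(G_j,L)$, $j\ne i$, to the graph by identifying $L\cdot a$ with the vertex $v_0\cdot a$ of $C$ for all $a\in A$. **Theorem.** Let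 $Y\subseteq G$ be finite and $H=\langle Y\rangle$. Whatever choices are made (words, folded edges, picked edges, order of the operations), the algorithm terminates, and the pointed labelled graph $\Gamma(H)$ that it produces is isomorphic to the normal core of $Cayley(G,H)$. In particular $\Gamma(H)$ is canonical: if $Y'\subseteq G$ is another finite set with $\langle Y'\rangle=H$, then the graphs produced from $Y$ and from $Y'$ are isomorphic. -/

import Mathlib

open Monoid

universe u v w a b c d

namespace Stallings

section Graphs

/-- A pointed graph labelled with `X^±`. The letter `x` is `(x, true)`, its formal inverse is
`(x, false)`. Every edge `e` has an inverse edge `inv e`, which is automatically distinct from `e`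
because the labels of the two differ. -/
structure PGraph (X : Type v) where
  V : Type a
  E : Type b
  ι : E → V
  inv : E → E
  lab : E → X × Bool
  base : V
  inv_inv : ∀ e, inv (inv e) = e
  lab_inv : ∀ e, lab (inv e) = ((lab e).1, !(lab e).2)

variable {X : Type v}

namespace PGraph

/-- Terminal vertex of an edge. -/
def τ (Γ : PGraph.{v, a, b} X) (e : Γ.E) : Γ.V := Γ.ι (Γ.inv e)

/-- `Γ.IsPath x p y`: the list of edges `p` is a path from `x` to `y`. -/
def IsPath (Γ : PGraph.{v, a, b} X) : Γ.V → List Γ.E → Γ.V → Prop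
  | x, [], y => x = y
  | x, e :: p, y => Γ.ι e = x ∧ Γ.IsPath (Γ.τ e) p y

/-- Label of a path, a word in `X^±`. -/
def pathLab (Γ : PGraph.{v, a, b} X) (p : List Γ.E) : List (X × Bool) := p.map Γ.lab

/-- `Γ` is well-labelled; equivalently, no Stallings folding can be applied to `Γ`. -/
def WellLabelled (Γ : PGraph.{v, a, b} X) : Prop :=
  ∀ e₁ e₂ : Γ.E, Γ.ι e₁ = Γ.ι e₂ → Γ.lab e₁ = Γ.lab e₂ → e₁ = e₂

/-- The same graph with another basepoint. -/
def rebase (Γ : PGraph.{v, a, b} X) (x : Γ.V) : PGraph.{v, a, b} X := { Γ with base := x }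

/-- Disjoint union, with the basepoint of the first graph. -/
def sum (Γ : PGraph.{v, a, b} X) (Δ : PGraph.{v, c, d} X) : PGraph.{v, max a c, max b d} X where
  V := Γ.V ⊕ Δ.V
  E := Γ.E ⊕ Δ.E
  ι := Sum.map Γ.ι Δ.ι
  inv := Sum.map Γ.inv Δ.inv
  lab := Sum.elim Γ.lab Δ.lab
  base := Sum.inl Γ.base
  inv_inv := by rintro (e | e) <;> simp [Γ.inv_inv, Δ.inv_inv]
  lab_inv := by rintro (e | e) <;> simp [Γ.lab_inv, Δ.lab_inv]

/-- Morphisms of pointed labelled graphs. -/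
structure Hom (Γ : PGraph.{v, a, b} X) (Δ : PGraph.{v, c, d} X) where
  onV : Γ.V → Δ.V
  onE : Γ.E → Δ.E
  map_ι : ∀ e, Δ.ι (onE e) = onV (Γ.ι e)
  map_inv : ∀ e, Δ.inv (onE e) = onE (Γ.inv e)
  map_lab : ∀ e, Δ.lab (onE e) = Γ.lab e
  map_base : onV Γ.base = Δ.base

/-- Isomorphism of pointed labelled graphs. -/
def Iso (Γ : PGraph.{v, a, b} X) (Δ : PGraph.{v, c, d} X) : Prop :=
  ∃ f : Hom Γ Δ, Function.Bijective f.onV ∧ Function.Bijective f.onE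

/-- `f : Γ → Δ` exhibits `Δ` as the graph obtained from `Γ` by identifying the pairs of vertices
related by `r` and the pairs of edges related by `s` (and nothing else). -/
def Hom.IsQuotient {Γ : PGraph.{v, a, b} X} {Δ : PGraph.{v, c, d} X} (f : Hom Γ Δ)
    (r : Γ.V → Γ.V → Prop) (s : Γ.E → Γ.E → Prop) : Prop :=
  Function.Surjective f.onV ∧ Function.Surjective f.onE ∧
  (∀ x y, f.onV x = f.onV y ↔ Relation.EqvGen r x y) ∧
  (∀ e e', f.onE e = f.onE e' ↔ Relation.EqvGen s e e')

/-- `Γ` is isomorphic, as a pointed graph, to the subgraph of `Δ` with vertex set `S` and edge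
set `T`. -/
def IsoOnto (Γ : PGraph.{v, a, b} X) (Δ : PGraph.{v, c, d} X) (S : Set Δ.V) (T : Set Δ.E) : Prop :=
  ∃ f : Hom Γ Δ, Function.Injective f.onV ∧ Function.Injective f.onE ∧
    Set.range f.onV = S ∧ Set.range f.onE = T

/-- `f` is a single Stallings folding: two distinct edges with the same initial vertex and the
same label are identified. -/
def Hom.IsFold {Γ : PGraph.{v, a, b} X} {Δ : PGraph.{v, c, d} X} (f : Hom Γ Δ) : Prop :=
  ∃ e₁ e₂ : Γ.E, e₁ ≠ e₂ ∧ Γ.ι e₁ = Γ.ι e₂ ∧ Γ.lab e₁ = Γ.lab e₂ ∧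
    f.IsQuotient (fun x y => x = Γ.τ e₁ ∧ y = Γ.τ e₂)
      (fun e e' => (e = e₁ ∧ e' = e₂) ∨ (e = Γ.inv e₁ ∧ e' = Γ.inv e₂))

/-- `e` is a hair: its terminal vertex has degree one and is not the basepoint. -/
def IsHair (Γ : PGraph.{v, a, b} X) (e : Γ.E) : Prop :=
  Γ.τ e ≠ Γ.base ∧ ∀ e', Γ.ι e' = Γ.τ e → e' = Γ.inv e

/-- `Δ` is obtained from `Γ` by cutting a single hair. -/
def CutHair (Γ : PGraph.{v, a, b} X) (Δ : PGraph.{v, c, d} X) : Prop :=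
  ∃ e, Γ.IsHair e ∧ Δ.IsoOnto Γ {x | x ≠ Γ.τ e} {e' | e' ≠ e ∧ e' ≠ Γ.inv e}

end PGraph

/-- Disjoint union of a point (the basepoint) and, for each word of the list, a segment labelled
by that word. -/
def segments (W : List (List (X × Bool))) : PGraph.{v, 0, 0} X where
  V := Unit ⊕ (Σ k : Fin W.length, Fin ((W.get k).length + 1))
  E := (Σ k : Fin W.length, Fin (W.get k).length) × Bool
  ι := fun e => Sum.inr ⟨e.1.1, if e.2 then e.1.2.castSucc else e.1.2.succ⟩
  inv := fun e => (e.1, !e.2)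
  lab := fun e =>
    let l := (W.get e.1.1).get e.1.2
    if e.2 then l else (l.1, !l.2)
  base := Sum.inl ()
  inv_inv := by rintro ⟨e, t⟩; simp
  lab_inv := by rintro ⟨e, t⟩; cases t <;> simp

/-- `Γ` consists of loops around the basepoint, one for each word of the list, labelled by these
words: both ends of every segment are identified with the basepoint. -/
def IsBouquet (W : List (List (X × Bool))) (Γ : PGraph.{v, a, b} X) : Prop :=
  ∃ f : (segments W).Hom Γ, f.IsQuotient
    (fun x y => y = Sum.inl () ∧ ∃ k, x = Sum.inr ⟨k, 0⟩ ∨ x = Sum.inr ⟨k, Fin.last _⟩)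
    (fun _ _ => False)

/-- `q` or `q⁻¹`, according to the sign. -/
def sgn {Q : Type u} [Group Q] (q : Q) (t : Bool) : Q := if t then q else q⁻¹

/-- The map `S q ↦ S q g` on right cosets. -/
def cosetMul {Q : Type u} [Group Q] (S : Subgroup Q) (g : Q) :
    Quotient (QuotientGroup.rightRel S) → Quotient (QuotientGroup.rightRel S) :=
  Quotient.map' (fun q => q * g) fun p q h => by
    rw [QuotientGroup.rightRel_apply] at h ⊢
    simpa [mul_assoc] using h

/-- The relative Cayley graph `Cayley(Q, S)` of a group `Q` with generators `g z`, `z ∈ Z`: the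
vertices are the right cosets `S q`, and there is an edge labelled `z^±` from `S q` to
`S q (g z)^±`. The map `ℓ` says under which name a generator appears in the alphabet `X`. -/
def relCayley {Q : Type u} [Group Q] {Z : Type c} (g : Z → Q) (ℓ : Z → X) (S : Subgroup Q) :
    PGraph.{v, u, max u c} X where
  V := Quotient (QuotientGroup.rightRel S)
  E := Quotient (QuotientGroup.rightRel S) × (Z × Bool)
  ι := fun e => e.1
  inv := fun e => (cosetMul S (sgn (g e.2.1) e.2.2) e.1, (e.2.1, !e.2.2))
  lab := fun e => (ℓ e.2.1, e.2.2)
  base := Quotient.mk'' 1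
  inv_inv := by
    rintro ⟨q, z, t⟩
    induction q using Quotient.inductionOn'
    cases t <;> simp [cosetMul, sgn]
  lab_inv := by rintro ⟨q, z, t⟩; rfl

end Graphs

section Amalgam

/-- Graphs labelled with `(X₀ ⊔ X₁)^±`. -/
abbrev AGraph (X : Fin 2 → Type v) := PGraph.{v, a, b} (Σ i, X i)

variable {X : Fin 2 → Type v}

namespace AGraph

/-- The index `i` such that the label of `e` is in `X_i^±`. -/
def colour (Γ : AGraph.{v, a, b} X) (e : Γ.E) : Fin 2 := (Γ.lab e).1.1

/-- `p` is a path from `x` to `y` labelled with `X_i^±`. -/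
def IsMonoPath (Γ : AGraph.{v, a, b} X) (i : Fin 2) (x : Γ.V) (p : List Γ.E) (y : Γ.V) : Prop :=
  Γ.IsPath x p y ∧ ∀ e ∈ p, colour Γ e = i

/-- The set of bichromatic vertices. -/
def VB (Γ : AGraph.{v, a, b} X) : Set Γ.V := {x | ∀ i, ∃ e, Γ.ι e = x ∧ colour Γ e = i}

/-- The set of `X_i`-monochromatic vertices. -/
def VM (Γ : AGraph.{v, a, b} X) (i : Fin 2) : Set Γ.V := {x | ∀ e, Γ.ι e = x → colour Γ e = i}

/-- Vertices of the `X_i`-monochromatic component that contains `x` (it is a component only if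
some edge with label in `X_i^±` starts at `x`). -/
def compV (Γ : AGraph.{v, a, b} X) (i : Fin 2) (x : Γ.V) : Set Γ.V :=
  {y | ∃ p, IsMonoPath Γ i x p y}

/-- Edges of the `X_i`-monochromatic component that contains `x`. -/
def compE (Γ : AGraph.{v, a, b} X) (i : Fin 2) (x : Γ.V) : Set Γ.E :=
  {e | colour Γ e = i ∧ Γ.ι e ∈ compV Γ i x}

/-- Two edges lie in the same monochromatic component. -/
def SameComp (Γ : AGraph.{v, a, b} X) (e e' : Γ.E) : Prop :=
  e' ∈ compE Γ (colour Γ e) (Γ.ι e)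

/-- The list `l` contains exactly one edge of each monochromatic component. -/
def PicksEdges (Γ : AGraph.{v, a, b} X) (l : List Γ.E) : Prop :=
  l.Pairwise (fun e e' => ¬ SameComp Γ e e') ∧ ∀ e, ∃ e' ∈ l, SameComp Γ e e'

end AGraph

open AGraph

variable {G : Fin 2 → Type u} [∀ i, Group (G i)] {A : Type c} [Group A]
  (φ : ∀ i, A →* G i) (gen : ∀ i, X i → G i)

/-- The element of the amalgam represented by a generator. -/
def genG (x : Σ i, X i) : PushoutI φ := PushoutI.of x.1 (gen x.1 x.2)

/-- The element of the amalgam represented by a word. -/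
def val (p : List ((Σ i, X i) × Bool)) : PushoutI φ :=
  (p.map fun l => sgn (genG φ gen l.1) l.2).prod

/-- The word `p` is in normal form: `S` is its decomposition into maximal monochromatic subwords
(the syllables, each with its colour), no syllable represents `1`, and if there is not exactly one
syllable then no syllable represents an element of `A`. The empty word is in normal form. -/
def IsNormalWord (p : List ((Σ i, X i) × Bool)) : Prop :=
  ∃ S : List (Fin 2 × List ((Σ i, X i) × Bool)),
    p = (S.map Prod.snd).flatten ∧
    (∀ s ∈ S, s.2 ≠ [] ∧ ∀ l ∈ s.2, l.1.1 = s.1) ∧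
    S.IsChain (fun s t => s.1 ≠ t.1) ∧
    (∀ s ∈ S, val φ gen s.2 ≠ 1) ∧
    (S.length ≠ 1 → ∀ s ∈ S, val φ gen s.2 ∉ (PushoutI.base φ).range)

/-- `Cayley(G, H)` for the amalgam `G`. -/
def cayleyG (H : Subgroup (PushoutI φ)) : AGraph.{v, max u c, max u c v} X :=
  relCayley (genG φ gen) id H

/-- `Cayley(G_i, K)` as a graph labelled with `X_i^± ⊆ X^±`. -/
def cayleyFactor (i : Fin 2) (K : Subgroup (G i)) : AGraph.{v, u, max u v} X :=
  relCayley (gen i) (Sigma.mk i) K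

/-- `p` is a normal path closed at the basepoint. -/
def IsNormalLoop (Γ : AGraph.{v, a, b} X) (p : List Γ.E) : Prop :=
  Γ.IsPath Γ.base p Γ.base ∧ IsNormalWord φ gen (Γ.pathLab p)

/-- The normal core of `Cayley(G, H)`: the union of all normal paths closed at `H · 1`.
Its vertices are the essential vertices, those on some normal path closed at `H · 1`; its edges are
the edges of such paths and their inverses. -/
def normalCore (H : Subgroup (PushoutI φ)) : AGraph.{v, max u c, max u c v} X where
  V := {x : (cayleyG φ gen H).V // ∃ p, IsNormalLoop φ gen (cayleyG φ gen H) p ∧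
    (x = (cayleyG φ gen H).base ∨
      ∃ e ∈ p, x = (cayleyG φ gen H).ι e ∨ x = (cayleyG φ gen H).τ e)}
  E := {e : (cayleyG φ gen H).E // ∃ p, IsNormalLoop φ gen (cayleyG φ gen H) p ∧
    (e ∈ p ∨ (cayleyG φ gen H).inv e ∈ p)}
  ι := fun e => ⟨(cayleyG φ gen H).ι e.1, by
    obtain ⟨e, p, hp, h | h⟩ := e
    · exact ⟨p, hp, Or.inr ⟨e, h, Or.inl rfl⟩⟩
    · exact ⟨p, hp, Or.inr ⟨_, h, Or.inr (by simp [PGraph.τ, PGraph.inv_inv])⟩⟩⟩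
  inv := fun e => ⟨(cayleyG φ gen H).inv e.1, by
    obtain ⟨e, p, hp, h⟩ := e
    exact ⟨p, hp, by simpa [PGraph.inv_inv] using h.symm⟩⟩
  lab := fun e => (cayleyG φ gen H).lab e.1
  base := ⟨(cayleyG φ gen H).base, [], ⟨rfl, [], by simp [PGraph.pathLab]⟩, Or.inl rfl⟩
  inv_inv := fun e => Subtype.ext ((cayleyG φ gen H).inv_inv e.1)
  lab_inv := fun e => (cayleyG φ gen H).lab_inv e.1

/-- `f : Γ ⊔ Cayley(G_i) → Δ` glues a copy of `Cayley(G_i)` to `Γ` along the edge `e`, whose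
colour is `i`: the edge `e` is identified with the edge of `Cayley(G_i)` that starts at `1` and has
the same label. -/
def IsGlueAlong (Γ : AGraph.{v, a, b} X) (Δ : AGraph.{v, a, b} X) (e : Γ.E) (i : Fin 2)
    (f : PGraph.Hom (Γ.sum (cayleyFactor gen i ⊥)) Δ) : Prop :=
  ∃ e₀ : (cayleyFactor gen i ⊥).E,
    (cayleyFactor gen i ⊥).ι e₀ = (cayleyFactor gen i ⊥).base ∧
    (cayleyFactor gen i ⊥).lab e₀ = Γ.lab e ∧
    f.IsQuotient
      (fun x y => (x = Sum.inl (Γ.ι e) ∧ y = Sum.inr ((cayleyFactor gen i ⊥).ι e₀)) ∨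
        (x = Sum.inl (Γ.τ e) ∧ y = Sum.inr ((cayleyFactor gen i ⊥).τ e₀)))
      (fun d d' => (d = Sum.inl e ∧ d' = Sum.inr e₀) ∨
        (d = Sum.inl (Γ.inv e) ∧ d' = Sum.inr ((cayleyFactor gen i ⊥).inv e₀)))

/-- `y₀ ≠ y₁` are the ends of two monochromatic paths of different colours that start at `x` and
whose labels represent the same element of `A`. -/
def Incompatible (Γ : AGraph.{v, a, b} X) (x y₀ y₁ : Γ.V) : Prop :=
  y₀ ≠ y₁ ∧ ∃ p₀ p₁, IsMonoPath Γ 0 x p₀ y₀ ∧ IsMonoPath Γ 1 x p₁ y₁ ∧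
    val φ gen (Γ.pathLab p₀) ∈ (PushoutI.base φ).range ∧
    val φ gen (Γ.pathLab p₁) ∈ (PushoutI.base φ).range ∧
    val φ gen (Γ.pathLab p₀) = val φ gen (Γ.pathLab p₁)

/-- The conditions under which the `X_i`-monochromatic component `C` that contains the bichromatic
vertex `x` is removed. -/
def IsRemovable (Γ : AGraph.{v, a, b} X) (i : Fin 2) (x : Γ.V) : Prop :=
  x ∈ VB Γ ∧ ∃ K : Subgroup (G i),
    PGraph.IsoOnto (cayleyFactor gen i K) (Γ.rebase x) (compV Γ i x) (compE Γ i x) ∧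
    K ≤ (φ i).range ∧
    (compV Γ i x ∩ VB Γ).ncard = K.relIndex (φ i).range ∧
    ((K = ⊥ ∧ Γ.base ∉ compV Γ i x ∩ VM Γ i) ∨ (K ≠ ⊥ ∧ Γ.base ∉ compV Γ i x))

/-- `Δ` is obtained from `Γ` by removing a removable component: all its edges and all its
monochromatic vertices are deleted. -/
def Remove (Γ : AGraph.{v, a, b} X) (Δ : AGraph.{v, a, b} X) : Prop :=
  ∃ i x, IsRemovable φ gen Γ i x ∧
    Δ.IsoOnto Γ {y | y ∉ compV Γ i x ∩ VM Γ i} {e | e ∉ compE Γ i x}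

/-- `Γ` is, for some `i`, a copy of `Cayley(G_i)` based at `1`, without bichromatic vertices. -/
def IsFreeFactorGraph (Γ : AGraph.{v, a, b} X) : Prop :=
  VB Γ = ∅ ∧ ∃ i, Γ.Iso (cayleyFactor gen i ⊥)

/-- The basepoint of `Γ` is `X_i`-monochromatic, it lies in an `X_i`-monochromatic component
isomorphic to `Cayley(G_i, K)`, and `K ∩ A` is not trivial. -/
def NeedsGluing (Γ : AGraph.{v, a, b} X) (i : Fin 2) (K : Subgroup (G i)) : Prop :=
  Γ.base ∈ VM Γ i ∧ (∃ e, Γ.ι e = Γ.base) ∧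
    PGraph.IsoOnto (cayleyFactor gen i K) Γ (compV Γ i Γ.base) (compE Γ i Γ.base) ∧
    K.comap (φ i) ≠ ⊥

/-- `Δ` is obtained from `Γ` and `Cayley(G_j, L)`, `L = K ∩ A`, by identifying the vertex `v₀ · a`
of the `X_i`-monochromatic component of the basepoint `v₀` with the vertex `L a`, for all
`a ∈ A`. -/
def GlueAtBase (Γ Δ : AGraph.{v, a, b} X) (i j : Fin 2) (K : Subgroup (G i)) : Prop :=
  ∃ f : PGraph.Hom (Γ.sum (cayleyFactor gen j ((K.comap (φ i)).map (φ j)))) Δ,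
    f.IsQuotient
      (fun x y => ∃ (α : A) (p : List Γ.E) (z : Γ.V), IsMonoPath Γ i Γ.base p z ∧
        val φ gen (Γ.pathLab p) = PushoutI.base φ α ∧
        x = Sum.inl z ∧ y = Sum.inr (Quotient.mk'' (φ j α)))
      (fun _ _ => False)

/-- Configurations of the generalized Stallings folding algorithm. During the third step `l` is the
list of the edges to which a Cayley graph still has to be glued; during the fourth step `S` is the
set of the vertices (images of the bichromatic vertices of the graph produced by the third step)
that have to be inspected. -/
inductive Config (X : Fin 2 → Type v)
  | step2 (Γ : AGraph.{v, w, w} X)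
  | step3 (Γ : AGraph.{v, w, w} X) (l : List Γ.E)
  | step4 (Γ : AGraph.{v, w, w} X) (S : Set Γ.V)
  | step5 (Γ : AGraph.{v, w, w} X)
  | step6 (Γ : AGraph.{v, w, w} X)
  | done (Γ : AGraph.{v, w, w} X)

/-- The transitions of the algorithm. All choices (which edges to fold, which edge of a component
to pick, in which order to proceed) are left open. -/
inductive Trans : Config.{v, w} X → Config.{v, w} X → Prop
  | fold₂ {Γ Δ : AGraph.{v, w, w} X} (f : PGraph.Hom Γ Δ) (hf : f.IsFold) :
      Trans (.step2 Γ) (.step2 Δ)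
  | cut₂ {Γ Δ : AGraph.{v, w, w} X} (h : Γ.CutHair Δ) : Trans (.step2 Γ) (.step2 Δ)
  | end₂ {Γ : AGraph.{v, w, w} X} (h : Γ.WellLabelled) (h' : ∀ e, ¬ Γ.IsHair e)
      (l : List Γ.E) (hl : PicksEdges Γ l) : Trans (.step2 Γ) (.step3 Γ l)
  | fold₃ {Γ Δ : AGraph.{v, w, w} X} (l : List Γ.E) (f : PGraph.Hom Γ Δ) (hf : f.IsFold) :
      Trans (.step3 Γ l) (.step3 Δ (l.map f.onE))
  | glue₃ {Γ Δ : AGraph.{v, w, w} X} (e : Γ.E) (l : List Γ.E) (i : Fin 2)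
      (f : PGraph.Hom (Γ.sum (cayleyFactor gen i ⊥)) Δ) (hf : IsGlueAlong gen Γ Δ e i f) :
      Trans (.step3 Γ (e :: l)) (.step3 Δ (l.map fun e' => f.onE (Sum.inl e')))
  | end₃ {Γ : AGraph.{v, w, w} X} (h : Γ.WellLabelled) :
      Trans (.step3 Γ []) (.step4 Γ (VB Γ))
  | fold₄ {Γ Δ : AGraph.{v, w, w} X} (S : Set Γ.V) (f : PGraph.Hom Γ Δ) (hf : f.IsFold) :
      Trans (.step4 Γ S) (.step4 Δ (f.onV '' S))
  | identify₄ {Γ Δ : AGraph.{v, w, w} X} (S : Set Γ.V) (x y₀ y₁ : Γ.V) (hx : x ∈ S)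
      (h : Incompatible φ gen Γ x y₀ y₁) (f : PGraph.Hom Γ Δ)
      (hf : f.IsQuotient (fun y z => y = y₀ ∧ z = y₁) (fun _ _ => False)) :
      Trans (.step4 Γ S) (.step4 Δ (f.onV '' S))
  | end₄ {Γ : AGraph.{v, w, w} X} (S : Set Γ.V) (h : Γ.WellLabelled)
      (h' : ∀ x ∈ S, ∀ y₀ y₁, ¬ Incompatible φ gen Γ x y₀ y₁) :
      Trans (.step4 Γ S) (.step5 Γ)
  | remove₅ {Γ Δ : AGraph.{v, w, w} X} (h : Remove φ gen Γ Δ) : Trans (.step5 Γ) (.step5 Δ)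
  | collapse₅ {Γ Δ : AGraph.{v, w, w} X} (h : ∀ i x, ¬ IsRemovable φ gen Γ i x)
      (h' : IsFreeFactorGraph gen Γ) (hV : Subsingleton Δ.V) (hE : IsEmpty Δ.E) :
      Trans (.step5 Γ) (.step6 Δ)
  | end₅ {Γ : AGraph.{v, w, w} X} (h : ∀ i x, ¬ IsRemovable φ gen Γ i x)
      (h' : ¬ IsFreeFactorGraph gen Γ) : Trans (.step5 Γ) (.step6 Γ)
  | glue₆ {Γ Δ : AGraph.{v, w, w} X} (i j : Fin 2) (hij : i ≠ j) (K : Subgroup (G i))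
      (h : NeedsGluing φ gen Γ i K) (h' : GlueAtBase φ gen Γ Δ i j K) :
      Trans (.step6 Γ) (.done Δ)
  | end₆ {Γ : AGraph.{v, w, w} X} (h : ∀ i K, ¬ NeedsGluing φ gen Γ i K) :
      Trans (.step6 Γ) (.done Γ)

/-- First step: `Γ` is a bouquet of loops labelled by words that represent the elements of `Y`
(at least one word for each element of `Y`). -/
def IsInitial (Y : Set (PushoutI φ)) (Γ : AGraph.{v, w, w} X) : Prop :=
  ∃ W : List (List ((Σ i, X i) × Bool)), {g | ∃ p ∈ W, val φ gen p = g} = Y ∧ IsBouquet W Γ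

/-- `c` occurs in a run of the algorithm on input `Y`. -/
def Reachable (Y : Set (PushoutI φ)) (c : Config.{v, w} X) : Prop :=
  ∃ Γ, IsInitial φ gen Y Γ ∧ Relation.ReflTransGen (Trans φ gen) (.step2 Γ) c

/-- `Γ` is a graph produced by the algorithm on input `Y`. -/
def IsOutput (Y : Set (PushoutI φ)) (Γ : AGraph.{v, w, w} X) : Prop :=
  Reachable φ gen Y (.done Γ)

/-- The algorithm terminates on input `Y`, whatever choices are made: it can be started, no run is
infinite, and a run can stop only with an output. -/
def Terminates (X : Fin 2 → Type v) (gen : ∀ i, X i → G i) (Y : Set (PushoutI φ)) : Prop :=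
  (∃ Γ : AGraph.{v, w, w} X, IsInitial φ gen Y Γ) ∧
  (∀ c : Config.{v, w} X, Reachable φ gen Y c →
    Acc (fun c₂ c₁ => Trans φ gen c₁ c₂) c ∧
    ((∃ Γ, c = .done Γ) ∨ ∃ c', Trans φ gen c c'))

end Amalgam

end Stallings

-- Every graph of a run maps to Cayley(G,H), where H is generated by Y. The proof shows that from
-- the end of step 4 on this map is an embedding, identifies its image with a piece of the tree of
-- cosets of the factors in G, and shows that steps 5 and 6 trim and complete this piece to exactly
-- the part crossed by reduced expressions of elements of H.
--
-- Embedding. Steps 1 to 4 keep the graph connected, keep the elements of H as the values of its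
-- loops at the basepoint, and keep a morphism to Cayley(G,H) (`Realizes`). Step 3 makes words over
-- one alphabet that represent 1 close up, so that each factor acts on the vertices that carry its
-- colour. Step 4 makes the two actions agree on A. For such a partial action the normal form
-- theorem shows that an element of G moves the basepoint to at most one vertex, whatever product of
-- syllables is used (`Reach.unique`). Two vertices with the same image in Cayley(G,H) can be
-- reached by paths representing the same element of G, hence coincide (`IsPrecover.injective`).
--
-- Tree. The image is recorded (`Represents`) by its preimages U 0, U 1 in G: H-invariant unions of
-- left cosets of the factors, connected to 1 and to all of H (`IsSubtree`). The cosets crossed by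
-- reduced expressions of elements of H, with their H-translates, form `core`; when H meets A
-- nontrivially the factors themselves are added. Since reduced expressions leave no freedom, a
-- subtree contains the core as soon as it contains the added factors (`IsSubtree.core_subset`).
-- Conversely, from a coset outside the core that is not a leaf one can move outward to another
-- coset outside the core, one syllable further from 1 even modulo H. Iterating this contradicts
-- finiteness, so a subtree without leaves lies in the core (`IsSubtree.subset_core`). The
-- exception, a single free factor with H trivial, is the collapsing clause of step 5. Removable
-- components are precisely leaves (`Represents.isLeaf_of_isRemovable`,
-- `Represents.isRemovable_of_isLeaf`), and step 6 supplies the one factor that may be missing at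
-- the basepoint (`RepresentsInCore.glueAtBase`).
--
-- Conclusion. The core describes the normal core of Cayley(G,H) edge by edge
-- (`mem_core_of_isNormalLoop`, `exists_isNormalLoop`), and this depends on H only. A lexicographic
-- measure gives termination, and each operation is possible whenever its condition holds.

universe r s

/-! ### Reduced products in an amalgam, and partial actions of its factors -/

namespace Stallings

section Tree

variable {G : Type*} [Group G]

/-- Alternating lists of syllables from the factors `F i`, none of them in `A`. -/
def IsReducedList (F : Fin 2 → Subgroup G) (A : Subgroup G) (L : List (Fin 2 × G)) : Prop :=
  (∀ s ∈ L, s.2 ∈ F s.1 ∧ s.2 ∉ A) ∧ L.IsChain (fun s t => s.1 ≠ t.1)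

/-- `g` is a product of alternating syllables outside `A`, the last one in `F i`. -/
inductive EndsIn (F : Fin 2 → Subgroup G) (A : Subgroup G) : Fin 2 → G → Prop
  | single {i k} : k ∈ F i → k ∉ A → EndsIn F A i k
  | step {i j g k} : EndsIn F A j g → j ≠ i → k ∈ F i → k ∉ A → EndsIn F A i (g * k)

/-- `G` is generated by `F 0`, `F 1`, and satisfies the normal form theorem for amalgams. -/
structure IsAmalgam (F : Fin 2 → Subgroup G) (A : Subgroup G) : Prop where
  le : ∀ i, A ≤ F i
  total : ∀ g, g ∈ A ∨ ∃ i, EndsIn F A i g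
  eq_nil : ∀ L, IsReducedList F A L → (L.map Prod.snd).prod ∈ A → L = []

variable {F : Fin 2 → Subgroup G} {A : Subgroup G}

theorem EndsIn.exists_list {i : Fin 2} {g : G} (hg : EndsIn F A i g) :
    ∃ L s, IsReducedList F A (L ++ [(i, s)]) ∧ (L.map Prod.snd).prod * s = g := by
  induction hg with
  | @single i k h h' => exact ⟨[], k, by simp [IsReducedList, h, h'], by simp⟩
  | @step i j g k hg hij hk hk' ih =>
    obtain ⟨L, s, ⟨h1, h2⟩, rfl⟩ := ih
    refine ⟨L ++ [(j, s)], k, ⟨?_, ?_⟩, by simp⟩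
    · intro t ht
      rcases List.mem_append.1 ht with ht | ht
      · exact h1 t ht
      · rw [List.mem_singleton] at ht
        subst ht
        exact ⟨hk, hk'⟩
    · rw [List.isChain_append]
      refine ⟨h2, by simp, ?_⟩
      intro x hx y hy
      simp at hx hy
      subst hx hy
      exact hij

theorem IsReducedList.endsIn {L : List (Fin 2 × G)} {s : Fin 2 × G}
    (h : IsReducedList F A (L ++ [s])) : EndsIn F A s.1 ((L.map Prod.snd).prod * s.2) := by
  induction L using List.reverseRecOn generalizing s with
  | nil =>
    obtain ⟨h1, -⟩ := h
    have := h1 s (by simp)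
    simpa using EndsIn.single this.1 this.2
  | append_singleton L t ih =>
    obtain ⟨h1, h2⟩ := h
    rw [List.isChain_append] at h2
    have hs := h1 s (by simp)
    have := ih (s := t) ⟨fun x hx => h1 x (by simp at hx ⊢; tauto), h2.1⟩
    have h3 := h2.2.2 t (by simp) s (by simp)
    simpa using EndsIn.step this h3 hs.1 hs.2

theorem IsReducedList.inv {L : List (Fin 2 × G)} (h : IsReducedList F A L) :
    IsReducedList F A ((L.map fun s => (s.1, s.2⁻¹)).reverse) := by
  refine ⟨?_, ?_⟩
  · intro s hs
    simp only [List.mem_reverse, List.mem_map] at hs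
    obtain ⟨t, ht, rfl⟩ := hs
    simpa using h.1 t ht
  · rw [List.isChain_reverse, List.isChain_map]
    exact h.2.imp fun x y hxy => hxy.symm

theorem prod_map_inv_reverse (L : List (Fin 2 × G)) :
    (((L.map fun s => (s.1, s.2⁻¹)).reverse).map Prod.snd).prod = (L.map Prod.snd).prod⁻¹ := by
  rw [List.prod_inv_reverse]
  simp [List.map_reverse, Function.comp_def]

theorem EndsIn.mul_right {i : Fin 2} {g a : G} (hg : EndsIn F A i g) (hle : A ≤ F i)
    (ha : a ∈ A) : EndsIn F A i (g * a) := by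
  cases hg with
  | single h h' =>
    exact .single (mul_mem h (hle ha)) (by rwa [Subgroup.mul_mem_cancel_right _ ha])
  | step h hij hk hk' =>
    rw [mul_assoc]
    exact .step h hij (mul_mem hk (hle ha)) (by rwa [Subgroup.mul_mem_cancel_right _ ha])

namespace IsAmalgam

theorem notMem (hA : IsAmalgam F A) {i : Fin 2} {g : G} (hg : EndsIn F A i g) : g ∉ A := by
  intro h
  obtain ⟨L, s, hL, rfl⟩ := hg.exists_list
  simpa using hA.eq_nil _ hL (by simpa using h)

/-- If the last factors differed, one reduced expression followed by the inverse of the other would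
still alternate at the junction while its product is 1, against the normal form theorem. -/
theorem unique (hA : IsAmalgam F A) {i j : Fin 2} {g : G} (hi : EndsIn F A i g)
    (hj : EndsIn F A j g) : i = j := by
  by_contra hij
  obtain ⟨L, s, hL, hg⟩ := hi.exists_list
  obtain ⟨M, t, hM, hg'⟩ := hj.exists_list
  have hM' := hM.inv
  have key := hA.eq_nil (L ++ [(i, s)] ++ ((M ++ [(j, t)]).map fun s => (s.1, s.2⁻¹)).reverse)
    ⟨fun x hx => (List.mem_append.1 hx).elim (hL.1 x) (hM'.1 x), by
      rw [List.isChain_append]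
      refine ⟨hL.2, hM'.2, fun x hx y hy => ?_⟩
      simp at hx hy
      subst hx hy
      exact hij⟩ (by
      rw [List.map_append, List.prod_append, prod_map_inv_reverse]
      simp [hg, hg'])
  simp at key

theorem mul_endsIn (hA : IsAmalgam F A) {i : Fin 2} {g k : G} (hg : ¬ EndsIn F A i g)
    (hk : k ∈ F i) (hk' : k ∉ A) : EndsIn F A i (g * k) := by
  rcases hA.total g with h | ⟨j, h⟩
  · exact .single (mul_mem (hA.le i h) hk) (by rwa [Subgroup.mul_mem_cancel_left _ h])
  · exact .step h (by rintro rfl; exact hg h) hk hk'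

theorem not_endsIn_of_mem (hA : IsAmalgam F A) {i : Fin 2} {g : G} (h : g ∈ A) :
    ¬ EndsIn F A i g := fun h' => hA.notMem h' h

theorem not_endsIn_of_ne (hA : IsAmalgam F A) {i j : Fin 2} {g : G} (h : EndsIn F A j g)
    (hij : j ≠ i) : ¬ EndsIn F A i g := fun h' => hij (hA.unique h h')

theorem exists_eq_mul (hA : IsAmalgam F A) {i : Fin 2} {g : G} (hg : EndsIn F A i g) :
    ∃ g' k, g = g' * k ∧ k ∈ F i ∧ k ∉ A ∧ ¬ EndsIn F A i g' := by
  cases hg with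
  | single h h' => exact ⟨1, g, by simp, h, h', hA.not_endsIn_of_mem (one_mem _)⟩
  | step h hij hk hk' => exact ⟨_, _, rfl, hk, hk', hA.not_endsIn_of_ne h hij⟩

theorem endsIn_of_mem (hA : IsAmalgam F A) {i j : Fin 2} {g : G} (hg : EndsIn F A i g)
    (h : g ∈ F j) : i = j :=
  hA.unique hg (.single h (hA.notMem hg))

end IsAmalgam

section PartialAction

variable {V : Type*}

/-- Each factor acts on the right on a subset of `V`, and the actions of the two factors agree on
`A` wherever both are defined. `Act i x g y` says that `g ∈ F i` moves `x` to `y`. -/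
structure IsPartialAction (F : Fin 2 → Subgroup G) (A : Subgroup G)
    (Act : Fin 2 → V → G → V → Prop) : Prop where
  mem : ∀ {i x g y}, Act i x g y → g ∈ F i
  mul : ∀ {i x g y k z}, Act i x g y → Act i y k z → Act i x (g * k) z
  inv : ∀ {i x g y}, Act i x g y → Act i y g⁻¹ x
  total : ∀ {i x g y k}, Act i x g y → k ∈ F i → ∃ z, Act i x k z
  func : ∀ {i x g y z}, Act i x g y → Act i x g z → y = z
  compat : ∀ {i j x g y k z}, Act i x g y → g ∈ A → Act j x k z → Act j x g y

/-- `g` is a product of syllables that moves the basepoint `o` to `x`. -/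
inductive Reach (Act : Fin 2 → V → G → V → Prop) (o : V) : G → V → Prop
  | one : Reach Act o 1 o
  | step {i g x k y} : Reach Act o g x → Act i x k y → Reach Act o (g * k) y

/-- `g` is a reduced product of syllables, the last one in `F i`, that moves `o` to `x`. -/
inductive ReducedReach (A : Subgroup G) (Act : Fin 2 → V → G → V → Prop) (o : V) :
    Fin 2 → G → V → Prop
  | single {i k x} : Act i o k x → k ∉ A → ReducedReach A Act o i k x
  | step {i j g x k y} : ReducedReach A Act o j g x → j ≠ i → Act i x k y → k ∉ A →
      ReducedReach A Act o i (g * k) y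

variable {Act : Fin 2 → V → G → V → Prop} {o : V}

theorem ReducedReach.endsIn (hP : IsPartialAction F A Act) {i : Fin 2} {g : G} {x : V}
    (h : ReducedReach A Act o i g x) : EndsIn F A i g := by
  induction h with
  | single h h' => exact .single (hP.mem h) h'
  | step _ hij hk hk' ih => exact .step ih hij (hP.mem hk) hk'

/-- Reversing the last syllable shows that its factor acts at the endpoint. This is what `compat`
requires before an element of A can be handed over to that factor. -/
theorem ReducedReach.exists_act (hP : IsPartialAction F A Act) {i : Fin 2} {g : G} {x : V}
    (h : ReducedReach A Act o i g x) : ∃ k z, Act i x k z := by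
  cases h with
  | single h h' => exact ⟨_, _, hP.inv h⟩
  | step _ hij hk hk' => exact ⟨_, _, hP.inv hk⟩

theorem ReducedReach.mul_right (hP : IsPartialAction F A Act) {i : Fin 2} {g a : G} {x y : V}
    (h : ReducedReach A Act o i g x) (ha : a ∈ A) (hx : Act i x a y) :
    ReducedReach A Act o i (g * a) y := by
  cases h with
  | single h h' => exact .single (hP.mul h hx) (by rwa [Subgroup.mul_mem_cancel_right _ ha])
  | step h hij hk hk' =>
    rw [mul_assoc]
    exact .step h hij (hP.mul hk hx) (by rwa [Subgroup.mul_mem_cancel_right _ ha])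

/-- Any product can be normalized without changing where it moves the basepoint: a new syllable is
appended, merged with the last one if the factors agree, or absorbed if it lies in A. Absorption is
possible because the actions of the factors agree on A. -/
theorem Reach.cases_reduced (hP : IsPartialAction F A Act) {g : G} {x : V}
    (h : Reach Act o g x) :
    (g = 1 ∧ x = o) ∨ (g ∈ A ∧ ∃ i, Act i o g x) ∨ ∃ i, ReducedReach A Act o i g x := by
  induction h with
  | one => exact .inl ⟨rfl, rfl⟩
  | @step i g x k y _ hk ih =>
    right
    rcases ih with ⟨rfl, rfl⟩ | ⟨hg, j, hj⟩ | ⟨j, hj⟩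
    · rw [one_mul]
      by_cases hA : k ∈ A
      · exact .inl ⟨hA, i, hk⟩
      · exact .inr ⟨i, .single hk hA⟩
    · have h1 := hP.inv (hP.compat (hP.inv hj) (inv_mem hg) hk)
      rw [inv_inv] at h1
      have h2 := hP.mul h1 hk
      by_cases hA : g * k ∈ A
      · exact .inl ⟨hA, i, h2⟩
      · exact .inr ⟨i, .single h2 hA⟩
    · by_cases hA : k ∈ A
      · obtain ⟨k', z, h'⟩ := hj.exists_act hP
        exact .inr ⟨j, hj.mul_right hP hA (hP.compat hk hA h')⟩
      by_cases hij : j = i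
      · subst hij
        cases hj with
        | single h h' =>
          by_cases hA' : g * k ∈ A
          · exact .inl ⟨hA', j, hP.mul h hk⟩
          · exact .inr ⟨j, .single (hP.mul h hk) hA'⟩
        | @step _ l g' x' k' _ h hlj hk' hk'' =>
          rw [mul_assoc]
          have h2 := hP.mul hk' hk
          by_cases hA' : k' * k ∈ A
          -- The merged syllable has fallen into A, so it is absorbed by the preceding one.
          · obtain ⟨k₁, z, h'⟩ := h.exists_act hP
            exact .inr ⟨l, h.mul_right hP hA' (hP.compat h2 hA' h')⟩
          · exact .inr ⟨j, .step h hlj h2 hA'⟩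
      · exact .inr ⟨i, .step hj hij hk hA⟩

/-- Two reduced expressions of the same element differ at the last junction only by an element of A.
Shifting that element into the preceding syllable leaves two expressions of the same shorter
element, to which induction applies. -/
theorem ReducedReach.unique (hA : IsAmalgam F A) (hP : IsPartialAction F A Act) {i : Fin 2}
    {g : G} {x y : V} (hx : ReducedReach A Act o i g x) (hy : ReducedReach A Act o i g y) :
    x = y := by
  -- A single syllable is never equal to a longer reduced product with the same last factor: the
  -- prefix would lie in that factor and yet end in the other one.
  have aux : ∀ {i j : Fin 2} {k g' k' : G}, j ≠ i → k ∈ F i → k' ∈ F i → EndsIn F A j g' →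
      k ≠ g' * k' := by
    rintro i j k g' k' hij hk hk' hg' rfl
    exact hij (hA.endsIn_of_mem hg' (by simpa using mul_mem hk (inv_mem hk')))
  induction hx generalizing y with
  | @single i k x h h' =>
    generalize hg : k = g₀ at hy
    cases hy with
    | single h₁ h₁' => subst hg; exact hP.func h h₁
    | step h₁ hij hk hk' =>
      exact absurd hg (aux hij (hP.mem h) (hP.mem hk) (h₁.endsIn hP))
  | @step i j g₁ x₁ k₁ x h₁ hij hk₁ hk₁' ih =>
    generalize hg : g₁ * k₁ = g₀ at hy
    cases hy with
    | single h₂ h₂' =>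
      exact absurd hg.symm (aux hij (hP.mem h₂) (hP.mem hk₁) (h₁.endsIn hP))
    | @step _ l g₂ x₂ k₂ _ h₂ hlj hk₂ hk₂' =>
      obtain rfl : j = l := by omega
      have hg2 : g₂ = g₁ * (k₁ * k₂⁻¹) := by rw [← mul_assoc, hg]; simp
      have hF : k₁ * k₂⁻¹ ∈ F i := mul_mem (hP.mem hk₁) (inv_mem (hP.mem hk₂))
      -- Otherwise the second prefix would end in `i` as well as in `j`.
      have ha : k₁ * k₂⁻¹ ∈ A := by
        by_contra ha
        have := EndsIn.step (h₁.endsIn hP) hij hF ha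
        rw [← hg2] at this
        exact hij (hA.unique (h₂.endsIn hP) this)
      obtain ⟨z, hz⟩ := hP.total hk₂ (inv_mem hF)
      obtain ⟨k', z', h'⟩ := h₂.exists_act hP
      -- The correcting element is defined at `x₂` through factor `i`; by compatibility it also acts
      -- through `j`, and so can be merged into the prefix.
      have h3 := h₂.mul_right hP (inv_mem ha) (hP.compat hz (inv_mem ha) h')
      rw [hg2, mul_inv_cancel_right] at h3
      obtain rfl := ih h3
      have h4 := hP.mul hz hk₁
      simp at h4
      exact hP.func h4 hk₂

/-- After normalization, elements of A are never reduced products, and the last factor of a reduced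
product is determined. The coincidences that remain are settled by functionality of the action or by
`ReducedReach.unique`. This replaces the usual extension to a full action of the amalgam. -/
theorem Reach.unique (hA : IsAmalgam F A) (hP : IsPartialAction F A Act)
    {g : G} {x y : V} (hx : Reach Act o g x) (hy : Reach Act o g y) : x = y := by
  have fix : ∀ {i z}, Act i o 1 z → z = o := by
    intro i z h
    have := hP.mul h (hP.inv h)
    simp at this
    exact hP.func h this
  rcases hx.cases_reduced hP with ⟨h1, rfl⟩ | ⟨hg, i, hi⟩ | ⟨i, hi⟩ <;>
    rcases hy.cases_reduced hP with ⟨h2, rfl⟩ | ⟨hg', j, hj⟩ | ⟨j, hj⟩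
  · rfl
  · exact (fix (h1 ▸ hj)).symm
  · exact absurd (h1 ▸ one_mem A) (hA.notMem (hj.endsIn hP))
  · exact fix (h2 ▸ hi)
  · exact hP.func (hP.compat hi hg hj) hj
  · exact absurd hg (hA.notMem (hj.endsIn hP))
  · exact absurd (h2 ▸ one_mem A) (hA.notMem (hi.endsIn hP))
  · exact absurd hg' (hA.notMem (hi.endsIn hP))
  · obtain rfl := hA.unique (hi.endsIn hP) (hj.endsIn hP)
    exact hi.unique hA hP hj

end PartialAction

end Tree

end Stallings

/-! ### Subtrees of the tree of cosets, the core and the leaves -/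

namespace Stallings

section Core

variable {G : Type*} [Group G]

/-- The partial action by right multiplication of the factors `F i` on the sets `U i`. -/
def mulAct (F : Fin 2 → Subgroup G) (U : Fin 2 → Set G) (i : Fin 2) (x g y : G) : Prop :=
  x ∈ U i ∧ g ∈ F i ∧ y = x * g

/-- `U` describes a connected `H`-invariant subgraph of the Cayley graph of `G` that contains `1`
and consists of whole cosets of the factors. -/
structure IsSubtree (F : Fin 2 → Subgroup G) (H : Subgroup G) (U : Fin 2 → Set G) : Prop where
  mulMem : ∀ {i g k}, g ∈ U i → k ∈ F i → g * k ∈ U i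
  smulMem : ∀ {i g h}, g ∈ U i → h ∈ H → h * g ∈ U i
  reach : ∀ {i g}, g ∈ U i → Reach (mulAct F U) 1 g g
  reach_of_mem : ∀ {h}, h ∈ H → Reach (mulAct F U) 1 h h

/-- The cosets `g' F i` crossed by a reduced expression of an element of `H`, moved by `H`. The
factors themselves are crossed as soon as `H ∩ A` is not trivial. -/
def core (F : Fin 2 → Subgroup G) (A H : Subgroup G) (i : Fin 2) : Set G :=
  {g | ∃ h ∈ H, ∃ g', g'⁻¹ * (h * g) ∈ F i ∧
    ((∃ r, g' * r ∈ H ∧ ¬ EndsIn F A i g' ∧ EndsIn F A i r⁻¹) ∨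
      (g' = 1 ∧ ∃ a ∈ H, a ∈ A ∧ a ≠ 1))}

/-- `g` is a product of `n` alternating syllables outside `A`, the last one not in `F i`. -/
inductive Entry (F : Fin 2 → Subgroup G) (A : Subgroup G) : ℕ → Fin 2 → G → Prop
  | nil {i a} : a ∈ A → Entry F A 0 i a
  | snoc {n i j g k} : Entry F A n i g → i ≠ j → k ∈ F i → k ∉ A → Entry F A (n + 1) j (g * k)

variable {F : Fin 2 → Subgroup G} {A H : Subgroup G} {U : Fin 2 → Set G}

theorem Entry.endsIn (hA : IsAmalgam F A) {n : ℕ} {i j : Fin 2} {g : G}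
    (h : Entry F A (n + 1) i g) (hij : i ≠ j) : EndsIn F A j g := by
  obtain ⟨m, rfl⟩ : ∃ m, m = n := ⟨n, rfl⟩
  generalize hm : m + 1 = l at h
  induction h generalizing j m with
  | nil => omega
  | @snoc n i₁ j₁ g₁ k h hij₁ hk hk' ih =>
    obtain rfl : i₁ = j := by omega
    refine hA.mul_endsIn ?_ hk hk'
    cases n with
    | zero =>
      cases h with
      | nil ha => exact hA.not_endsIn_of_mem ha
    | succ n => exact hA.not_endsIn_of_ne (ih hij₁ n rfl) hij₁.symm

theorem Entry.not_endsIn (hA : IsAmalgam F A) {n : ℕ} {i : Fin 2} {g : G}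
    (h : Entry F A n i g) : ¬ EndsIn F A i g := by
  cases n with
  | zero =>
    cases h with
    | nil ha => exact hA.not_endsIn_of_mem ha
  | succ n =>
    obtain ⟨j, hj⟩ : ∃ j, i ≠ j := (exists_ne i).imp fun _ h => h.symm
    exact hA.not_endsIn_of_ne (h.endsIn hA hj) hj.symm

theorem EndsIn.exists_entry {i j : Fin 2} {g : G} (h : EndsIn F A j g) (hij : j ≠ i) :
    ∃ n, Entry F A (n + 1) i g := by
  induction h generalizing i with
  | @single j k hk hk' => exact ⟨0, by simpa using Entry.snoc (.nil (one_mem A)) hij hk hk'⟩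
  | @step j l g k hg hlj hk hk' ih =>
    obtain ⟨n, hn⟩ := ih hlj
    exact ⟨n + 1, .snoc hn hij hk hk'⟩

theorem IsAmalgam.exists_entry (hA : IsAmalgam F A) {i : Fin 2} {g : G}
    (h : ¬ EndsIn F A i g) : ∃ n, Entry F A n i g := by
  rcases hA.total g with hg | ⟨j, hj⟩
  · exact ⟨0, .nil hg⟩
  · obtain ⟨n, hn⟩ := hj.exists_entry (i := i) (by rintro rfl; exact h hj)
    exact ⟨_, hn⟩

theorem IsSubtree.isPartialAction (hA : IsAmalgam F A) (hU : IsSubtree F H U) :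
    IsPartialAction F A (mulAct F U) where
  mem h := h.2.1
  mul := by
    rintro i x g y k z ⟨hx, hg, rfl⟩ ⟨_, hk, rfl⟩
    exact ⟨hx, mul_mem hg hk, mul_assoc _ _ _⟩
  inv := by
    rintro i x g y ⟨hx, hg, rfl⟩
    exact ⟨hU.mulMem hx hg, inv_mem hg, by simp⟩
  total h hk := ⟨_, h.1, hk, rfl⟩
  func := by
    rintro i x g y z ⟨-, -, rfl⟩ ⟨-, -, rfl⟩
    rfl
  compat := by
    rintro i j x g y k z ⟨hx, hg, rfl⟩ hgA ⟨hx', hk, rfl⟩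
    exact ⟨hx', hA.le j hgA, rfl⟩

theorem Reach.eq_of_mulAct {g x : G} (h : Reach (mulAct F U) 1 g x) : x = g := by
  induction h with
  | one => rfl
  | step _ hk ih => rw [hk.2.2, ih]

/-- Normalizing the product that leads to `g` inside the subtree keeps it inside, and its last
syllable must be the `F i`-syllable in which `g` ends. -/
theorem IsSubtree.mem_of_reach (hA : IsAmalgam F A) (hU : IsSubtree F H U) {i : Fin 2} {g : G}
    (hg : Reach (mulAct F U) 1 g g) (hi : EndsIn F A i g) : g ∈ U i := by
  have hP : IsPartialAction F A (mulAct F U) := hU.isPartialAction hA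
  rcases hg.cases_reduced hP with ⟨h, -⟩ | ⟨h, -⟩ | ⟨j, hj⟩
  · exact absurd (h ▸ one_mem A) (hA.notMem hi)
  · exact absurd h (hA.notMem hi)
  · obtain rfl := hA.unique hi (hj.endsIn hP)
    obtain ⟨k, z, h⟩ := hj.exists_act hP
    exact h.1

/-- There is no cancellation between `g` and the inverse of `s`, whose first syllable lies in `F i`.
The reduced way from 1 to the product therefore crosses the coset `g F i`, and a subtree containing
the endpoint contains this coset. The induction moves back from the endpoint one syllable at a time.
-/
theorem IsSubtree.mem_of_reach_mul_inv (hA : IsAmalgam F A) (hU : IsSubtree F H U) {i : Fin 2}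
    {g s : G} (hs : EndsIn F A i s) (hr : Reach (mulAct F U) 1 (g * s⁻¹) (g * s⁻¹))
    (hg : ¬ EndsIn F A i g) : g ∈ U i := by
  have aux : ∀ {i : Fin 2} {g k : G}, Reach (mulAct F U) 1 (g * k⁻¹) (g * k⁻¹) →
      ¬ EndsIn F A i g → k ∈ F i → k ∉ A → g ∈ U i := by
    intro i g k hr hg hk hk'
    have := hU.mem_of_reach hA hr (hA.mul_endsIn hg (inv_mem hk) (by simpa using hk'))
    simpa using hU.mulMem this hk
  induction hs generalizing g with
  | single hk hk' => exact aux hr hg hk hk'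
  | @step i j s k _ hij hk hk' ih =>
    refine aux (hU.reach (ih ?_ ?_)) hg hk hk'
    · simpa [mul_assoc] using hr
    · exact hA.not_endsIn_of_ne (hA.mul_endsIn hg (inv_mem hk) (by simpa using hk')) hij.symm

/-- A subtree reaches every element of `H`, and the reduced way there is forced. Only the factors
that the core contains because of `H ∩ A` are not visible in this way, hence the extra hypothesis.
-/
theorem IsSubtree.core_subset (hA : IsAmalgam F A) (hU : IsSubtree F H U) {i : Fin 2}
    (h1 : (∃ a ∈ H, a ∈ A ∧ a ≠ 1) → 1 ∈ U i) : core F A H i ⊆ U i := by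
  rintro g ⟨h, hh, g', hg', H'⟩
  have : g' ∈ U i := by
    rcases H' with ⟨r, hr, hg, hi⟩ | ⟨rfl, ha⟩
    · refine hU.mem_of_reach_mul_inv hA hi (hU.reach_of_mem (by simpa using hr)) hg
    · exact h1 ha
  simpa using hU.smulMem (hU.mulMem this hg') (inv_mem hh)

theorem mem_core_of_mul_mem {i : Fin 2} {g x : G} (h : g * x ∈ H) (hg : ¬ EndsIn F A i g)
    (hx : EndsIn F A i x⁻¹) : g ∈ core F A H i :=
  ⟨1, one_mem _, g, by simp, .inl ⟨x, h, hg, hx⟩⟩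

theorem core_mul_mem {i : Fin 2} {g k : G} (hg : g ∈ core F A H i) (hk : k ∈ F i) :
    g * k ∈ core F A H i := by
  obtain ⟨h, hh, g', hg', H'⟩ := hg
  exact ⟨h, hh, g', by simpa [mul_assoc] using mul_mem hg' hk, H'⟩

/-- The coset `g F i` is a leaf of the quotient by `H`, attached along `g A`, that does not carry
the basepoint in an essential way. -/
def IsLeaf (F : Fin 2 → Subgroup G) (A H : Subgroup G) (U : Fin 2 → Set G) (i j : Fin 2) (g : G) :
    Prop :=
  g ∈ U i ∧ g ∈ U j ∧ (∀ k ∈ F i, g * k * g⁻¹ ∈ H → k ∈ A) ∧ (∀ k ∈ F i, g * k ∈ U j → k ∈ A) ∧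
    (((∀ k ∈ F i, g * k * g⁻¹ ∈ H → k = 1) ∧ ¬ ((∃ h ∈ H, g⁻¹ * h ∈ F i) ∧ 1 ∉ U j)) ∨
      ((∃ k ∈ F i, g * k * g⁻¹ ∈ H ∧ k ≠ 1) ∧ ¬ ∃ h ∈ H, g⁻¹ * h ∈ F i))

/-- A coset outside the core that is entered along `g A` must have another exit. If it had none, its
stabilizer and its elements from `H` would be confined so strongly that it would be a leaf, or else
the whole subtree would be one free factor. -/
theorem IsSubtree.exists_mul_mem (hA : IsAmalgam F A) (hU : IsSubtree F H U) {i j : Fin 2}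
    (hij : i ≠ j) (hleaf : ∀ g, ¬ IsLeaf F A H U i j g)
    (hfree : ¬ (H = ⊥ ∧ U j = ∅ ∧ U i = F i)) {g : G} (hg : g ∈ U i) (hc : g ∉ core F A H i)
    (he : ¬ EndsIn F A i g) : ∃ k ∈ F i, k ∉ A ∧ g * k ∈ U j := by
  by_contra! hno
  have hno' : ∀ k ∈ F i, g * k ∈ U j → k ∈ A := fun k hk h => by
    by_contra hk'
    exact hno k hk hk' h
  have hK : ∀ k ∈ F i, g * k * g⁻¹ ∈ H → k ∈ A := by
    intro k hk hkH
    by_contra hk'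
    refine hc (mem_core_of_mul_mem (x := k * g⁻¹) (by simpa [mul_assoc] using hkH) he ?_)
    simpa using hA.mul_endsIn he (inv_mem hk) (by simpa using hk')
  -- An element of `H` in the coset but off `g A` would have a reduced expression crossing the
  -- coset.
  have hHA : (∃ h ∈ H, g⁻¹ * h ∈ F i) → ∃ h ∈ H, g⁻¹ * h ∈ A := by
    rintro ⟨h, hh, hgh⟩
    refine ⟨h, hh, ?_⟩
    by_contra hgA
    refine hc (mem_core_of_mul_mem (x := g⁻¹ * h) (by simpa using hh) he ?_)
    exact .single (inv_mem hgh) (by rwa [inv_mem_iff])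
  -- If an element of `H` lies in the coset, the coset is an `H`-translate of `F i`. A nontrivial
  -- stabilizer would be conjugate to a nontrivial subgroup of `H ∩ A`, which puts `F i` itself into
  -- the core.
  have hK1 : (∃ h ∈ H, g⁻¹ * h ∈ F i) → ∀ k ∈ F i, g * k * g⁻¹ ∈ H → k = 1 := by
    rintro hex k hk hkH
    obtain ⟨h, hh, hgh⟩ := hHA hex
    by_contra hk1
    refine hc ⟨h⁻¹, inv_mem hh, 1, by simpa using hA.le i (inv_mem hgh), .inr ⟨rfl, ?_⟩⟩
    refine ⟨(g⁻¹ * h)⁻¹ * k * (g⁻¹ * h), ?_, ?_, ?_⟩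
    · simpa [mul_assoc] using mul_mem (inv_mem hh) (mul_mem hkH hh)
    · exact mul_mem (mul_mem (inv_mem hgh) (hK k hk hkH)) hgh
    · intro h1
      apply hk1
      have := congrArg (fun x => (g⁻¹ * h) * x * (g⁻¹ * h)⁻¹) h1
      simpa [mul_assoc] using this
  by_cases hgj : g ∈ U j
  · refine hleaf g ⟨hg, hgj, hK, hno', ?_⟩
    by_cases hex : ∃ h ∈ H, g⁻¹ * h ∈ F i
    · refine .inl ⟨hK1 hex, fun hn => hn.2 ?_⟩
      obtain ⟨h, hh, hgh⟩ := hHA hex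
      simpa using hU.smulMem (hU.mulMem hgj (hA.le j hgh)) (inv_mem hh)
    · by_cases hk : ∃ k ∈ F i, g * k * g⁻¹ ∈ H ∧ k ≠ 1
      · exact .inr ⟨hk, hex⟩
      · push Not at hk
        exact .inl ⟨hk, fun hn => hex hn.1⟩
  -- The coset is not attached to the other colour at `g`, so nothing was crossed to enter it: it is
  -- `F i`, and the subtree turns out to be confined to it.
  · have hgA : g ∈ A := by
      rcases hA.total g with h | ⟨l, hl⟩
      · exact h
      · obtain rfl : l = j := by
          have : l ≠ i := by rintro rfl; exact he hl
          omega
        exact absurd (hU.mem_of_reach hA (hU.reach hg) hl) hgj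
    have hdis : ∀ k ∈ F i, k ∉ U j := by
      intro k hk hkj
      have := hno' (g⁻¹ * k) (mul_mem (inv_mem (hA.le i hgA)) hk) (by simpa using hkj)
      apply hgj
      simpa using hU.mulMem hkj (hA.le j (inv_mem this))
    have hreach : ∀ x y, Reach (mulAct F U) 1 x y → x ∈ F i := by
      intro x y h
      induction h with
      | one => exact one_mem _
      | @step l x y k z h hk ih =>
        obtain rfl := h.eq_of_mulAct
        have hl : l ≠ j := by
          rintro rfl
          exact hdis _ ih hk.1
        obtain rfl : l = i := by omega
        exact mul_mem ih hk.2.1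
    have hgF := hA.le i hgA
    have hex : ∃ h ∈ H, g⁻¹ * h ∈ F i := ⟨1, one_mem _, by simpa using hgF⟩
    refine hfree ⟨?_, ?_, ?_⟩
    · rw [Subgroup.eq_bot_iff_forall]
      intro h hh
      have hF : h ∈ F i := hreach h h (hU.reach_of_mem hh)
      have := hK1 hex (g⁻¹ * h * g) (mul_mem (mul_mem (inv_mem hgF) hF) hgF)
        (by simpa [mul_assoc] using hh)
      simpa [mul_assoc, inv_mul_eq_one, eq_comm] using this
    · rw [Set.eq_empty_iff_forall_notMem]
      exact fun x hx => hdis x (hreach x x (hU.reach hx)) hx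
    · ext x
      refine ⟨fun hx => hreach x x (hU.reach hx), fun hx => ?_⟩
      simpa using hU.mulMem hg (mul_mem (inv_mem hgF) hx)

/-- If the next coset were crossed by an expression of an element of `H`, one could start with `g k`
and follow that expression to its end or back to its beginning. This gives an element of `H` whose
expression crosses `g F i`. -/
theorem IsAmalgam.notMem_core_mul (hA : IsAmalgam F A) {i j : Fin 2}
    (hij : i ≠ j) {g k : G} (hc : g ∉ core F A H i) (he : ¬ EndsIn F A i g)
    (hk : k ∈ F i) (hk' : k ∉ A) : g * k ∉ core F A H j := by
  rintro ⟨h, hh, g₁, hm, H'⟩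
  obtain ⟨m, hm', hg₁⟩ : ∃ m ∈ F j, h * (g * k) = g₁ * m := ⟨_, hm, by simp⟩
  have hk'' : k⁻¹ ∉ A := by simpa using hk'
  have key : ∀ x, g * (k * x) ∈ H → ¬ EndsIn F A i x⁻¹ → False := by
    intro x hx hx'
    refine hc (mem_core_of_mul_mem hx he ?_)
    simpa using hA.mul_endsIn hx' (inv_mem hk) hk''
  have hgk : g * (k * (m⁻¹ * g₁⁻¹)) ∈ H := by
    have : g * k = h⁻¹ * (g₁ * m) := by rw [← hg₁]; simp
    rw [← mul_assoc, this]
    simpa [mul_assoc] using hh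
  -- For `m ∈ A` the expression enters the coset where `g k` does, and is followed forward.
  -- Otherwise it enters elsewhere, and is followed backward to 1.
  by_cases hmA : m ∈ A
  · rcases H' with ⟨r, hr, -, hr'⟩ | ⟨rfl, -⟩
    · refine key (m⁻¹ * r) ?_ ?_
      · simpa [mul_assoc] using mul_mem hgk hr
      · simpa using hA.not_endsIn_of_ne (hr'.mul_right (hA.le j) hmA) hij.symm
    · exact key _ hgk (hA.not_endsIn_of_mem (by simpa using hmA))
  · refine key _ hgk ?_
    have : ¬ EndsIn F A j g₁ := by
      rcases H' with ⟨r, -, h, -⟩ | ⟨rfl, -⟩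
      · exact h
      · exact hA.not_endsIn_of_mem (one_mem A)
    simpa using hA.not_endsIn_of_ne (hA.mul_endsIn this hm' hmA) hij.symm

/-- The numbers of syllables of the reduced expressions that lead into the coset `g F i`, up to
the action of `H`. -/
def entryLengths (F : Fin 2 → Subgroup G) (A H : Subgroup G) (i : Fin 2) (g : G) : Set ℕ :=
  {n | ∃ h ∈ H, ∃ g₁, Entry F A n i g₁ ∧ g⁻¹ * (h * g₁) ∈ F i}

theorem entryLengths_smul {i : Fin 2} {g h : G} (hh : h ∈ H) :
    entryLengths F A H i (h * g) = entryLengths F A H i g := by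
  ext n
  constructor
  · rintro ⟨h', hh', g₁, h1, h2⟩
    exact ⟨h⁻¹ * h', mul_mem (inv_mem hh) hh', g₁, h1, by simpa [mul_assoc] using h2⟩
  · rintro ⟨h', hh', g₁, h1, h2⟩
    exact ⟨h * h', mul_mem hh hh', g₁, h1, by simpa [mul_assoc] using h2⟩

/-- Even modulo `H`, the next coset can be entered only through `g F i`. An entry from another side,
or one without syllables, would together with `g k` give an element of `H` crossing `g F i`.
Dropping the last syllable of an entry thus leaves an entry into `g F i`. -/
theorem IsAmalgam.exists_mem_entryLengths (hA : IsAmalgam F A) {i j : Fin 2}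
    (hij : i ≠ j) {g k : G} (hc : g ∉ core F A H i) (he : ¬ EndsIn F A i g)
    (hk : k ∈ F i) (hk' : k ∉ A) {n : ℕ} (hn : n ∈ entryLengths F A H j (g * k)) :
    ∃ m ∈ entryLengths F A H i g, n = m + 1 := by
  obtain ⟨h, hh, g₁, h1, h2⟩ := hn
  obtain ⟨m, hm, hg₁⟩ : ∃ m ∈ F j, h * g₁ = g * k * m :=
    ⟨_, h2, (mul_inv_cancel_left _ _).symm⟩
  have key : ∀ x, g * (k * x) ∈ H → ¬ EndsIn F A i x⁻¹ → False := by
    intro x hx hx'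
    refine hc (mem_core_of_mul_mem hx he ?_)
    simpa using hA.mul_endsIn hx' (inv_mem hk) (by simpa using hk')
  have hgk : g * (k * (m * g₁⁻¹)) ∈ H := by
    have : g * (k * (m * g₁⁻¹)) = (g * k * m) * g₁⁻¹ := by simp [mul_assoc]
    rw [this, ← hg₁]
    simpa using hh
  have hmA : m ∈ A := by
    by_contra hmA
    refine key _ hgk ?_
    simpa using hA.not_endsIn_of_ne
      (hA.mul_endsIn (h1.not_endsIn hA) (inv_mem hm) (by simpa using hmA)) hij.symm
  cases h1 with
  | nil ha =>
    exact (key _ hgk (hA.not_endsIn_of_mem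
      (by simpa using mul_mem ha (inv_mem hmA)))).elim
  | @snoc n l _ g₂ k₂ h1 hlj hk₂ hk₂' =>
    obtain rfl : l = i := by omega
    refine ⟨n, ⟨h, hh, g₂, h1, ?_⟩, rfl⟩
    have : g⁻¹ * (h * g₂) = k * m * k₂⁻¹ := by
      have := congrArg (fun x => g⁻¹ * x * k₂⁻¹) hg₁
      simpa [mul_assoc] using this
    rw [this]
    exact mul_mem (mul_mem hk (hA.le l hmA)) (inv_mem hk₂)

/-- From a coset outside the core one can move outward indefinitely, and the least number of
syllables needed to enter, an `H`-invariant quantity, grows at every move. Modulo `H` there are only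
finitely many cosets, so this number is bounded. -/
theorem IsSubtree.subset_core (hA : IsAmalgam F A) (hU : IsSubtree F H U)
    (hfin : ∃ T : Finset G, ∀ i, ∀ g ∈ U i, ∃ h ∈ H, h * g ∈ T)
    (hleaf : ∀ i j, i ≠ j → ∀ g, ¬ IsLeaf F A H U i j g)
    (hfree : ∀ i j, i ≠ j → ¬ (H = ⊥ ∧ U j = ∅ ∧ U i = F i)) (i : Fin 2) :
    U i ⊆ core F A H i := by
  obtain ⟨T, hT⟩ := hfin
  intro g hg
  by_contra hc
  have grow : ∀ n, ∃ i, ∃ g ∈ U i, g ∉ core F A H i ∧ ¬ EndsIn F A i g ∧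
      n ≤ sInf (entryLengths F A H i g) := by
    intro n
    induction n with
    | zero =>
      by_cases he : EndsIn F A i g
      -- Another representative of the same coset, at which the coset is entered, is chosen.
      · obtain ⟨g', k, rfl, hk, hk', he'⟩ := hA.exists_eq_mul he
        refine ⟨i, g', by simpa using hU.mulMem hg (inv_mem hk), fun h => hc ?_, he',
          Nat.zero_le _⟩
        exact core_mul_mem h hk
      · exact ⟨i, g, hg, hc, he, Nat.zero_le _⟩
    | succ n ih =>
      obtain ⟨i, g, hg, hc, he, hn⟩ := ih
      obtain ⟨j, hij⟩ : ∃ j, i ≠ j := (exists_ne i).imp fun _ h => h.symm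
      obtain ⟨k, hk, hk', hgk⟩ :=
        hU.exists_mul_mem hA hij (hleaf i j hij) (hfree i j hij) hg hc he
      have he' : ¬ EndsIn F A j (g * k) :=
        hA.not_endsIn_of_ne (hA.mul_endsIn he hk hk') hij
      refine ⟨j, g * k, hgk, hA.notMem_core_mul hij hc he hk hk', he', ?_⟩
      -- An entry exists, with `1` as the translating element of `H`; hence the infimum is attained
      -- and is not the default value `sInf ∅ = 0`.
      obtain ⟨m, hm⟩ := hA.exists_entry he'
      obtain ⟨m', hm', h⟩ := hA.exists_mem_entryLengths hij hc he hk hk'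
        (Nat.sInf_mem (s := entryLengths F A H j (g * k)) ⟨m, 1, one_mem _, _, hm, by simp⟩)
      rw [h]
      exact Nat.succ_le_succ (hn.trans (Nat.sInf_le hm'))
  obtain ⟨i, g, hg, -, -, hn⟩ :=
    grow ((T ×ˢ Finset.univ).sup (fun p => sInf (entryLengths F A H p.2 p.1)) + 1)
  obtain ⟨h, hh, ht⟩ := hT i g hg
  have := Finset.le_sup (f := fun p : G × Fin 2 => sInf (entryLengths F A H p.2 p.1))
    (show (h * g, i) ∈ T ×ˢ Finset.univ from Finset.mem_product.2 ⟨ht, Finset.mem_univ i⟩)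
  simp only [entryLengths_smul hh] at this
  omega

/-- Removing a leaf from a subtree. -/
theorem IsSubtree.remove (hU : IsSubtree F H U) {i j : Fin 2} (hij : i ≠ j)
    {g : G} (hg : IsLeaf F A H U i j g) (hA : IsAmalgam F A) {U' : Fin 2 → Set G}
    (hj : U' j = U j) (hi : ∀ x, x ∈ U' i ↔ x ∈ U i ∧ ¬ ∃ h ∈ H, g⁻¹ * (h * x) ∈ F i) :
    IsSubtree F H U' := by
  obtain ⟨hgi, hgj, hK, hZ, hbase⟩ := hg
  have hl : ∀ l, l = i ∨ l = j := fun l => by omega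
  have hmul : ∀ {l x k}, x ∈ U' l → k ∈ F l → x * k ∈ U' l := by
    intro l x k hx hk
    rcases hl l with rfl | rfl
    · rw [hi] at hx ⊢
      refine ⟨hU.mulMem hx.1 hk, fun ⟨h, hh, h'⟩ => hx.2 ⟨h, hh, ?_⟩⟩
      simpa [mul_assoc] using mul_mem h' (inv_mem hk)
    · rw [hj] at hx ⊢
      exact hU.mulMem hx hk
  have hsmul : ∀ {l x h}, x ∈ U' l → h ∈ H → h * x ∈ U' l := by
    intro l x h hx hh
    rcases hl l with rfl | rfl
    · rw [hi] at hx ⊢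
      refine ⟨hU.smulMem hx.1 hh, fun ⟨h₁, hh₁, h'⟩ => hx.2 ⟨h₁ * h, mul_mem hh₁ hh, ?_⟩⟩
      simpa [mul_assoc] using h'
    · rw [hj] at hx ⊢
      exact hU.smulMem hx hh
  -- the vertices of the removed coset that survive form a single orbit of `A`
  have hZ' : ∀ x k, (∃ h ∈ H, g⁻¹ * (h * x) ∈ F i) → x ∈ U j → k ∈ F i → x * k ∈ U j →
      k ∈ A := by
    rintro x k ⟨h, hh, hx⟩ hxj hk hxk
    have h1 := hZ _ hx (by simpa using hU.smulMem hxj hh)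
    have h2 := hZ _ (mul_mem hx hk) (by simpa [mul_assoc] using hU.smulMem hxk hh)
    rwa [Subgroup.mul_mem_cancel_left _ h1] at h2
  -- The condition on the basepoint in the definition of a leaf: a translate of 1 in a removed coset
  -- is also carried by the other colour.
  have hbase' : ∀ h₁ ∈ H, (∃ h ∈ H, g⁻¹ * (h * h₁) ∈ F i) → h₁ ∈ U j := by
    rintro h₁ hh₁ ⟨h, hh, h'⟩
    rcases hbase with ⟨-, hb⟩ | ⟨-, hb⟩
    · have : 1 ∈ U j := by
        by_contra h1
        exact hb ⟨⟨_, mul_mem hh hh₁, h'⟩, h1⟩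
      simpa using hU.smulMem this hh₁
    · exact absurd ⟨_, mul_mem hh hh₁, h'⟩ hb
  -- The last step cannot be of colour `i`, since such steps avoid the removed cosets; thus the
  -- point is the start or was reached by a step of colour `j`.
  have hsurv : ∀ x y, Reach (mulAct F U') 1 x y → (∃ h ∈ H, g⁻¹ * (h * x) ∈ F i) →
      x ∈ U j := by
    intro x y hx hC
    cases hx with
    | one => exact hbase' 1 (one_mem _) hC
    | @step l x' y' k _ hx hk =>
      obtain rfl := hx.eq_of_mulAct
      have := hmul hk.1 hk.2.1
      rcases hl l with rfl | rfl
      · rw [hi] at this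
        exact absurd hC this.2
      · rwa [hj] at this
  have key : ∀ x y, Reach (mulAct F U) 1 x y → Reach (mulAct F U') 1 x x ∨
      ∃ x₁ k, Reach (mulAct F U') 1 x₁ x₁ ∧ (∃ h ∈ H, g⁻¹ * (h * x₁) ∈ F i) ∧ x₁ ∈ U j ∧
        k ∈ F i ∧ x = x₁ * k := by
    -- An excursion into a removed coset enters and leaves at vertices of colour `j`. These differ
    -- by an element of A, so a single step of colour `j` replaces the excursion.
    have back : ∀ x₁ k, Reach (mulAct F U') 1 x₁ x₁ → (∃ h ∈ H, g⁻¹ * (h * x₁) ∈ F i) →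
        x₁ ∈ U j → k ∈ F i → x₁ * k ∈ U j → Reach (mulAct F U') 1 (x₁ * k) (x₁ * k) := by
      intro x₁ k h1 h2 h3 h4 h5
      exact .step (i := j) h1 ⟨hj ▸ h3, hA.le j (hZ' x₁ k h2 h3 h4 h5), rfl⟩
    intro x y hx
    induction hx with
    | one => exact .inl .one
    | @step l x y k z hx hk ih =>
      obtain rfl := hx.eq_of_mulAct
      rcases ih with ih | ⟨x₁, k₁, h1, h2, h3, h4, rfl⟩
      · rcases hl l with rfl | rfl
        · by_cases hC : ∃ h ∈ H, g⁻¹ * (h * y) ∈ F l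
          · exact .inr ⟨y, k, ih, hC, hsurv _ _ ih hC, hk.2.1, rfl⟩
          · exact .inl (.step (i := l) ih ⟨(hi y).2 ⟨hk.1, hC⟩, hk.2.1, rfl⟩)
        · exact .inl (.step (i := l) ih ⟨hj ▸ hk.1, hk.2.1, rfl⟩)
      · rcases hl l with rfl | rfl
        · exact .inr ⟨x₁, k₁ * k, h1, h2, h3, mul_mem h4 hk.2.1, mul_assoc _ _ _⟩
        · exact .inl (.step (i := l) (back x₁ k₁ h1 h2 h3 h4 hk.1) ⟨hj ▸ hk.1, hk.2.1, rfl⟩)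
  have fin : ∀ x, Reach (mulAct F U) 1 x x → ((∃ h ∈ H, g⁻¹ * (h * x) ∈ F i) → x ∈ U j) →
      Reach (mulAct F U') 1 x x := by
    intro x hx hC
    rcases key x x hx with h | ⟨x₁, k, h1, h2, h3, h4, rfl⟩
    · exact h
    · obtain ⟨h, hh, h2'⟩ := id h2
      have h5 := hC ⟨h, hh, by simpa [mul_assoc] using mul_mem h2' h4⟩
      exact .step (i := j) h1 ⟨hj ▸ h3, hA.le j (hZ' x₁ k h2 h3 h4 h5), rfl⟩
  refine ⟨hmul, hsmul, ?_, fun hh => fin _ (hU.reach_of_mem hh) (hbase' _ hh)⟩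
  intro l x hx
  rcases hl l with rfl | rfl
  · have := (hi x).1 hx
    exact fin x (hU.reach this.1) fun h => absurd h this.2
  · rw [hj] at hx
    exact fin x (hU.reach hx) fun _ => hx

end Core
end Stallings

/-! ### The pushout satisfies the normal form theorem -/

namespace Stallings

section Pushout

variable {G : Fin 2 → Type u} [∀ i, Group (G i)] {A : Type c} [Group A] (φ : ∀ i, A →* G i)

/-- The image of the factor `G i` in the amalgam. -/
abbrev factor (i : Fin 2) : Subgroup (PushoutI φ) := (PushoutI.of (φ := φ) i).range

/-- The image of `A` in the amalgam. -/
abbrev amalg : Subgroup (PushoutI φ) := (PushoutI.base φ).range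

/-- Existence of reduced expressions comes for free from the normalization of partial actions.
Uniqueness is the statement that a nonempty reduced word does not represent an element of the base.
-/
theorem isAmalgam_pushout (hφ : ∀ i, Function.Injective (φ i)) :
    IsAmalgam (factor φ) (amalg φ) where
  le := by
    rintro i _ ⟨x, rfl⟩
    exact ⟨φ i x, PushoutI.of_apply_eq_base φ i x⟩
  total := by
    have hle : ∀ i, amalg φ ≤ factor φ i := by
      rintro i _ ⟨x, rfl⟩
      exact ⟨φ i x, PushoutI.of_apply_eq_base φ i x⟩
    -- On a one-point set the action forgets positions, so `Reach.cases_reduced` becomes a statement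
    -- about products alone.
    let Act : Fin 2 → Unit → PushoutI φ → Unit → Prop := fun i _ g _ => g ∈ factor φ i
    have hP : IsPartialAction (factor φ) (amalg φ) Act :=
      { mem := fun h => h
        mul := fun h h' => mul_mem h h'
        inv := fun h => inv_mem h
        total := fun _ h => ⟨(), h⟩
        func := fun _ _ => rfl
        compat := fun _ h _ => hle _ h }
    have hreach : ∀ g x : PushoutI φ, Reach Act () x () → Reach Act () (x * g) () := by
      intro g
      induction g using PushoutI.induction_on with
      | of i k => exact fun x hx => .step (i := i) hx ⟨k, rfl⟩
      | base a => exact fun x hx => .step (i := 0) hx (hle 0 ⟨a, rfl⟩)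
      | mul g k hg hk =>
        intro x hx
        rw [← mul_assoc]
        exact hk _ (hg _ hx)
    intro g
    have := hreach g 1 .one
    rw [one_mul] at this
    rcases this.cases_reduced hP with ⟨rfl, -⟩ | ⟨h, -⟩ | ⟨i, hi⟩
    · exact .inl (one_mem _)
    · exact .inl h
    · exact .inr ⟨i, hi.endsIn hP⟩
  eq_nil := by
    intro L hL hprod
    have hlift : ∀ L : List (Fin 2 × PushoutI φ), (∀ s ∈ L, s.2 ∈ factor φ s.1) →
        ∃ M : List (Σ i, G i), M.map (fun s => (s.1, PushoutI.of (φ := φ) s.1 s.2)) = L := by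
      intro L
      induction L with
      | nil => exact fun _ => ⟨[], rfl⟩
      | cons s L ih =>
        intro h
        obtain ⟨M, rfl⟩ := ih fun t ht => h t (List.mem_cons_of_mem _ ht)
        obtain ⟨i, g⟩ := s
        obtain ⟨k, hk⟩ := h (i, g) List.mem_cons_self
        exact ⟨⟨i, k⟩ :: M, by simp only [List.map_cons, hk]⟩
    obtain ⟨M, rfl⟩ := hlift L fun s hs => (hL.1 s hs).1
    have hM : ∀ s ∈ M, s.2 ∉ (φ s.1).range := by
      rintro ⟨i, k⟩ hs ⟨x, hx⟩
      refine (hL.1 _ (List.mem_map_of_mem hs)).2 ⟨x, ?_⟩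
      rw [← PushoutI.of_apply_eq_base φ i x, hx]
    let W : CoprodI.Word G :=
      { toList := M
        ne_one := fun s hs h1 => hM s hs (by rw [h1]; exact one_mem _)
        chain_ne := by
          have := hL.2
          rw [List.isChain_map] at this
          exact this }
    have hW := PushoutI.Reduced.eq_empty_of_mem_range hφ (w := W) hM (by
      convert hprod
      simp [W, CoprodI.Word.prod, map_list_prod, Function.comp_def])
    have : W.toList = [] := by rw [hW]; rfl
    simpa [W] using this

end Pushout

end Stallings

/-! ### Paths, morphisms and quotients of labelled graphs -/

namespace Stallings

section PathLemmas

variable {X : Type v}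

namespace PGraph

variable {Γ : PGraph.{v, a, b} X} {Δ : PGraph.{v, c, d} X}

theorem τ_inv (e : Γ.E) : Γ.τ (Γ.inv e) = Γ.ι e := by simp [τ, Γ.inv_inv]

theorem isPath_append {x z : Γ.V} {p q : List Γ.E} :
    Γ.IsPath x (p ++ q) z ↔ ∃ y, Γ.IsPath x p y ∧ Γ.IsPath y q z := by
  induction p generalizing x with
  | nil => simp [IsPath]
  | cons e p ih => simp [IsPath, ih, and_assoc]

theorem IsPath.append {x y z : Γ.V} {p q : List Γ.E} (hp : Γ.IsPath x p y)
    (hq : Γ.IsPath y q z) : Γ.IsPath x (p ++ q) z := isPath_append.2 ⟨y, hp, hq⟩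

theorem IsPath.reverse {x y : Γ.V} {p : List Γ.E} (h : Γ.IsPath x p y) :
    Γ.IsPath y (p.map Γ.inv).reverse x := by
  induction p generalizing x with
  | nil => exact Eq.symm h
  | cons e p ih =>
    simp only [List.map_cons, List.reverse_cons]
    refine (ih h.2).append ⟨rfl, ?_⟩
    rw [τ_inv]
    exact h.1

theorem pathLab_append (p q : List Γ.E) : Γ.pathLab (p ++ q) = Γ.pathLab p ++ Γ.pathLab q := by
  simp [pathLab]

theorem IsPath.target_unique {x y z : Γ.V} {p : List Γ.E} (h : Γ.IsPath x p y)
    (h' : Γ.IsPath x p z) : y = z := by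
  induction p generalizing x with
  | nil => exact h.symm.trans h'
  | cons e p ih => exact ih h.2 h'.2

theorem WellLabelled.path_unique (hΓ : Γ.WellLabelled) {x y z : Γ.V} {p q : List Γ.E}
    (hp : Γ.IsPath x p y) (hq : Γ.IsPath x q z) (h : Γ.pathLab p = Γ.pathLab q) :
    p = q := by
  induction p generalizing x q with
  | nil =>
    cases q with
    | nil => rfl
    | cons e q => simp [pathLab] at h
  | cons e p ih =>
    cases q with
    | nil => simp [pathLab] at h
    | cons e' q =>
      simp only [pathLab, List.map_cons, List.cons.injEq] at h
      obtain rfl := hΓ e e' (hp.1.trans hq.1.symm) h.1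
      rw [ih hp.2 hq.2 h.2]

namespace Hom

variable (f : Hom Γ Δ)

theorem map_τ (e : Γ.E) : Δ.τ (f.onE e) = f.onV (Γ.τ e) := by
  simp [τ, f.map_inv, f.map_ι]

theorem map_path {x y : Γ.V} {p : List Γ.E} (h : Γ.IsPath x p y) :
    Δ.IsPath (f.onV x) (p.map f.onE) (f.onV y) := by
  induction p generalizing x with
  | nil => exact congrArg _ h
  | cons e p ih =>
    refine ⟨by rw [f.map_ι, h.1], ?_⟩
    rw [map_τ]
    exact ih h.2

theorem map_pathLab (p : List Γ.E) : Δ.pathLab (p.map f.onE) = Γ.pathLab p := by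
  simp [pathLab, Function.comp_def, f.map_lab]

/-- Composition of morphisms. -/
def comp {Θ : PGraph.{v, u, w} X} (g : Hom Δ Θ) (f : Hom Γ Δ) : Hom Γ Θ where
  onV := g.onV ∘ f.onV
  onE := g.onE ∘ f.onE
  map_ι e := by simp [g.map_ι, f.map_ι]
  map_inv e := by simp [g.map_inv, f.map_inv]
  map_lab e := by simp [g.map_lab, f.map_lab]
  map_base := by simp [g.map_base, f.map_base]

/-- Change of the basepoint. -/
def rebase (x : Γ.V) : Hom (Γ.rebase x) (Δ.rebase (f.onV x)) where
  onV := f.onV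
  onE := f.onE
  map_ι := f.map_ι
  map_inv := f.map_inv
  map_lab := f.map_lab
  map_base := rfl

/-- Universal property of identifications: this is how the morphism to Cayley(G,H) survives every
fold, gluing and identification. -/
theorem IsQuotient.exists_lift {Θ : PGraph.{v, u, w} X} {f : Hom Γ Δ}
    {r : Γ.V → Γ.V → Prop} {s : Γ.E → Γ.E → Prop} (hf : f.IsQuotient r s) (g : Hom Γ Θ)
    (hr : ∀ x y, r x y → g.onV x = g.onV y) (hs : ∀ e e', s e e' → g.onE e = g.onE e') :
    ∃ h : Hom Δ Θ, (∀ x, h.onV (f.onV x) = g.onV x) ∧ ∀ e, h.onE (f.onE e) = g.onE e := by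
  obtain ⟨h1, h2, h3, h4⟩ := hf
  have hr' : ∀ x y, f.onV x = f.onV y → g.onV x = g.onV y := by
    intro x y h
    rw [h3] at h
    induction h with
    | rel x y h => exact hr x y h
    | refl => rfl
    | symm _ _ _ ih => exact ih.symm
    | trans _ _ _ _ _ ih ih' => exact ih.trans ih'
  have hs' : ∀ x y, f.onE x = f.onE y → g.onE x = g.onE y := by
    intro x y h
    rw [h4] at h
    induction h with
    | rel x y h => exact hs x y h
    | refl => rfl
    | symm _ _ _ ih => exact ih.symm
    | trans _ _ _ _ _ ih ih' => exact ih.trans ih'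
  have hV : ∀ x, g.onV (Function.surjInv h1 (f.onV x)) = g.onV x := fun x =>
    hr' _ _ (Function.surjInv_eq h1 _)
  have hE : ∀ e, g.onE (Function.surjInv h2 (f.onE e)) = g.onE e := fun e =>
    hs' _ _ (Function.surjInv_eq h2 _)
  refine ⟨⟨fun x => g.onV (Function.surjInv h1 x), fun e => g.onE (Function.surjInv h2 e),
    ?_, ?_, ?_, ?_⟩, hV, hE⟩
  · intro e
    obtain ⟨e, rfl⟩ := h2 e
    rw [hE, f.map_ι, hV, g.map_ι]
  · intro e
    obtain ⟨e, rfl⟩ := h2 e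
    rw [hE, f.map_inv, hE, g.map_inv]
  · intro e
    obtain ⟨e, rfl⟩ := h2 e
    rw [hE, f.map_lab, g.map_lab]
  · rw [← f.map_base, hV, g.map_base]

end Hom

theorem Iso.symm (h : Γ.Iso Δ) : Δ.Iso Γ := by
  obtain ⟨f, hV, hE⟩ := h
  let eV := Equiv.ofBijective _ hV
  let eE := Equiv.ofBijective _ hE
  have hV' : ∀ x, f.onV (eV.symm x) = x := eV.apply_symm_apply
  have hE' : ∀ x, f.onE (eE.symm x) = x := eE.apply_symm_apply
  refine ⟨⟨eV.symm, eE.symm, ?_, ?_, ?_, ?_⟩, eV.symm.bijective, eE.symm.bijective⟩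
  · intro e
    apply hV.1
    rw [hV', ← f.map_ι, hE']
  · intro e
    apply hE.1
    rw [hE', ← f.map_inv, hE']
  · intro e
    rw [← f.map_lab, hE']
  · apply hV.1
    rw [hV', f.map_base]

theorem Iso.trans {Θ : PGraph.{v, u, w} X} (h : Γ.Iso Δ) (h' : Δ.Iso Θ) : Γ.Iso Θ := by
  obtain ⟨f, hV, hE⟩ := h
  obtain ⟨g, hV', hE'⟩ := h'
  exact ⟨g.comp f, hV'.comp hV, hE'.comp hE⟩

theorem IsoOnto.iso {Θ : PGraph.{v, u, w} X} {S : Set Θ.V} {T : Set Θ.E}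
    (h : Γ.IsoOnto Θ S T) (h' : Δ.IsoOnto Θ S T) : Γ.Iso Δ := by
  obtain ⟨f, fV, fE, rfl, rfl⟩ := h
  obtain ⟨g, gV, gE, hV, hE⟩ := h'
  have h1 : ∀ x, ∃ y, g.onV y = f.onV x := fun x => by
    have : f.onV x ∈ Set.range g.onV := hV ▸ ⟨x, rfl⟩
    exact this
  have h2 : ∀ x, ∃ y, g.onE y = f.onE x := fun x => by
    have : f.onE x ∈ Set.range g.onE := hE ▸ ⟨x, rfl⟩
    exact this
  choose k hk using h1
  choose l hl using h2
  refine ⟨⟨k, l, ?_, ?_, ?_, ?_⟩, ⟨?_, ?_⟩, ⟨?_, ?_⟩⟩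
  · intro e
    apply gV
    rw [← g.map_ι, hl, hk, f.map_ι]
  · intro e
    apply gE
    rw [← g.map_inv, hl, hl, f.map_inv]
  · intro e
    rw [← g.map_lab, hl, f.map_lab]
  · apply gV
    rw [hk, f.map_base, g.map_base]
  · intro x y h
    apply fV
    rw [← hk, ← hk]
    exact congrArg g.onV h
  · intro y
    have : g.onV y ∈ Set.range f.onV := hV ▸ ⟨y, rfl⟩
    obtain ⟨x, hx⟩ := this
    exact ⟨x, gV (by rw [hk, hx])⟩
  · intro x y h
    apply fE
    rw [← hl, ← hl]
    exact congrArg g.onE h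
  · intro y
    have : g.onE y ∈ Set.range f.onE := hE ▸ ⟨y, rfl⟩
    obtain ⟨x, hx⟩ := this
    exact ⟨x, gE (by rw [hl, hx])⟩

/-- A finite graph has a copy in every universe. -/
theorem exists_equiv (Γ : PGraph.{v, a, b} X) [Finite Γ.V] [Finite Γ.E] :
    ∃ (Δ : PGraph.{v, w, w} X) (f : Hom Γ Δ), Function.Bijective f.onV ∧
      Function.Bijective f.onE := by
  obtain ⟨n, ⟨eV⟩⟩ := Finite.exists_equiv_fin Γ.V
  obtain ⟨m, ⟨eE⟩⟩ := Finite.exists_equiv_fin Γ.E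
  let eV' : Γ.V ≃ ULift.{w} (Fin n) := eV.trans Equiv.ulift.symm
  let eE' : Γ.E ≃ ULift.{w} (Fin m) := eE.trans Equiv.ulift.symm
  exact ⟨{ V := ULift.{w} (Fin n)
           E := ULift.{w} (Fin m)
           ι := fun e => eV' (Γ.ι (eE'.symm e))
           inv := fun e => eE' (Γ.inv (eE'.symm e))
           lab := fun e => Γ.lab (eE'.symm e)
           base := eV' Γ.base
           inv_inv := by simp [Γ.inv_inv]
           lab_inv := by simp [Γ.lab_inv] },
    { onV := eV', onE := eE'
      map_ι := by simp
      map_inv := by simp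
      map_lab := by simp
      map_base := rfl }, eV'.bijective, eE'.bijective⟩

/-- Used to show that the algorithm never gets stuck. The hypotheses let the structure maps descend;
finiteness allows the quotient to be moved to the universe of the configurations, although it may be
built from a Cayley graph living elsewhere. -/
theorem exists_isQuotient (Γ : PGraph.{v, a, b} X) [Finite Γ.V] [Finite Γ.E]
    (r : Γ.V → Γ.V → Prop) (s : Γ.E → Γ.E → Prop)
    (hι : ∀ e e', s e e' → Relation.EqvGen r (Γ.ι e) (Γ.ι e'))
    (hinv : ∀ e e', s e e' → Relation.EqvGen s (Γ.inv e) (Γ.inv e'))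
    (hlab : ∀ e e', s e e' → Γ.lab e = Γ.lab e') :
    ∃ (Δ : PGraph.{v, w, w} X) (f : Hom Γ Δ), f.IsQuotient r s := by
  let rV : Setoid Γ.V := Relation.EqvGen.setoid r
  let rE : Setoid Γ.E := Relation.EqvGen.setoid s
  have hι' : ∀ e e', Relation.EqvGen s e e' → Relation.EqvGen r (Γ.ι e) (Γ.ι e') := by
    intro e e' h
    induction h with
    | rel x y h => exact hι x y h
    | refl => exact .refl _
    | symm _ _ _ ih => exact .symm _ _ ih
    | trans _ _ _ _ _ ih ih' => exact .trans _ _ _ ih ih'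
  have hinv' : ∀ e e', Relation.EqvGen s e e' → Relation.EqvGen s (Γ.inv e) (Γ.inv e') := by
    intro e e' h
    induction h with
    | rel x y h => exact hinv x y h
    | refl => exact .refl _
    | symm _ _ _ ih => exact .symm _ _ ih
    | trans _ _ _ _ _ ih ih' => exact .trans _ _ _ ih ih'
  have hlab' : ∀ e e', Relation.EqvGen s e e' → Γ.lab e = Γ.lab e' := by
    intro e e' h
    induction h with
    | rel x y h => exact hlab x y h
    | refl => rfl
    | symm _ _ _ ih => exact ih.symm
    | trans _ _ _ _ _ ih ih' => exact ih.trans ih'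
  let Θ : PGraph.{v, a, b} X :=
    { V := Quotient rV
      E := Quotient rE
      ι := Quotient.map Γ.ι hι'
      inv := Quotient.map Γ.inv hinv'
      lab := Quotient.lift Γ.lab hlab'
      base := ⟦Γ.base⟧
      inv_inv := by
        intro e
        induction e using Quotient.inductionOn
        simp [Γ.inv_inv]
      lab_inv := by
        intro e
        induction e using Quotient.inductionOn
        simp [Γ.lab_inv] }
  have : Finite Θ.V := inferInstanceAs (Finite (Quotient rV))
  have : Finite Θ.E := inferInstanceAs (Finite (Quotient rE))
  obtain ⟨Δ, g, hV, hE⟩ := exists_equiv.{v, w} Θ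
  let q : Hom Γ Θ := ⟨Quotient.mk rV, Quotient.mk rE, fun _ => rfl, fun _ => rfl, fun _ => rfl, rfl⟩
  refine ⟨Δ, g.comp q, hV.2.comp Quotient.mk_surjective, hE.2.comp Quotient.mk_surjective, ?_, ?_⟩
  · intro x y
    exact hV.1.eq_iff.trans Quotient.eq
  · intro x y
    exact hE.1.eq_iff.trans Quotient.eq

/-- The subgraph with vertex set `S` and edge set `T`. -/
theorem exists_isoOnto (Γ : PGraph.{v, a, b} X) (S : Set Γ.V) (T : Set Γ.E)
    (hbase : Γ.base ∈ S) (hι : ∀ e ∈ T, Γ.ι e ∈ S) (hinv : ∀ e ∈ T, Γ.inv e ∈ T) :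
    ∃ Δ : PGraph.{v, a, b} X, Δ.IsoOnto Γ S T :=
  ⟨{ V := S
     E := T
     ι := fun e => ⟨Γ.ι e, hι e e.2⟩
     inv := fun e => ⟨Γ.inv e, hinv e e.2⟩
     lab := fun e => Γ.lab e
     base := ⟨Γ.base, hbase⟩
     inv_inv := fun e => Subtype.ext (Γ.inv_inv e)
     lab_inv := fun e => Γ.lab_inv e },
    ⟨Subtype.val, Subtype.val, fun _ => rfl, fun _ => rfl, fun _ => rfl, rfl⟩,
    Subtype.val_injective, Subtype.val_injective, Subtype.range_val, Subtype.range_val⟩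

end PGraph

end PathLemmas

end Stallings

/-! ### Words, monochromatic paths and Cayley graphs -/

namespace Stallings

open AGraph

section Words

variable {X : Fin 2 → Type v} {G : Fin 2 → Type u} [∀ i, Group (G i)] {A : Type c} [Group A]
  {φ : ∀ i, A →* G i} {gen : ∀ i, X i → G i}

/-- The formal inverse of a word. -/
def invWord {X : Type v} (p : List (X × Bool)) : List (X × Bool) :=
  (p.map fun l => (l.1, !l.2)).reverse

theorem sgn_not {Q : Type u} [Group Q] (q : Q) (t : Bool) : sgn q (!t) = (sgn q t)⁻¹ := by
  cases t <;> simp [sgn]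

@[simp] theorem val_nil : val φ gen [] = 1 := rfl

theorem val_cons (l : (Σ i, X i) × Bool) (p : List ((Σ i, X i) × Bool)) :
    val φ gen (l :: p) = sgn (genG φ gen l.1) l.2 * val φ gen p := by simp [val]

theorem val_append (p q : List ((Σ i, X i) × Bool)) :
    val φ gen (p ++ q) = val φ gen p * val φ gen q := by simp [val]

theorem val_invWord (p : List ((Σ i, X i) × Bool)) :
    val φ gen (invWord p) = (val φ gen p)⁻¹ := by
  induction p with
  | nil => simp [invWord]
  | cons l p ih =>
    have : invWord (l :: p) = invWord p ++ [(l.1, !l.2)] := by simp [invWord]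
    rw [this, val_append, ih, val_cons, val_cons]
    simp [sgn_not]

theorem sgn_genG_eq (l : (Σ i, X i) × Bool) :
    sgn (genG φ gen l.1) l.2 = PushoutI.of l.1.1 (sgn (gen l.1.1 l.1.2) l.2) := by
  obtain ⟨⟨i, x⟩, t⟩ := l
  cases t <;> simp [sgn, genG]

theorem val_mem_factor {i : Fin 2} {p : List ((Σ i, X i) × Bool)} (h : ∀ l ∈ p, l.1.1 = i) :
    val φ gen p ∈ factor φ i := by
  induction p with
  | nil => exact one_mem _
  | cons l p ih =>
    rw [val_cons]
    refine mul_mem ?_ (ih fun l' hl' => h l' (List.mem_cons_of_mem _ hl'))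
    obtain rfl := h l List.mem_cons_self
    rw [sgn_genG_eq]
    exact ⟨_, rfl⟩

theorem mono_invWord {i : Fin 2} {p : List ((Σ i, X i) × Bool)} (h : ∀ l ∈ p, l.1.1 = i) :
    ∀ l ∈ invWord p, l.1.1 = i := by
  intro l hl
  simp only [invWord, List.mem_reverse, List.mem_map] at hl
  obtain ⟨l', hl', rfl⟩ := hl
  exact h l' hl'

theorem mono_append {i : Fin 2} {p q : List ((Σ i, X i) × Bool)} (hp : ∀ l ∈ p, l.1.1 = i)
    (hq : ∀ l ∈ q, l.1.1 = i) : ∀ l ∈ p ++ q, l.1.1 = i := by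
  intro l hl
  exact (List.mem_append.1 hl).elim (hp l) (hq l)

variable (φ gen) in
theorem exists_word (hgen : ∀ i, Subgroup.closure (Set.range (gen i)) = ⊤) (i : Fin 2) (k : G i) :
    ∃ p : List ((Σ i, X i) × Bool), (∀ l ∈ p, l.1.1 = i) ∧ val φ gen p = PushoutI.of i k := by
  have hk : k ∈ Subgroup.closure (Set.range (gen i)) := hgen i ▸ Subgroup.mem_top k
  induction hk using Subgroup.closure_induction with
  | mem k hk =>
    obtain ⟨x, rfl⟩ := hk
    exact ⟨[(⟨i, x⟩, true)], by simp, by simp [val_cons, sgn, genG]⟩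
  | one => exact ⟨[], by simp, by simp⟩
  | mul k k' _ _ ih ih' =>
    obtain ⟨p, hp, h⟩ := ih
    obtain ⟨p', hp', h'⟩ := ih'
    exact ⟨p ++ p', mono_append hp hp', by rw [val_append, h, h', map_mul]⟩
  | inv k _ ih =>
    obtain ⟨p, hp, h⟩ := ih
    exact ⟨invWord p, mono_invWord hp, by rw [val_invWord, h, map_inv]⟩

variable (φ gen) in
theorem exists_word_of_mem (hgen : ∀ i, Subgroup.closure (Set.range (gen i)) = ⊤) {i : Fin 2}
    {k : PushoutI φ} (hk : k ∈ factor φ i) :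
    ∃ p : List ((Σ i, X i) × Bool), (∀ l ∈ p, l.1.1 = i) ∧ val φ gen p = k := by
  obtain ⟨k, rfl⟩ := hk
  exact exists_word φ gen hgen i k

variable (φ gen) in
theorem val_surjective (hgen : ∀ i, Subgroup.closure (Set.range (gen i)) = ⊤) :
    Function.Surjective (val φ gen) := by
  intro g
  induction g using PushoutI.induction_on with
  | of i k => exact (exists_word φ gen hgen i k).imp fun p hp => hp.2
  | base a =>
    obtain ⟨p, -, hp⟩ := exists_word φ gen hgen 0 (φ 0 a)
    exact ⟨p, by rw [hp, PushoutI.of_apply_eq_base]⟩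
  | mul g k hg hk =>
    obtain ⟨p, rfl⟩ := hg
    obtain ⟨q, rfl⟩ := hk
    exact ⟨p ++ q, val_append p q⟩

end Words

theorem PGraph.pathLab_reverse {X : Type v} (Γ : PGraph.{v, a, b} X) (p : List Γ.E) :
    Γ.pathLab (p.map Γ.inv).reverse = invWord (Γ.pathLab p) := by
  simp [pathLab, invWord, List.map_reverse, Function.comp_def, Γ.lab_inv]

section MonoPaths

variable {X : Fin 2 → Type v} {Γ : AGraph.{v, a, b} X} {Δ : AGraph.{v, r, s} X}

theorem colour_inv (e : Γ.E) : colour Γ (Γ.inv e) = colour Γ e := by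
  simp [colour, Γ.lab_inv]

theorem colour_map (f : PGraph.Hom Γ Δ) (e : Γ.E) : colour Δ (f.onE e) = colour Γ e := by
  simp [colour, f.map_lab]

theorem forall_colour_iff {i : Fin 2} {p : List Γ.E} :
    (∀ e ∈ p, colour Γ e = i) ↔ ∀ l ∈ Γ.pathLab p, l.1.1 = i := by
  simp [PGraph.pathLab, colour]

namespace AGraph.IsMonoPath

variable {i : Fin 2} {x y z : Γ.V} {p q : List Γ.E}

theorem nil (i : Fin 2) (x : Γ.V) : IsMonoPath Γ i x [] x := ⟨rfl, by simp⟩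

theorem append (hp : IsMonoPath Γ i x p y) (hq : IsMonoPath Γ i y q z) :
    IsMonoPath Γ i x (p ++ q) z :=
  ⟨hp.1.append hq.1, fun e he => (List.mem_append.1 he).elim (hp.2 e) (hq.2 e)⟩

theorem reverse (hp : IsMonoPath Γ i x p y) : IsMonoPath Γ i y (p.map Γ.inv).reverse x := by
  refine ⟨hp.1.reverse, fun e he => ?_⟩
  simp only [List.mem_reverse, List.mem_map] at he
  obtain ⟨e', he', rfl⟩ := he
  rw [colour_inv]
  exact hp.2 e' he'

theorem map (f : PGraph.Hom Γ Δ) (hp : IsMonoPath Γ i x p y) :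
    IsMonoPath Δ i (f.onV x) (p.map f.onE) (f.onV y) := by
  refine ⟨f.map_path hp.1, fun e he => ?_⟩
  obtain ⟨e', he', rfl⟩ := List.mem_map.1 he
  rw [colour_map]
  exact hp.2 e' he'

end AGraph.IsMonoPath

end MonoPaths

section CayleyGraphs

variable {X : Fin 2 → Type v} {G : Fin 2 → Type u} [∀ i, Group (G i)] {A : Type c} [Group A]
  (φ : ∀ i, A →* G i) (gen : ∀ i, X i → G i) (H : Subgroup (PushoutI φ))

/-- The vertex `H g` of `Cayley(G, H)`. -/
def vtx (g : PushoutI φ) : (cayleyG φ gen H).V := Quotient.mk'' g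

/-- The vertex `K k` of `Cayley(G_i, K)`. -/
def factorVtx (i : Fin 2) (K : Subgroup (G i)) (k : G i) : (cayleyFactor gen i K).V :=
  Quotient.mk'' k

variable {φ gen H}

theorem vtx_surjective : Function.Surjective (vtx φ gen H) := Quotient.mk''_surjective

theorem factorVtx_surjective (i : Fin 2) (K : Subgroup (G i)) :
    Function.Surjective (factorVtx gen i K) := Quotient.mk''_surjective

theorem vtx_eq_iff {g g' : PushoutI φ} :
    vtx φ gen H g = vtx φ gen H g' ↔ g' * g⁻¹ ∈ H := by
  rw [← QuotientGroup.rightRel_apply]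
  exact Quotient.eq''

theorem factorVtx_eq_iff {i : Fin 2} {K : Subgroup (G i)} {k k' : G i} :
    factorVtx gen i K k = factorVtx gen i K k' ↔ k' * k⁻¹ ∈ K := by
  rw [← QuotientGroup.rightRel_apply]
  exact Quotient.eq''

theorem base_cayleyG : (cayleyG φ gen H).base = vtx φ gen H 1 := rfl

theorem vtx_mul_of_mem {g h : PushoutI φ} (hh : h ∈ H) :
    vtx φ gen H (h * g) = vtx φ gen H g := by
  rw [vtx_eq_iff]
  simpa using hh

theorem τ_cayleyG {e : (cayleyG φ gen H).E} {g : PushoutI φ}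
    (h : (cayleyG φ gen H).ι e = vtx φ gen H g) :
    (cayleyG φ gen H).τ e = vtx φ gen H (g * val φ gen [(cayleyG φ gen H).lab e]) := by
  obtain ⟨q, x, t⟩ := e
  obtain rfl : q = vtx φ gen H g := h
  rw [val_cons, val_nil, mul_one]
  rfl

theorem isPath_cayleyG {p : List (cayleyG φ gen H).E} {g : PushoutI φ} {y : (cayleyG φ gen H).V}
    (h : (cayleyG φ gen H).IsPath (vtx φ gen H g) p y) :
    y = vtx φ gen H (g * val φ gen ((cayleyG φ gen H).pathLab p)) := by
  induction p generalizing g with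
  | nil => simpa [PGraph.pathLab] using Eq.symm h
  | cons e p ih =>
    have h2 := h.2
    rw [τ_cayleyG h.1] at h2
    rw [ih h2, mul_assoc, ← val_append]
    rfl

/-- The edge of `Cayley(G, H)` that starts at `x` and has the label `l`. -/
def edgeAt (x : (cayleyG φ gen H).V) (l : (Σ i, X i) × Bool) : (cayleyG φ gen H).E := (x, l)

theorem ι_edgeAt (x : (cayleyG φ gen H).V) (l : (Σ i, X i) × Bool) :
    (cayleyG φ gen H).ι (edgeAt x l) = x := rfl

theorem lab_edgeAt (x : (cayleyG φ gen H).V) (l : (Σ i, X i) × Bool) :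
    (cayleyG φ gen H).lab (edgeAt x l) = l := rfl

theorem exists_path_cayleyG (g : PushoutI φ) (p : List ((Σ i, X i) × Bool)) :
    ∃ q, (cayleyG φ gen H).IsPath (vtx φ gen H g) q (vtx φ gen H (g * val φ gen p)) ∧
      (cayleyG φ gen H).pathLab q = p := by
  induction p generalizing g with
  | nil => exact ⟨[], by simp [PGraph.IsPath], rfl⟩
  | cons l p ih =>
    obtain ⟨q, hq, hq'⟩ := ih (g * val φ gen [l])
    refine ⟨edgeAt (vtx φ gen H g) l :: q, ⟨rfl, ?_⟩, ?_⟩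
    · rw [τ_cayleyG (ι_edgeAt _ _), lab_edgeAt]
      rw [mul_assoc, ← val_append] at hq
      exact hq
    · rw [← hq']
      rfl

theorem wellLabelled_cayleyG : (cayleyG φ gen H).WellLabelled := by
  rintro ⟨q, x, t⟩ ⟨q', x', t'⟩ h1 h2
  exact Prod.ext h1 h2

theorem wellLabelled_cayleyFactor (i : Fin 2) (K : Subgroup (G i)) :
    (cayleyFactor gen i K).WellLabelled := by
  rintro ⟨q, x, t⟩ ⟨q', x', t'⟩ h1 h2
  have : (⟨i, x⟩ : Σ i, X i) = ⟨i, x'⟩ ∧ t = t' := Prod.ext_iff.1 h2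
  obtain ⟨h3, rfl⟩ := this
  obtain rfl : x = x' := by simpa using h3
  obtain rfl : q = q' := h1
  rfl

theorem colour_cayleyFactor {i : Fin 2} {K : Subgroup (G i)} (e : (cayleyFactor gen i K).E) :
    colour (cayleyFactor gen i K) e = i := rfl

theorem τ_cayleyFactor {i : Fin 2} {K : Subgroup (G i)} (k : G i) (l : X i × Bool) :
    (cayleyFactor gen i K).τ (factorVtx gen i K k, l) =
      factorVtx gen i K (k * sgn (gen i l.1) l.2) := rfl

variable (φ) in
theorem exists_path_cayleyFactor {i : Fin 2} (K : Subgroup (G i)) (k : G i)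
    {p : List ((Σ i, X i) × Bool)} (hp : ∀ l ∈ p, l.1.1 = i) :
    ∃ m q, PushoutI.of i m = val φ gen p ∧
      (cayleyFactor gen i K).IsPath (factorVtx gen i K k) q (factorVtx gen i K (k * m)) ∧
      (cayleyFactor gen i K).pathLab q = p := by
  induction p generalizing k with
  | nil => exact ⟨1, [], by simp, by simp [PGraph.IsPath], rfl⟩
  | cons l p ih =>
    obtain ⟨⟨j, x⟩, t⟩ := l
    obtain rfl : j = i := hp _ List.mem_cons_self
    obtain ⟨m, q, hm, hq, hq'⟩ := ih (k * sgn (gen j x) t) fun l hl =>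
      hp l (List.mem_cons_of_mem _ hl)
    refine ⟨sgn (gen j x) t * m, (factorVtx gen j K k, (x, t)) :: q, ?_, ⟨rfl, ?_⟩, ?_⟩
    · rw [map_mul, hm, val_cons, sgn_genG_eq]
    · rw [τ_cayleyFactor, ← mul_assoc]
      exact hq
    · rw [← hq']
      rfl

theorem isMonoPath_cayleyFactor {i : Fin 2} {K : Subgroup (G i)}
    {x y : (cayleyFactor gen i K).V} {p : List (cayleyFactor gen i K).E}
    (h : (cayleyFactor gen i K).IsPath x p y) : IsMonoPath (cayleyFactor gen i K) i x p y :=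
  ⟨h, fun e _ => colour_cayleyFactor e⟩

/-- The map `K k ↦ H g k`. -/
def factorMap (i : Fin 2) (K : Subgroup (G i)) (g : PushoutI φ)
    (hK : ∀ k ∈ K, g * PushoutI.of i k * g⁻¹ ∈ H) :
    (cayleyFactor gen i K).V → (cayleyG φ gen H).V :=
  Quotient.lift (fun k => vtx φ gen H (g * PushoutI.of i k)) (by
    intro k k' h
    have h' : k' * k⁻¹ ∈ K := QuotientGroup.rightRel_apply.1 h
    rw [vtx_eq_iff]
    simpa [mul_assoc] using hK _ h')

/-- The morphism from `Cayley(G_i, K)` to `Cayley(G, H)` that sends `K k` to `H g k`. -/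
def factorHom (i : Fin 2) (K : Subgroup (G i)) (g : PushoutI φ)
    (hK : ∀ k ∈ K, g * PushoutI.of i k * g⁻¹ ∈ H) :
    PGraph.Hom (cayleyFactor gen i K) ((cayleyG φ gen H).rebase (vtx φ gen H g)) where
  onV := factorMap i K g hK
  onE e := edgeAt (factorMap i K g hK ((cayleyFactor gen i K).ι e)) ((cayleyFactor gen i K).lab e)
  map_ι _ := rfl
  map_inv := by
    rintro ⟨q, x, t⟩
    obtain ⟨k, hk⟩ := factorVtx_surjective (gen := gen) i K q
    subst hk
    refine Prod.ext ?_ rfl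
    change vtx φ gen H (g * PushoutI.of i k * sgn (genG φ gen ⟨i, x⟩) t) =
      vtx φ gen H (g * PushoutI.of i (k * sgn (gen i x) t))
    rw [sgn_genG_eq (⟨i, x⟩, t), map_mul, mul_assoc]
  map_lab _ := rfl
  map_base := by
    change vtx φ gen H (g * PushoutI.of i 1) = vtx φ gen H g
    simp

theorem factorHom_onV {i : Fin 2} {K : Subgroup (G i)} {g : PushoutI φ}
    (hK : ∀ k ∈ K, g * PushoutI.of i k * g⁻¹ ∈ H) (k : G i) :
    (factorHom (gen := gen) i K g hK).onV (factorVtx gen i K k) =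
      vtx φ gen H (g * PushoutI.of i k) := rfl

/-- Under a morphism to Cayley(G,H), the end of a path is determined by the start and the value of
the label. Most comparisons of vertices below come down to this. -/
theorem hom_path {Γ : AGraph.{v, a, b} X} (f : PGraph.Hom Γ (cayleyG φ gen H)) {x y : Γ.V}
    {p : List Γ.E} {g : PushoutI φ} (hp : Γ.IsPath x p y) (hx : f.onV x = vtx φ gen H g) :
    f.onV y = vtx φ gen H (g * val φ gen (Γ.pathLab p)) := by
  have := f.map_path hp
  rw [hx] at this
  rw [isPath_cayleyG this, f.map_pathLab]

end CayleyGraphs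

end Stallings

/-! ### Steps 1 and 2: bouquet, folding and cutting of hairs -/

namespace Stallings

open AGraph

section Realizes

variable {X : Fin 2 → Type v} {G : Fin 2 → Type u} [∀ i, Group (G i)] {A : Type c} [Group A]
  (φ : ∀ i, A →* G i) (gen : ∀ i, X i → G i) (H : Subgroup (PushoutI φ))

/-- `Γ` is connected, and the labels of its closed paths at the basepoint represent exactly the
elements of `H`. -/
structure Realizes (Γ : AGraph.{v, a, b} X) : Prop where
  conn : ∀ x, ∃ p, Γ.IsPath Γ.base p x
  loops : ∀ h ∈ H, ∃ p, Γ.IsPath Γ.base p Γ.base ∧ val φ gen (Γ.pathLab p) = h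
  hom : Nonempty (PGraph.Hom Γ (cayleyG φ gen H))

variable {φ gen H}

/-- A map of vertices that is compatible with the edges extends to a morphism. -/
theorem exists_hom_of_onV {Γ : AGraph.{v, a, b} X} (F : Γ.V → (cayleyG φ gen H).V)
    (hbase : F Γ.base = vtx φ gen H 1)
    (hF : ∀ e, ∃ g, F (Γ.ι e) = vtx φ gen H g ∧
      F (Γ.τ e) = vtx φ gen H (g * val φ gen [Γ.lab e])) :
    ∃ f : PGraph.Hom Γ (cayleyG φ gen H), f.onV = F := by
  refine ⟨⟨F, fun e => edgeAt (F (Γ.ι e)) (Γ.lab e), fun _ => rfl, ?_, fun _ => rfl, hbase⟩, rfl⟩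
  intro e
  obtain ⟨g, h1, h2⟩ := hF e
  have h3 := τ_cayleyG (e := edgeAt (F (Γ.ι e)) (Γ.lab e)) h1
  apply wellLabelled_cayleyG
  · rw [ι_edgeAt]
    exact h3.trans h2.symm
  · rw [PGraph.lab_inv, lab_edgeAt, lab_edgeAt, Γ.lab_inv]

theorem Realizes.of_surjective {Γ : AGraph.{v, a, b} X} {Δ : AGraph.{v, r, s} X}
    (hΓ : Realizes φ gen H Γ) (f : PGraph.Hom Γ Δ) (hf : Function.Surjective f.onV)
    (g : PGraph.Hom Δ (cayleyG φ gen H)) : Realizes φ gen H Δ where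
  conn x := by
    obtain ⟨x, rfl⟩ := hf x
    obtain ⟨p, hp⟩ := hΓ.conn x
    exact ⟨_, f.map_base ▸ f.map_path hp⟩
  loops h hh := by
    obtain ⟨p, hp, hp'⟩ := hΓ.loops h hh
    refine ⟨p.map f.onE, ?_, by rw [f.map_pathLab, hp']⟩
    have := f.map_path hp
    rwa [f.map_base] at this
  hom := ⟨g⟩

/-- Cayley(G,H) is well-labelled, so the folded edges already have the same image and the morphism
descends to the folded graph. -/
theorem Realizes.fold {Γ : AGraph.{v, a, b} X} {Δ : AGraph.{v, r, s} X}
    (hΓ : Realizes φ gen H Γ) {f : PGraph.Hom Γ Δ} (hf : f.IsFold) : Realizes φ gen H Δ := by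
  obtain ⟨e₁, e₂, -, hι, hlab, hq⟩ := hf
  obtain ⟨g⟩ := hΓ.hom
  have hE : g.onE e₁ = g.onE e₂ := by
    apply wellLabelled_cayleyG
    · rw [g.map_ι, g.map_ι, hι]
    · rw [g.map_lab, g.map_lab, hlab]
  obtain ⟨k, -⟩ := hq.exists_lift g
    (by rintro _ _ ⟨rfl, rfl⟩; rw [← g.map_τ, ← g.map_τ, hE])
    (by
      rintro _ _ (⟨rfl, rfl⟩ | ⟨rfl, rfl⟩)
      · exact hE
      · rw [← g.map_inv, ← g.map_inv, hE])
  exact hΓ.of_surjective f hq.1 k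

/-- A path with both ends off the tip of the hair can visit the tip only by running along the hair
and straight back. Deleting these backtracks does not change the value of the label. Two edges
disappear at once, hence the induction on a bound for the length. -/
theorem Realizes.cutHair {Γ : AGraph.{v, a, b} X} {Δ : AGraph.{v, r, s} X}
    (hΓ : Realizes φ gen H Γ) (h : Γ.CutHair Δ) : Realizes φ gen H Δ := by
  obtain ⟨e, ⟨hbase, he⟩, f, fV, fE, hV, hE⟩ := h
  have key : ∀ n (p : List Γ.E), p.length ≤ n → ∀ x y : Δ.V,
      Γ.IsPath (f.onV x) p (f.onV y) →
      ∃ q, Δ.IsPath x q y ∧ val φ gen (Δ.pathLab q) = val φ gen (Γ.pathLab p) := by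
    intro n
    induction n with
    | zero =>
      intro p hp x y h
      obtain rfl : p = [] := by simpa using hp
      exact ⟨[], fV h, rfl⟩
    | succ n ih =>
      intro p hp x y h
      have hx : f.onV x ≠ Γ.τ e := by
        have : f.onV x ∈ Set.range f.onV := ⟨x, rfl⟩
        rwa [hV] at this
      have hy : f.onV y ≠ Γ.τ e := by
        have : f.onV y ∈ Set.range f.onV := ⟨y, rfl⟩
        rwa [hV] at this
      cases p with
      | nil => exact ⟨[], fV h, rfl⟩
      | cons d p =>
        by_cases hd : d = e
        · subst hd
          cases p with
          | nil => exact absurd h.2.symm hy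
          | cons d' p =>
            obtain ⟨h1, h2, h3⟩ := h
            obtain rfl := he d' h2
            rw [PGraph.τ_inv, h1] at h3
            obtain ⟨q, hq, hq'⟩ := ih p (by simp at hp; omega) x y h3
            refine ⟨q, hq, ?_⟩
            simp only [PGraph.pathLab, List.map_cons] at hq' ⊢
            rw [val_cons, val_cons, hq', Γ.lab_inv, sgn_not, mul_inv_cancel_left]
        · have hd' : d ≠ Γ.inv e := by
            rintro rfl
            exact hx h.1.symm
          have hdE : d ∈ Set.range f.onE := hE ▸ ⟨hd, hd'⟩
          obtain ⟨d, rfl⟩ := hdE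
          have hxd : Δ.ι d = x := fV (by rw [← f.map_ι, h.1])
          have h2 := h.2
          rw [f.map_τ] at h2
          obtain ⟨q, hq, hq'⟩ := ih p (by simp at hp; omega) _ y h2
          refine ⟨d :: q, ⟨hxd, hq⟩, ?_⟩
          simp only [PGraph.pathLab, List.map_cons] at hq' ⊢
          rw [val_cons, val_cons, hq', f.map_lab]
  obtain ⟨g⟩ := hΓ.hom
  refine ⟨fun x => ?_, fun h hh => ?_, ⟨g.comp f⟩⟩
  · obtain ⟨p, hp⟩ := hΓ.conn (f.onV x)
    rw [← f.map_base] at hp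
    obtain ⟨q, hq, -⟩ := key _ p le_rfl _ _ hp
    exact ⟨q, hq⟩
  · obtain ⟨p, hp, hp'⟩ := hΓ.loops h hh
    rw [← f.map_base] at hp
    obtain ⟨q, hq, hq'⟩ := key _ p le_rfl _ _ hp
    exact ⟨q, hq, hq'.trans hp'⟩

theorem take_succ_get {α : Type*} (l : List α) (m : Fin l.length) :
    l.take (m + 1) = l.take m ++ [l.get m] := by
  rw [List.get_eq_getElem, List.take_append_getElem]

theorem exists_path_segments (W : List (List ((Σ i, X i) × Bool))) (k : Fin W.length)
    (m : Fin ((W.get k).length + 1)) :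
    ∃ p, (segments W).IsPath (Sum.inr ⟨k, 0⟩) p (Sum.inr ⟨k, m⟩) ∧
      (segments W).pathLab p = (W.get k).take m := by
  induction m using Fin.induction with
  | zero => exact ⟨[], rfl, by simp [PGraph.pathLab]⟩
  | succ m ih =>
    obtain ⟨p, hp, hp'⟩ := ih
    let e : (segments W).E := (⟨k, m⟩, true)
    have he : (segments W).IsPath (Sum.inr ⟨k, m.castSucc⟩) [e] (Sum.inr ⟨k, m.succ⟩) :=
      ⟨rfl, rfl⟩
    refine ⟨p ++ [e], hp.append he, ?_⟩
    rw [PGraph.pathLab_append, hp', Fin.val_succ, take_succ_get]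
    rfl

theorem IsBouquet.realizes {W : List (List ((Σ i, X i) × Bool))} {Γ : AGraph.{v, a, b} X}
    (hΓ : IsBouquet W Γ) :
    Realizes φ gen (Subgroup.closure {g | ∃ p ∈ W, val φ gen p = g}) Γ := by
  obtain ⟨f, hf⟩ := hΓ
  set H := Subgroup.closure {g | ∃ p ∈ W, val φ gen p = g}
  have h0 : ∀ k, f.onV (Sum.inr ⟨k, 0⟩) = Γ.base := fun k => by
    rw [← f.map_base]
    exact (hf.2.2.1 _ _).2 (.rel _ _ ⟨rfl, k, .inl rfl⟩)
  have h1 : ∀ k, f.onV (Sum.inr ⟨k, Fin.last _⟩) = Γ.base := fun k => by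
    rw [← f.map_base]
    exact (hf.2.2.1 _ _).2 (.rel _ _ ⟨rfl, k, .inr rfl⟩)
  refine ⟨fun x => ?_, fun h hh => ?_, ?_⟩
  · obtain ⟨x, rfl⟩ := hf.1 x
    rcases x with x | ⟨k, m⟩
    · exact ⟨[], f.map_base.symm⟩
    · obtain ⟨p, hp, -⟩ := exists_path_segments W k m
      exact ⟨p.map f.onE, h0 k ▸ f.map_path hp⟩
  · induction hh using Subgroup.closure_induction with
    | mem h hh =>
      obtain ⟨p, hp, rfl⟩ := hh
      obtain ⟨k, rfl⟩ := List.get_of_mem hp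
      obtain ⟨q, hq, hq'⟩ := exists_path_segments W k (Fin.last _)
      refine ⟨q.map f.onE, ?_, ?_⟩
      · have := f.map_path hq
        rwa [h0, h1] at this
      · rw [f.map_pathLab, hq']
        simp
    | one => exact ⟨[], rfl, rfl⟩
    | mul h h' _ _ ih ih' =>
      obtain ⟨p, hp, rfl⟩ := ih
      obtain ⟨p', hp', rfl⟩ := ih'
      exact ⟨p ++ p', hp.append hp', by rw [PGraph.pathLab_append, val_append]⟩
    | inv h _ ih =>
      obtain ⟨p, hp, rfl⟩ := ih
      exact ⟨_, hp.reverse, by rw [PGraph.pathLab_reverse, val_invWord]⟩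
  -- A point of a segment is sent to the coset of the value of the prefix read so far; the far end
  -- lands on the base vertex because the whole word represents a generator of `H`.
  · let F : (segments W).V → (cayleyG φ gen H).V :=
      Sum.elim (fun _ => vtx φ gen H 1)
        fun km => vtx φ gen H (val φ gen ((W.get km.1).take km.2))
    have hstep : ∀ (k : Fin W.length) (m : Fin (W.get k).length),
        val φ gen ((W.get k).take (m + 1)) =
          val φ gen ((W.get k).take m) * val φ gen [(W.get k).get m] := by
      intro k m
      rw [take_succ_get, val_append]
    obtain ⟨g, hg⟩ := exists_hom_of_onV (Γ := segments W) F rfl (by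
      rintro ⟨⟨k, m⟩, t⟩
      cases t
      · refine ⟨val φ gen ((W.get k).take (m + 1)), by simp [segments, F], ?_⟩
        rw [hstep]
        simp [F, segments, PGraph.τ, val_cons, sgn_not]
      · refine ⟨val φ gen ((W.get k).take m), by simp [segments, F], ?_⟩
        have h2 := hstep k m
        simp only [List.get_eq_getElem] at h2
        simp [F, segments, PGraph.τ, ← h2])
    obtain ⟨g', -⟩ := hf.exists_lift g
      (by
        rintro _ _ ⟨rfl, k, rfl | rfl⟩
        · rw [hg]
          simp [F]
        · rw [hg]
          simp only [F, Sum.elim_inr, Sum.elim_inl, Fin.val_last, List.take_length]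
          rw [vtx_eq_iff, one_mul, inv_mem_iff]
          exact Subgroup.subset_closure ⟨_, List.get_mem _ _, rfl⟩)
      (fun _ _ h => h.elim)
    exact ⟨g'⟩

end Realizes

end Stallings

/-! ### Step 3: gluing Cayley graphs of the factors -/

namespace Stallings

open AGraph

namespace PGraph

variable {X : Type v} {Γ : PGraph.{v, a, b} X} {Δ : PGraph.{v, c, d} X}

/-- The inclusion of the first graph into a disjoint union. -/
def inlHom (Γ : PGraph.{v, a, b} X) (Δ : PGraph.{v, c, d} X) : Hom Γ (Γ.sum Δ) :=
  ⟨Sum.inl, Sum.inl, fun _ => rfl, fun _ => rfl, fun _ => rfl, rfl⟩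

/-- The inclusion of the second graph into a disjoint union. -/
def inrHom (Γ : PGraph.{v, a, b} X) (Δ : PGraph.{v, c, d} X) :
    Hom Δ ((Γ.sum Δ).rebase (Sum.inr Δ.base)) :=
  ⟨Sum.inr, Sum.inr, fun _ => rfl, fun _ => rfl, fun _ => rfl, rfl⟩

/-- The morphism from a disjoint union given by two morphisms. -/
def sumHom {Θ : PGraph.{v, u, w} X} {x : Θ.V} (f : Hom Γ Θ) (g : Hom Δ (Θ.rebase x)) :
    Hom (Γ.sum Δ) Θ where
  onV := Sum.elim f.onV g.onV
  onE := Sum.elim f.onE g.onE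
  map_ι := by rintro (e | e) <;> [exact f.map_ι e; exact g.map_ι e]
  map_inv := by rintro (e | e) <;> [exact f.map_inv e; exact g.map_inv e]
  map_lab := by rintro (e | e) <;> [exact f.map_lab e; exact g.map_lab e]
  map_base := f.map_base

theorem IsPath.of_rebase {x y z : Γ.V} {p : List Γ.E} (h : (Γ.rebase z).IsPath x p y) :
    Γ.IsPath x p y := by
  induction p generalizing x with
  | nil => exact h
  | cons e p ih => exact ⟨h.1, ih h.2⟩

theorem IsPath.exists_split {x z : Γ.V} {q : List Γ.E} {s t : List (X × Bool)}
    (h : Γ.IsPath x q z) (hq : Γ.pathLab q = s ++ t) :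
    ∃ q₁ q₂ y, Γ.IsPath x q₁ y ∧ Γ.IsPath y q₂ z ∧ Γ.pathLab q₁ = s ∧ Γ.pathLab q₂ = t := by
  obtain ⟨q₁, q₂, rfl, h1, h2⟩ := List.map_eq_append_iff.1 hq
  obtain ⟨y, hy, hy'⟩ := isPath_append.1 h
  exact ⟨q₁, q₂, y, hy, hy', h1, h2⟩

end PGraph

section Covered

variable {X : Fin 2 → Type v} {G : Fin 2 → Type u} [∀ i, Group (G i)] {A : Type c} [Group A]
  (φ : ∀ i, A →* G i) (gen : ∀ i, X i → G i)

/-- Every word over `X_i^±` that represents `1` labels a closed path at `x`. -/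
def CoveredAt (Γ : AGraph.{v, a, b} X) (i : Fin 2) (x : Γ.V) : Prop :=
  ∀ p, (∀ l ∈ p, l.1.1 = i) → val φ gen p = 1 → ∃ q, Γ.IsPath x q x ∧ Γ.pathLab q = p

/-- Every monochromatic component contains an edge of the list `l` or an edge at whose initial
vertex `Γ` is covered. -/
def Seeded (Γ : AGraph.{v, a, b} X) (l : List Γ.E) : Prop :=
  ∀ e, ∃ e', SameComp Γ e e' ∧ (e' ∈ l ∨ CoveredAt φ gen Γ (colour Γ e) (Γ.ι e'))

variable {φ gen}

theorem CoveredAt.map {Γ : AGraph.{v, a, b} X} {Δ : AGraph.{v, r, s} X} {i : Fin 2} {x : Γ.V}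
    (h : CoveredAt φ gen Γ i x) (f : PGraph.Hom Γ Δ) : CoveredAt φ gen Δ i (f.onV x) := by
  intro p hp hp'
  obtain ⟨q, hq, rfl⟩ := h p hp hp'
  exact ⟨q.map f.onE, f.map_path hq, f.map_pathLab q⟩

/-- The factor embeds in the amalgam, so a word over its generators that is trivial in the amalgam
is already trivial in the factor. -/
theorem coveredAt_cayleyFactor (hφ : ∀ i, Function.Injective (φ i)) {i : Fin 2}
    (K : Subgroup (G i)) (x : (cayleyFactor gen i K).V) :
    CoveredAt φ gen (cayleyFactor gen i K) i x := by
  intro p hp hp'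
  obtain ⟨k, rfl⟩ := factorVtx_surjective i K x
  obtain ⟨m, q, hm, hq, hq'⟩ := exists_path_cayleyFactor φ K k hp
  obtain rfl : m = 1 := PushoutI.of_injective hφ i (by rw [hm, hp', map_one])
  rw [mul_one] at hq
  exact ⟨q, hq, hq'⟩

theorem sameComp_map {Γ : AGraph.{v, a, b} X} {Δ : AGraph.{v, r, s} X} {e e' : Γ.E}
    (f : PGraph.Hom Γ Δ) (h : SameComp Γ e e') : SameComp Δ (f.onE e) (f.onE e') := by
  obtain ⟨h1, p, hp⟩ := h
  refine ⟨by rw [colour_map, colour_map, h1], p.map f.onE, ?_⟩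
  rw [colour_map, f.map_ι, f.map_ι]
  exact hp.map f

theorem sameComp_refl {Γ : AGraph.{v, a, b} X} (e : Γ.E) : SameComp Γ e e :=
  ⟨rfl, [], IsMonoPath.nil _ _⟩

theorem Seeded.map {Γ : AGraph.{v, a, b} X} {Δ : AGraph.{v, r, s} X} {l : List Γ.E}
    (h : Seeded φ gen Γ l) (f : PGraph.Hom Γ Δ) (hf : Function.Surjective f.onE) :
    Seeded φ gen Δ (l.map f.onE) := by
  intro e
  obtain ⟨e, rfl⟩ := hf e
  obtain ⟨e', he', h | h⟩ := h e
  · exact ⟨f.onE e', sameComp_map f he', .inl (List.mem_map_of_mem h)⟩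
  · refine ⟨f.onE e', sameComp_map f he', .inr ?_⟩
    rw [colour_map, f.map_ι]
    exact h.map f

/-- A trivial word is conjugated by the label of the path to the covered vertex. In a well-labelled
graph the outer parts of the resulting loop must be the path and its reverse, so the middle part is
a loop at the new vertex. -/
theorem CoveredAt.of_isMonoPath {Γ : AGraph.{v, a, b} X} {i : Fin 2} {x y : Γ.V} {p : List Γ.E}
    (h : CoveredAt φ gen Γ i x) (hΓ : Γ.WellLabelled) (hp : IsMonoPath Γ i x p y) :
    CoveredAt φ gen Γ i y := by
  intro s hs hs'
  have hp' := forall_colour_iff.1 hp.2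
  obtain ⟨q, hq, hql⟩ := h (Γ.pathLab p ++ (s ++ invWord (Γ.pathLab p)))
    (mono_append hp' (mono_append hs (mono_invWord hp')))
    (by rw [val_append, val_append, val_invWord, hs']; simp)
  obtain ⟨q₁, q₂, y₁, h1, h2, h3, h4⟩ := hq.exists_split hql
  obtain ⟨q₃, q₄, y₂, h5, h6, h7, h8⟩ := h2.exists_split h4
  obtain rfl := hΓ.path_unique h1 hp.1 h3
  obtain rfl := h1.target_unique hp.1
  have h9 := h6.reverse
  obtain h10 := hΓ.path_unique h9 h1 (by
    rw [PGraph.pathLab_reverse, h8]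
    simp [invWord, List.map_reverse, Function.comp_def])
  rw [h10] at h9
  obtain rfl := h9.target_unique h1
  exact ⟨q₃, h5, h7⟩

theorem Seeded.coveredAt {Γ : AGraph.{v, a, b} X} (h : Seeded φ gen Γ []) (hΓ : Γ.WellLabelled)
    (e : Γ.E) : CoveredAt φ gen Γ (colour Γ e) (Γ.ι e) := by
  obtain ⟨e', ⟨-, p, hp⟩, h | h⟩ := h e
  · simp at h
  · exact h.of_isMonoPath hΓ hp.reverse

end Covered

section Gluing

variable {X : Fin 2 → Type v} {G : Fin 2 → Type u} [∀ i, Group (G i)] {A : Type c} [Group A]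
  {φ : ∀ i, A →* G i} {gen : ∀ i, X i → G i} {H : Subgroup (PushoutI φ)}

theorem IsGlueAlong.colour_eq {Γ Δ : AGraph.{v, a, b} X} {e : Γ.E} {i : Fin 2}
    {f : PGraph.Hom (Γ.sum (cayleyFactor gen i ⊥)) Δ} (hf : IsGlueAlong gen Γ Δ e i f) :
    colour Γ e = i := by
  obtain ⟨e₀, -, h, -⟩ := hf
  rw [colour, ← h]
  exact colour_cayleyFactor e₀

/-- The edge taken from the list now starts at a vertex of the glued Cayley graph, where trivial
words close up; it remains a witness for its component. -/
theorem IsGlueAlong.seeded (hφ : ∀ i, Function.Injective (φ i)) {Γ Δ : AGraph.{v, a, b} X}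
    {e : Γ.E} {l : List Γ.E} {i : Fin 2}
    {f : PGraph.Hom (Γ.sum (cayleyFactor gen i ⊥)) Δ} (hf : IsGlueAlong gen Γ Δ e i f)
    (h : Seeded φ gen Γ (e :: l)) :
    Seeded φ gen Δ (l.map fun e' => f.onE (Sum.inl e')) := by
  have hcol := hf.colour_eq
  obtain ⟨e₀, hb, hlab, hq⟩ := hf
  let f₁ := f.comp (PGraph.inlHom Γ (cayleyFactor gen i ⊥))
  let f₂ := (f.rebase (Sum.inr (cayleyFactor gen i ⊥).base)).comp
    (PGraph.inrHom Γ (cayleyFactor gen i ⊥))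
  have hcov : ∀ x : (cayleyFactor gen i ⊥).V, CoveredAt φ gen Δ i (f.onV (Sum.inr x)) := by
    intro x p hp hp'
    obtain ⟨q, hq, hq'⟩ := (coveredAt_cayleyFactor hφ ⊥ x).map f₂ p hp hp'
    exact ⟨q, hq.of_rebase, hq'⟩
  intro d
  obtain ⟨d, rfl⟩ := hq.2.1 d
  rcases d with d | d
  · obtain ⟨e', he', h | h⟩ := h d
    · refine ⟨f₁.onE e', sameComp_map f₁ he', ?_⟩
      rcases List.mem_cons.1 h with rfl | h
      · right
        have h1 : colour Δ (f.onE (Sum.inl d)) = i :=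
          (colour_map f₁ d).trans (he'.1.symm.trans hcol)
        have h2 : Δ.ι (f₁.onE e') = f.onV (Sum.inr ((cayleyFactor gen i ⊥).ι e₀)) := by
          rw [f₁.map_ι]
          exact (hq.2.2.1 _ _).2 (.rel _ _ (.inl ⟨rfl, rfl⟩))
        rw [h1, h2]
        exact hcov _
      · exact .inl (List.mem_map.2 ⟨e', h, rfl⟩)
    · refine ⟨f₁.onE e', sameComp_map f₁ he', .inr ?_⟩
      rw [f₁.map_ι]
      have h1 : colour Δ (f.onE (Sum.inl d)) = colour Γ d := colour_map f₁ d
      rw [h1]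
      exact h.map f₁
  · refine ⟨_, sameComp_refl _, .inr ?_⟩
    have h1 : colour Δ (f.onE (Sum.inr d)) = i := colour_map f₂ d
    have h2 : Δ.ι (f.onE (Sum.inr d)) = f.onV (Sum.inr ((cayleyFactor gen i ⊥).ι d)) := f.map_ι _
    rw [h1, h2]
    exact hcov _

/-- The copy of Cayley(G_i) is mapped to the translate starting at the image of `e`. It agrees with
the old morphism on the glued edge because the target is well-labelled, and its vertices are reached
through that edge. -/
theorem IsGlueAlong.realizes (hgen : ∀ i, Subgroup.closure (Set.range (gen i)) = ⊤)
    (hφ : ∀ i, Function.Injective (φ i)) {Γ Δ : AGraph.{v, a, b} X}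
    {e : Γ.E} {i : Fin 2}
    {f : PGraph.Hom (Γ.sum (cayleyFactor gen i ⊥)) Δ} (hf : IsGlueAlong gen Γ Δ e i f)
    (h : Realizes φ gen H Γ) : Realizes φ gen H Δ := by
  obtain ⟨e₀, hb, hlab, hq⟩ := hf
  let f₁ := f.comp (PGraph.inlHom Γ (cayleyFactor gen i ⊥))
  let f₂ := (f.rebase (Sum.inr (cayleyFactor gen i ⊥).base)).comp
    (PGraph.inrHom Γ (cayleyFactor gen i ⊥))
  obtain ⟨g⟩ := h.hom
  obtain ⟨y, hy⟩ := vtx_surjective (g.onV (Γ.ι e))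
  let g₂ : PGraph.Hom (cayleyFactor gen i ⊥) ((cayleyG φ gen H).rebase (vtx φ gen H y)) :=
    factorHom i ⊥ y (by
      intro k hk
      obtain rfl : k = 1 := by simpa using hk
      simp)
  have hι : g.onV (Γ.ι e) = g₂.onV ((cayleyFactor gen i ⊥).ι e₀) := by
    rw [hb, g₂.map_base]
    exact hy.symm
  have hE : g.onE e = g₂.onE e₀ := by
    apply wellLabelled_cayleyG
    · rw [g.map_ι]
      exact hι.trans (g₂.map_ι e₀).symm
    · rw [g.map_lab]
      exact hlab.symm.trans (g₂.map_lab e₀).symm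
  have hinv : g.onE (Γ.inv e) = g₂.onE ((cayleyFactor gen i ⊥).inv e₀) := by
    rw [← g.map_inv, hE]
    exact g₂.map_inv e₀
  have hτ : g.onV (Γ.τ e) = g₂.onV ((cayleyFactor gen i ⊥).τ e₀) := by
    rw [← g.map_τ, hE]
    exact g₂.map_τ e₀
  obtain ⟨k, -⟩ := hq.exists_lift (PGraph.sumHom g g₂)
    (by rintro _ _ (⟨rfl, rfl⟩ | ⟨rfl, rfl⟩) <;> [exact hι; exact hτ])
    (by rintro _ _ (⟨rfl, rfl⟩ | ⟨rfl, rfl⟩) <;> [exact hE; exact hinv])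
  refine ⟨fun x => ?_, fun t ht => ?_, ⟨k⟩⟩
  · obtain ⟨x, rfl⟩ := hq.1 x
    rcases x with x | x
    · obtain ⟨p, hp⟩ := h.conn x
      exact ⟨_, f₁.map_base ▸ f₁.map_path hp⟩
    · obtain ⟨m, rfl⟩ := factorVtx_surjective i ⊥ x
      obtain ⟨s, hs, hs'⟩ := exists_word φ gen hgen i m
      obtain ⟨m', q, hm', hq', -⟩ := exists_path_cayleyFactor φ (gen := gen) ⊥ 1 hs
      obtain rfl : m' = m := PushoutI.of_injective hφ i (hm'.trans hs')
      rw [one_mul] at hq'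
      obtain ⟨p, hp⟩ := h.conn (Γ.ι e)
      have h1 := (f₂.map_path hq').of_rebase
      have h2 := f₁.map_path hp
      have h3 : f₁.onV (Γ.ι e) = f₂.onV (factorVtx gen i ⊥ 1) :=
        ((hq.2.2.1 _ _).2 (.rel _ _ (.inl ⟨rfl, rfl⟩))).trans
          (congrArg (fun z => f.onV (Sum.inr z)) hb)
      rw [h3, f₁.map_base] at h2
      exact ⟨_, h2.append h1⟩
  · obtain ⟨p, hp, hp'⟩ := h.loops t ht
    refine ⟨p.map f₁.onE, ?_, by rw [f₁.map_pathLab, hp']⟩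
    have := f₁.map_path hp
    rwa [f₁.map_base] at this

end Gluing

/-! ### Step 4: making the two colours agree on A -/

section Compatibility

variable {X : Fin 2 → Type v} {G : Fin 2 → Type u} [∀ i, Group (G i)] {A : Type c} [Group A]
  (φ : ∀ i, A →* G i) (gen : ∀ i, X i → G i) (H : Subgroup (PushoutI φ))

/-- Some path from `x` to `y` over `X_i^±` represents `g`. -/
def MonoAct (Γ : AGraph.{v, a, b} X) (i : Fin 2) (x : Γ.V) (g : PushoutI φ) (y : Γ.V) : Prop :=
  ∃ p, IsMonoPath Γ i x p y ∧ val φ gen (Γ.pathLab p) = g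

/-- Every bichromatic vertex is a translate of an element of `S` by an element of `A`. -/
def Anchored (Γ : AGraph.{v, a, b} X) (S : Set Γ.V) (y : Γ.V) : Prop :=
  ∃ x ∈ S, ∃ g ∈ amalg φ, ∀ i, MonoAct φ gen Γ i x g y

/-- The invariant of the fourth step. -/
structure IsPrecover (Γ : AGraph.{v, a, b} X) (S : Set Γ.V) : Prop where
  realizes : Realizes φ gen H Γ
  covered : ∀ e, CoveredAt φ gen Γ (colour Γ e) (Γ.ι e)
  subset : S ⊆ VB Γ
  anchored : ∀ y ∈ VB Γ, Anchored φ gen Γ S y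

variable {φ gen H}

theorem MonoAct.map {Γ : AGraph.{v, a, b} X} {Δ : AGraph.{v, r, s} X} {i : Fin 2} {x y : Γ.V}
    {g : PushoutI φ} (h : MonoAct φ gen Γ i x g y) (f : PGraph.Hom Γ Δ) :
    MonoAct φ gen Δ i (f.onV x) g (f.onV y) := by
  obtain ⟨p, hp, rfl⟩ := h
  exact ⟨p.map f.onE, hp.map f, by rw [f.map_pathLab]⟩

theorem MonoAct.mul {Γ : AGraph.{v, a, b} X} {i : Fin 2} {x y z : Γ.V} {g k : PushoutI φ}
    (h : MonoAct φ gen Γ i x g y) (h' : MonoAct φ gen Γ i y k z) :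
    MonoAct φ gen Γ i x (g * k) z := by
  obtain ⟨p, hp, rfl⟩ := h
  obtain ⟨q, hq, rfl⟩ := h'
  exact ⟨p ++ q, hp.append hq, by rw [PGraph.pathLab_append, val_append]⟩

theorem MonoAct.inv {Γ : AGraph.{v, a, b} X} {i : Fin 2} {x y : Γ.V} {g : PushoutI φ}
    (h : MonoAct φ gen Γ i x g y) : MonoAct φ gen Γ i y g⁻¹ x := by
  obtain ⟨p, hp, rfl⟩ := h
  exact ⟨_, hp.reverse, by rw [PGraph.pathLab_reverse, val_invWord]⟩

theorem vb_map {Γ : AGraph.{v, a, b} X} {Δ : AGraph.{v, r, s} X} (f : PGraph.Hom Γ Δ) {x : Γ.V}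
    (h : x ∈ VB Γ) : f.onV x ∈ VB Δ := by
  intro i
  obtain ⟨e, he, he'⟩ := h i
  exact ⟨f.onE e, by rw [f.map_ι, he], by rw [colour_map, he']⟩

theorem Anchored.map {Γ : AGraph.{v, a, b} X} {Δ : AGraph.{v, r, s} X} {S : Set Γ.V} {y : Γ.V}
    (h : Anchored φ gen Γ S y) (f : PGraph.Hom Γ Δ) :
    Anchored φ gen Δ (f.onV '' S) (f.onV y) := by
  obtain ⟨x, hx, g, hg, h⟩ := h
  exact ⟨_, ⟨x, hx, rfl⟩, g, hg, fun i => (h i).map f⟩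

/-- At the beginning of step 4 every bichromatic vertex is anchored at itself, by the trivial
element. -/
theorem IsPrecover.of_vb {Γ : AGraph.{v, a, b} X} (h : Realizes φ gen H Γ)
    (hc : ∀ e, CoveredAt φ gen Γ (colour Γ e) (Γ.ι e)) : IsPrecover φ gen H Γ (VB Γ) :=
  ⟨h, hc, subset_rfl, fun y hy => ⟨y, hy, 1, one_mem _, fun _ => ⟨[], .nil _ _, rfl⟩⟩⟩

theorem IsPrecover.map {Γ : AGraph.{v, a, b} X} {Δ : AGraph.{v, r, s} X} {S : Set Γ.V}
    (h : IsPrecover φ gen H Γ S) (hΔ : Realizes φ gen H Δ) (f : PGraph.Hom Γ Δ)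
    (hf : Function.Surjective f.onE)
    (hVB : ∀ y ∈ VB Δ, (∃ x ∈ VB Γ, f.onV x = y) ∨ Anchored φ gen Δ (f.onV '' S) y) :
    IsPrecover φ gen H Δ (f.onV '' S) where
  realizes := hΔ
  covered e := by
    obtain ⟨e, rfl⟩ := hf e
    rw [colour_map, f.map_ι]
    exact (h.covered e).map f
  subset := by
    rintro _ ⟨x, hx, rfl⟩
    exact vb_map f (h.subset hx)
  anchored y hy := by
    rcases hVB y hy with ⟨x, hx, rfl⟩ | h'
    · exact (h.anchored x hx).map f
    · exact h'

/-- A bichromatic vertex of a quotient comes from a bichromatic vertex or from two related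
vertices. -/
theorem exists_mem_vb_of_isQuotient {Γ : AGraph.{v, a, b} X} {Δ : AGraph.{v, r, s} X}
    {f : PGraph.Hom Γ Δ} {y₀ y₁ : Γ.V} {s : Γ.E → Γ.E → Prop}
    (hf : f.IsQuotient (fun x y => x = y₀ ∧ y = y₁) s) {y : Δ.V} (hy : y ∈ VB Δ) :
    (∃ x ∈ VB Γ, f.onV x = y) ∨ y = f.onV y₀ := by
  by_contra! hno
  obtain ⟨h1, h2⟩ := hno
  have hinj : ∀ x x', f.onV x = y → f.onV x = f.onV x' → x = x' := by
    intro x x' hx hxx'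
    have h3 := (hf.2.2.1 _ _).1 hxx'
    have h4 : f.onV y₀ = f.onV y₁ := (hf.2.2.1 _ _).2 (.rel _ _ ⟨rfl, rfl⟩)
    have key : ∀ x x', Relation.EqvGen (fun x y => x = y₀ ∧ y = y₁) x x' →
        x = x' ∨ f.onV x = f.onV y₀ := by
      intro x x' h
      induction h with
      | rel x y h => exact .inr (by rw [h.1])
      | refl => exact .inl rfl
      | symm x x' h ih =>
        rcases ih with rfl | ih
        · exact .inl rfl
        · exact .inr (((hf.2.2.1 _ _).2 h).symm.trans ih)
      | trans x x' x'' h h' ih ih' =>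
        rcases ih with rfl | ih
        · exact ih'
        · exact .inr ih
    rcases key x x' h3 with h | h
    · exact h
    · exact absurd (hx.symm.trans h) h2
  obtain ⟨x, rfl⟩ := hf.1 y
  refine h1 x (fun i => ?_) rfl
  obtain ⟨e, he, he'⟩ := hy i
  obtain ⟨e, rfl⟩ := hf.2.1 e
  rw [f.map_ι] at he
  refine ⟨e, (hinj _ _ rfl he.symm).symm, ?_⟩
  rwa [colour_map] at he'

/-- Folding creates no essentially new bichromatic vertex: the two merged vertices already share the
colour of the folded edges, so any edge of the other colour at the merged vertex came from a vertex
that was bichromatic before. -/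
theorem IsPrecover.fold {Γ : AGraph.{v, a, b} X} {Δ : AGraph.{v, r, s} X} {S : Set Γ.V}
    (h : IsPrecover φ gen H Γ S) {f : PGraph.Hom Γ Δ} (hf : f.IsFold) :
    IsPrecover φ gen H Δ (f.onV '' S) := by
  refine h.map (h.realizes.fold hf) f ?_ ?_
  · obtain ⟨e₁, e₂, -, hι, hlab, hq⟩ := hf
    exact hq.2.1
  · intro y hy
    left
    obtain ⟨e₁, e₂, -, hι, hlab, hq⟩ := hf
    rcases exists_mem_vb_of_isQuotient hq hy with hx | rfl
    · exact hx
    by_contra! hno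
    -- both identified vertices start an edge of the colour of the fold
    have hcol : colour Γ e₁ = colour Γ e₂ := by rw [colour, colour, hlab]
    have h12 : f.onV (Γ.τ e₁) = f.onV (Γ.τ e₂) := (hq.2.2.1 _ _).2 (.rel _ _ ⟨rfl, rfl⟩)
    obtain ⟨j, hj⟩ : ∃ j, j ≠ colour Γ e₁ := exists_ne _
    have hbi : ∀ x, (∃ e, Γ.ι e = x ∧ colour Γ e = colour Γ e₁) →
        (∃ e, Γ.ι e = x ∧ colour Γ e = j) → x ∈ VB Γ := by
      intro x h1 h2 i
      by_cases hi : i = j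
      · rwa [hi]
      · obtain rfl : i = colour Γ e₁ := by omega
        exact h1
    have hpre : ∀ x, f.onV x = f.onV (Γ.τ e₁) →
        (∃ e, Γ.ι e = x ∧ colour Γ e = colour Γ e₁) := by
      intro x hx
      have key : ∀ x x', Relation.EqvGen (fun x y => x = Γ.τ e₁ ∧ y = Γ.τ e₂) x x' →
          ((∃ e, Γ.ι e = x ∧ colour Γ e = colour Γ e₁) ↔
            (∃ e, Γ.ι e = x' ∧ colour Γ e = colour Γ e₁)) := by
        intro x x' h
        induction h with
        | rel x y h =>
          obtain ⟨rfl, rfl⟩ := h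
          exact ⟨fun _ => ⟨Γ.inv e₂, rfl, by rw [colour_inv, hcol]⟩,
            fun _ => ⟨Γ.inv e₁, rfl, colour_inv e₁⟩⟩
        | refl => exact Iff.rfl
        | symm _ _ _ ih => exact ih.symm
        | trans _ _ _ _ _ ih ih' => exact ih.trans ih'
      exact (key _ _ ((hq.2.2.1 _ _).1 hx)).2 ⟨Γ.inv e₁, rfl, colour_inv e₁⟩
    obtain ⟨e, he, he'⟩ := hy j
    obtain ⟨e, rfl⟩ := hq.2.1 e
    rw [f.map_ι] at he
    rw [colour_map] at he'
    exact hno _ (hbi _ (hpre _ he) ⟨e, rfl, he'⟩) he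

/-- The merged vertex may become bichromatic, but it is reached from the inspected vertex `x` by
paths of both colours with the same value in A, so it is anchored at the image of `x`. This is why
the original bichromatic vertices suffice for the inspection. -/
theorem IsPrecover.identify {Γ : AGraph.{v, a, b} X} {Δ : AGraph.{v, r, s} X} {S : Set Γ.V}
    (h : IsPrecover φ gen H Γ S) {x y₀ y₁ : Γ.V} (hx : x ∈ S)
    (hinc : Incompatible φ gen Γ x y₀ y₁) {f : PGraph.Hom Γ Δ}
    (hf : f.IsQuotient (fun y z => y = y₀ ∧ z = y₁) (fun _ _ => False)) :
    IsPrecover φ gen H Δ (f.onV '' S) := by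
  obtain ⟨-, p₀, p₁, hp₀, hp₁, h₀, -, h01⟩ := hinc
  refine h.map ?_ f hf.2.1 ?_
  · obtain ⟨g⟩ := h.realizes.hom
    obtain ⟨k, -⟩ := hf.exists_lift g (by
      rintro _ _ ⟨rfl, rfl⟩
      obtain ⟨t, ht⟩ := vtx_surjective (g.onV x)
      rw [hom_path g hp₀.1 ht.symm, hom_path g hp₁.1 ht.symm, h01]) (fun _ _ h => h.elim)
    exact h.realizes.of_surjective f hf.1 k
  · intro y hy
    rcases exists_mem_vb_of_isQuotient hf hy with hx | rfl
    · exact .inl hx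
    right
    have h12 : f.onV y₀ = f.onV y₁ := (hf.2.2.1 _ _).2 (.rel _ _ ⟨rfl, rfl⟩)
    refine ⟨_, ⟨x, hx, rfl⟩, _, h₀, fun i => ?_⟩
    obtain rfl | rfl : i = 0 ∨ i = 1 := by omega
    · exact MonoAct.map ⟨p₀, hp₀, rfl⟩ f
    · rw [h12]
      exact MonoAct.map ⟨p₁, hp₁, h01.symm⟩ f

end Compatibility

end Stallings

/-! ### The embedding into Cayley(G,H) after step 4 -/

namespace Stallings

open AGraph

section PartialActionOfGraph

variable {X : Fin 2 → Type v} {G : Fin 2 → Type u} [∀ i, Group (G i)] {A : Type c} [Group A]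
  (φ : ∀ i, A →* G i) (gen : ∀ i, X i → G i)

/-- Some edge with label in `X_i^±` starts at `x`. -/
def HasEdge (Γ : AGraph.{v, a, b} X) (i : Fin 2) (x : Γ.V) : Prop :=
  ∃ e, Γ.ι e = x ∧ colour Γ e = i

/-- The partial action of the factors on the vertices of a graph. -/
def EdgeAct (Γ : AGraph.{v, a, b} X) (i : Fin 2) (x : Γ.V) (g : PushoutI φ) (y : Γ.V) : Prop :=
  HasEdge Γ i x ∧ MonoAct φ gen Γ i x g y

variable {φ gen}

theorem HasEdge.of_isMonoPath {Γ : AGraph.{v, a, b} X} {i : Fin 2} {x y : Γ.V} {p : List Γ.E}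
    (h : HasEdge Γ i x) (hp : IsMonoPath Γ i x p y) : HasEdge Γ i y := by
  induction p generalizing x with
  | nil =>
    obtain rfl : x = y := hp.1
    exact h
  | cons e p ih =>
    refine ih (x := Γ.τ e) ⟨Γ.inv e, rfl, ?_⟩ ⟨hp.1.2, fun d hd => hp.2 d (List.mem_cons_of_mem _ hd)⟩
    rw [colour_inv]
    exact hp.2 e List.mem_cons_self

variable {H : Subgroup (PushoutI φ)} {Γ : AGraph.{v, a, b} X} {S : Set Γ.V}

theorem IsPrecover.coveredAt (h : IsPrecover φ gen H Γ S) {i : Fin 2} {x : Γ.V}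
    (hx : HasEdge Γ i x) : CoveredAt φ gen Γ i x := by
  obtain ⟨e, rfl, rfl⟩ := hx
  exact h.covered e

/-- Coverage is applied to the word followed by its formal inverse, and the first half of the loop
is kept. -/
theorem IsPrecover.exists_path (h : IsPrecover φ gen H Γ S) {i : Fin 2} {x : Γ.V}
    (hx : HasEdge Γ i x) {p : List ((Σ i, X i) × Bool)} (hp : ∀ l ∈ p, l.1.1 = i) :
    ∃ q y, IsMonoPath Γ i x q y ∧ Γ.pathLab q = p := by
  obtain ⟨q, hq, hq'⟩ := h.coveredAt hx (p ++ invWord p) (mono_append hp (mono_invWord hp))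
    (by rw [val_append, val_invWord, mul_inv_cancel])
  obtain ⟨q₁, q₂, y, h1, h2, h3, h4⟩ := hq.exists_split hq'
  exact ⟨q₁, y, ⟨h1, forall_colour_iff.2 (h3 ▸ hp)⟩, h3⟩

/-- Coverage and well-labelledness make each factor act. Agreement on A is tested at vertices of `S`
only and is carried by anchoring to all bichromatic vertices. -/
theorem IsPrecover.isPartialAction (hgen : ∀ i, Subgroup.closure (Set.range (gen i)) = ⊤)
    (h : IsPrecover φ gen H Γ S) (hΓ : Γ.WellLabelled)
    (hS : ∀ x ∈ S, ∀ y₀ y₁, ¬ Incompatible φ gen Γ x y₀ y₁) :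
    IsPartialAction (factor φ) (amalg φ) (EdgeAct φ gen Γ) := by
  have hmem : ∀ {i x g y}, EdgeAct φ gen Γ i x g y → g ∈ factor φ i := by
    rintro i x g y ⟨-, p, hp, rfl⟩
    exact val_mem_factor (forall_colour_iff.1 hp.2)
  have htotal : ∀ {i x g y k}, EdgeAct φ gen Γ i x g y → k ∈ factor φ i →
      ∃ z, EdgeAct φ gen Γ i x k z := by
    rintro i x g y k ⟨hx, -⟩ hk
    obtain ⟨p, hp, rfl⟩ := exists_word_of_mem φ gen hgen hk
    obtain ⟨q, z, hq, rfl⟩ := h.exists_path hx hp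
    exact ⟨z, hx, q, hq, rfl⟩
  refine ⟨hmem, ?_, ?_, htotal, ?_, ?_⟩
  · rintro i x g y k z ⟨hx, h1⟩ ⟨-, h2⟩
    exact ⟨hx, h1.mul h2⟩
  · rintro i x g y ⟨hx, h1⟩
    obtain ⟨p, hp, -⟩ := id h1
    exact ⟨hx.of_isMonoPath hp, h1.inv⟩
  · rintro i x g y z ⟨hx, p, hp, rfl⟩ ⟨-, q, hq, hpq⟩
    have hp' := forall_colour_iff.1 hp.2
    -- The second path preceded by the reverse of the first has a trivial label, hence closes up at
    -- `y`; by unique reading its end is also `z`.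
    obtain ⟨t, ht, ht'⟩ := h.coveredAt (hx.of_isMonoPath hp)
      (invWord (Γ.pathLab p) ++ Γ.pathLab q)
      (mono_append (mono_invWord hp') (forall_colour_iff.1 hq.2))
      (by rw [val_append, val_invWord, hpq, inv_mul_cancel])
    obtain ⟨t₁, t₂, x', h1, h2, h3, h4⟩ := ht.exists_split ht'
    have h5 := hΓ.path_unique h1 hp.1.reverse (by rw [h3, PGraph.pathLab_reverse])
    rw [h5] at h1
    obtain rfl := h1.target_unique hp.1.reverse
    obtain rfl := hΓ.path_unique h2 hq.1 h4
    exact h2.target_unique hq.1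
  · intro i j x g y k z h1 hg h2
    by_cases hij : i = j
    · exact hij ▸ h1
    have hl : ∀ l, l = i ∨ l = j := fun l => by omega
    obtain ⟨y', h3⟩ := htotal h2 (k := g) (by
      obtain ⟨α, rfl⟩ := hg
      exact ⟨φ j α, PushoutI.of_apply_eq_base φ j α⟩)
    have hx : x ∈ VB Γ := by
      intro l
      rcases hl l with rfl | rfl
      · exact h1.1
      · exact h2.1
    -- Acting by `g` at `x` amounts, for both colours, to acting by `t * g` at the inspected vertex
    -- `x₀`, where a disagreement would be an incompatibility.
    obtain ⟨x₀, hx₀, t, ht, hact⟩ := h.anchored x hx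
    obtain ⟨p, hp, hpv⟩ := (hact i).mul h1.2
    obtain ⟨p', hp', hpv'⟩ := (hact j).mul h3.2
    have hA : t * g ∈ amalg φ := mul_mem ht hg
    suffices y = y' by rwa [this]
    by_contra hyy
    obtain ⟨rfl, rfl⟩ | ⟨rfl, rfl⟩ : (i = 0 ∧ j = 1) ∨ (i = 1 ∧ j = 0) := by omega
    · exact hS x₀ hx₀ y y' ⟨hyy, p, p', hp, hp', hpv ▸ hA, hpv' ▸ hA, hpv.trans hpv'.symm⟩
    · exact hS x₀ hx₀ y' y
        ⟨Ne.symm hyy, p', p, hp', hp, hpv' ▸ hA, hpv ▸ hA, hpv'.trans hpv.symm⟩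

theorem reach_of_isPath {x y : Γ.V} {g : PushoutI φ} {p : List Γ.E}
    (hx : Reach (EdgeAct φ gen Γ) Γ.base g x) (hp : Γ.IsPath x p y) :
    Reach (EdgeAct φ gen Γ) Γ.base (g * val φ gen (Γ.pathLab p)) y := by
  induction p generalizing x g with
  | nil =>
    obtain rfl : x = y := hp
    simpa [PGraph.pathLab] using hx
  | cons e p ih =>
    have h1 : EdgeAct φ gen Γ (colour Γ e) x (val φ gen [Γ.lab e]) (Γ.τ e) :=
      ⟨⟨e, hp.1, rfl⟩, [e], ⟨⟨hp.1, rfl⟩, by simp⟩, rfl⟩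
    have := ih (.step hx h1) hp.2
    rwa [mul_assoc, ← val_append] at this

/-- Vertices with the same image are reached by paths whose values differ by an element of `H`.
Prefixing a loop for that element makes the values equal, and uniqueness for partial actions
identifies the endpoints. -/
theorem IsPrecover.injective (hφ : ∀ i, Function.Injective (φ i))
    (hgen : ∀ i, Subgroup.closure (Set.range (gen i)) = ⊤)
    (h : IsPrecover φ gen H Γ S) (hΓ : Γ.WellLabelled)
    (hS : ∀ x ∈ S, ∀ y₀ y₁, ¬ Incompatible φ gen Γ x y₀ y₁)
    (f : PGraph.Hom Γ (cayleyG φ gen H)) : Function.Injective f.onV := by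
  intro x y hxy
  obtain ⟨p, hp⟩ := h.realizes.conn x
  obtain ⟨q, hq⟩ := h.realizes.conn y
  have hb : f.onV Γ.base = vtx φ gen H 1 := f.map_base
  rw [hom_path f hp hb, hom_path f hq hb, vtx_eq_iff, one_mul, one_mul] at hxy
  obtain ⟨t, ht, ht'⟩ := h.realizes.loops _ hxy
  have h1 := reach_of_isPath (φ := φ) (gen := gen) .one (ht.append hp)
  have h2 := reach_of_isPath (φ := φ) (gen := gen) .one hq
  rw [PGraph.pathLab_append, val_append, ht', inv_mul_cancel_right] at h1
  exact h1.unique (isAmalgam_pushout φ hφ) (h.isPartialAction hgen hΓ hS) h2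

end PartialActionOfGraph

/-! ### Graphs as subtrees of the amalgam -/

section Represents

variable {X : Fin 2 → Type v} {G : Fin 2 → Type u} [∀ i, Group (G i)] {A : Type c} [Group A]
  (φ : ∀ i, A →* G i) (gen : ∀ i, X i → G i) (H : Subgroup (PushoutI φ))

/-- The elements `g` of the amalgam such that `H g ∈ B i`. -/
def lifts (B : Fin 2 → Set (cayleyG φ gen H).V) (i : Fin 2) : Set (PushoutI φ) :=
  {g | vtx φ gen H g ∈ B i}

/-- `f` is an isomorphism from `Γ` onto the connected subgraph of `Cayley(G, H)` that consists of
the basepoint and of the edges with label in `X_i^±` that start in `B i`, `i = 0, 1`. -/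
structure Represents (Γ : AGraph.{v, a, b} X) (f : PGraph.Hom Γ (cayleyG φ gen H))
    (B : Fin 2 → Set (cayleyG φ gen H).V) : Prop where
  injV : Function.Injective f.onV
  injE : Function.Injective f.onE
  mem_rangeV : ∀ x, x ∈ Set.range f.onV ↔ x = vtx φ gen H 1 ∨ ∃ i, x ∈ B i
  mem_rangeE : ∀ e, e ∈ Set.range f.onE ↔
    (cayleyG φ gen H).ι e ∈ B (colour (cayleyG φ gen H) e)
  nonempty : ∀ {i x}, x ∈ B i → Nonempty (X i)
  subtree : IsSubtree (factor φ) H (lifts φ gen H B)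

variable {φ gen H}
variable {Γ : AGraph.{v, a, b} X} {f : PGraph.Hom Γ (cayleyG φ gen H)}
  {B : Fin 2 → Set (cayleyG φ gen H).V}

theorem mem_lifts {i : Fin 2} {g : PushoutI φ} :
    g ∈ lifts φ gen H B i ↔ vtx φ gen H g ∈ B i := Iff.rfl

/-- Coverage supplies all edges of a colour at every vertex that has one of them, so the image
consists of whole components of Cayley(G,H). Connectedness and the loops for `H` give the subtree
conditions. -/
theorem IsPrecover.represents (hφ : ∀ i, Function.Injective (φ i))
    (hgen : ∀ i, Subgroup.closure (Set.range (gen i)) = ⊤) {S : Set Γ.V}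
    (h : IsPrecover φ gen H Γ S) (hΓ : Γ.WellLabelled)
    (hS : ∀ x ∈ S, ∀ y₀ y₁, ¬ Incompatible φ gen Γ x y₀ y₁)
    (f : PGraph.Hom Γ (cayleyG φ gen H)) :
    Represents φ gen H Γ f (fun i => f.onV '' {x | HasEdge Γ i x}) := by
  have hinj := h.injective hφ hgen hΓ hS f
  have hb : f.onV Γ.base = vtx φ gen H 1 := f.map_base
  have hpath : ∀ {x y : Γ.V} {g : PushoutI φ} {p : List Γ.E},
      Reach (mulAct (factor φ) (lifts φ gen H fun i => f.onV '' {x | HasEdge Γ i x})) 1 g g →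
      f.onV x = vtx φ gen H g → Γ.IsPath x p y →
      Reach (mulAct (factor φ) (lifts φ gen H fun i => f.onV '' {x | HasEdge Γ i x})) 1
        (g * val φ gen (Γ.pathLab p)) (g * val φ gen (Γ.pathLab p)) := by
    intro x y g p hg hx hp
    induction p generalizing x g with
    | nil => simpa [PGraph.pathLab] using hg
    | cons e p ih =>
      have hp1 : Γ.IsPath x [e] (Γ.τ e) := ⟨hp.1, rfl⟩
      have h1 := hom_path f hp1 hx
      have := ih (.step (i := colour Γ e) (k := val φ gen (Γ.pathLab [e])) hg
        ⟨⟨x, ⟨e, hp.1, rfl⟩, hx⟩, val_mem_factor (by simp [PGraph.pathLab, colour]), rfl⟩) h1 hp.2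
      rw [mul_assoc, ← val_append] at this
      exact this
  have hreach : ∀ x g, f.onV x = vtx φ gen H g →
      Reach (mulAct (factor φ) (lifts φ gen H fun i => f.onV '' {x | HasEdge Γ i x})) 1 g g := by
    intro x g hx
    obtain ⟨p, hp⟩ := h.realizes.conn x
    rw [hom_path f hp hb, vtx_eq_iff, one_mul] at hx
    obtain ⟨q, hq, hq'⟩ := h.realizes.loops _ hx
    have := hpath .one hb (hq.append hp)
    rwa [PGraph.pathLab_append, val_append, hq', inv_mul_cancel_right, one_mul] at this
  refine ⟨hinj, ?_, ?_, ?_, ?_, ?_, ?_, ?_, ?_⟩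
  · intro e e' hee
    apply hΓ
    · apply hinj
      rw [← f.map_ι, ← f.map_ι, hee]
    · rw [← f.map_lab, ← f.map_lab, hee]
  · intro x
    constructor
    · rintro ⟨x, rfl⟩
      obtain ⟨p, hp⟩ := h.realizes.conn x
      rcases List.eq_nil_or_concat p with rfl | ⟨q, e, rfl⟩
      · left
        obtain rfl : Γ.base = x := hp
        exact hb
      · right
        rw [List.concat_eq_append] at hp
        obtain ⟨y, -, -, hy⟩ := PGraph.isPath_append.1 hp
        exact ⟨colour Γ e, x, ⟨Γ.inv e, hy, colour_inv e⟩, rfl⟩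
    · rintro (rfl | ⟨i, x, -, rfl⟩)
      · exact ⟨_, hb⟩
      · exact ⟨x, rfl⟩
  · intro e
    constructor
    · rintro ⟨e, rfl⟩
      rw [f.map_ι, colour_map]
      exact ⟨_, ⟨e, rfl, rfl⟩, rfl⟩
    · rintro ⟨x, hx, hxe⟩
      obtain ⟨q, y, hq, hq'⟩ := h.exists_path hx (p := [(cayleyG φ gen H).lab e]) (by simp [colour])
      obtain ⟨d, rfl⟩ : ∃ d, q = [d] := by
        have := congrArg List.length hq'
        simp [PGraph.pathLab] at this
        exact List.length_eq_one_iff.1 this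
      refine ⟨d, ?_⟩
      apply wellLabelled_cayleyG
      · rw [f.map_ι, hq.1.1, hxe]
      · rw [f.map_lab]
        simpa [PGraph.pathLab] using hq'
  · rintro i _ ⟨x, ⟨e, rfl, rfl⟩, rfl⟩
    exact ⟨(Γ.lab e).1.2⟩
  · rintro i g k ⟨x, hx, hxg⟩ hk
    obtain ⟨p, hp, rfl⟩ := exists_word_of_mem φ gen hgen hk
    obtain ⟨q, z, hq, rfl⟩ := h.exists_path hx hp
    exact ⟨z, hx.of_isMonoPath hq, hom_path f hq.1 hxg⟩
  · rintro i g t ⟨x, hx, hxg⟩ ht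
    exact ⟨x, hx, hxg.trans (vtx_mul_of_mem ht).symm⟩
  · rintro i g ⟨x, hx, hxg⟩
    exact hreach x g hxg
  · intro t ht
    refine hreach Γ.base t ?_
    rw [hb]
    simpa using (vtx_mul_of_mem (g := 1) ht).symm

namespace Represents

theorem onV_base (_ : Represents φ gen H Γ f B) : f.onV Γ.base = vtx φ gen H 1 := f.map_base

/-- The field `nonempty` is needed here: a factor without generators would leave no edge to witness
membership in `B i`. -/
theorem hasEdge_iff (h : Represents φ gen H Γ f B) {i : Fin 2} {x : Γ.V} :
    HasEdge Γ i x ↔ f.onV x ∈ B i := by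
  constructor
  · rintro ⟨e, rfl, rfl⟩
    have := (h.mem_rangeE (f.onE e)).1 ⟨e, rfl⟩
    rwa [f.map_ι, colour_map] at this
  · intro hx
    obtain ⟨z⟩ := h.nonempty hx
    obtain ⟨e, he⟩ := (h.mem_rangeE (edgeAt (f.onV x) (⟨i, z⟩, true))).2 hx
    refine ⟨e, h.injV ?_, ?_⟩
    · rw [← f.map_ι, he, ι_edgeAt]
    · rw [← colour_map f, he]
      rfl

theorem mem_vb_iff (h : Represents φ gen H Γ f B) {x : Γ.V} :
    x ∈ VB Γ ↔ ∀ i, f.onV x ∈ B i :=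
  forall_congr' fun _ => h.hasEdge_iff

theorem mem_vm_iff (h : Represents φ gen H Γ f B) {i j : Fin 2} (hij : i ≠ j) {x : Γ.V} :
    x ∈ VM Γ i ↔ f.onV x ∉ B j := by
  rw [← h.hasEdge_iff]
  constructor
  · rintro hx ⟨e, he, hj⟩
    exact hij ((hx e he).symm.trans hj)
  · intro hx e he
    have : colour Γ e ≠ j := fun hj => hx ⟨e, he, hj⟩
    omega

theorem exists_path (h : Represents φ gen H Γ f B) {i : Fin 2} {x : Γ.V}
    {g : PushoutI φ} (hx : f.onV x = vtx φ gen H g) (hi : f.onV x ∈ B i)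
    {p : List ((Σ i, X i) × Bool)} (hp : ∀ l ∈ p, l.1.1 = i) :
    ∃ q y, IsMonoPath Γ i x q y ∧ Γ.pathLab q = p ∧ f.onV y = vtx φ gen H (g * val φ gen p) := by
  induction p generalizing x g with
  | nil => exact ⟨[], x, .nil _ _, rfl, by simpa using hx⟩
  | cons l p ih =>
    have hl : l.1.1 = i := hp l List.mem_cons_self
    obtain ⟨e, he⟩ := (h.mem_rangeE (edgeAt (f.onV x) l)).2 (by rw [← hl] at hi; exact hi)
    have hex : Γ.ι e = x := h.injV (by rw [← f.map_ι, he, ι_edgeAt])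
    have hel : Γ.lab e = l := by rw [← f.map_lab, he, lab_edgeAt]
    have hec : colour Γ e = i := by rw [colour, hel, hl]
    have hτ := hom_path f (x := x) (p := [e]) (y := Γ.τ e) ⟨hex, rfl⟩ hx
    have hτ' : f.onV (Γ.τ e) ∈ B i :=
      h.hasEdge_iff.1 ⟨Γ.inv e, rfl, (colour_inv e).trans hec⟩
    obtain ⟨q, y, hq, hq', hy⟩ := ih hτ hτ' fun l hl => hp l (List.mem_cons_of_mem _ hl)
    refine ⟨e :: q, y, ⟨⟨hex, hq.1⟩, ?_⟩, ?_, ?_⟩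
    · rintro d hd
      rcases List.mem_cons.1 hd with rfl | hd
      · exact hec
      · exact hq.2 d hd
    · rw [← hq', ← hel]
      rfl
    · rw [hy, mul_assoc, ← val_append, ← hel]
      rfl

/-- Monochromatic components are the images of left cosets `g F i`; this is the dictionary between
components and the tree. -/
theorem mem_compV_iff (hgen : ∀ i, Subgroup.closure (Set.range (gen i)) = ⊤)
    (h : Represents φ gen H Γ f B) {i : Fin 2} {x y : Γ.V}
    {g : PushoutI φ} (hx : f.onV x = vtx φ gen H g) (hi : f.onV x ∈ B i) :
    y ∈ compV Γ i x ↔ ∃ k ∈ factor φ i, f.onV y = vtx φ gen H (g * k) := by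
  constructor
  · rintro ⟨p, hp⟩
    exact ⟨_, val_mem_factor (forall_colour_iff.1 hp.2), hom_path f hp.1 hx⟩
  · rintro ⟨k, hk, hy⟩
    obtain ⟨p, hp, rfl⟩ := exists_word_of_mem φ gen hgen hk
    obtain ⟨q, z, hq, -, hz⟩ := h.exists_path hx hi hp
    obtain rfl : y = z := h.injV (hy.trans hz.symm)
    exact ⟨q, hq⟩

theorem colour_mem (h : Represents φ gen H Γ f B) (e : Γ.E) : f.onV (Γ.ι e) ∈ B (colour Γ e) :=
  h.hasEdge_iff.1 ⟨e, rfl, rfl⟩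

end Represents

end Represents

end Stallings

/-! ### Removable components are leaves -/

namespace Stallings

open AGraph

theorem PGraph.Hom.exists_lift_injective {X : Type v} {Γ : PGraph.{v, a, b} X}
    {Θ : PGraph.{v, r, s} X} {Λ : PGraph.{v, u, w} X} (f : Hom Γ Θ)
    (hV : Function.Injective f.onV) (hE : Function.Injective f.onE) {x : Γ.V} {z : Θ.V}
    (hx : f.onV x = z) (k : Hom Λ (Θ.rebase z)) (hkV : ∀ y, k.onV y ∈ Set.range f.onV)
    (hkE : ∀ e, k.onE e ∈ Set.range f.onE) :
    ∃ l : Hom Λ (Γ.rebase x), (∀ y, f.onV (l.onV y) = k.onV y) ∧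
      ∀ e, f.onE (l.onE e) = k.onE e := by
  choose lV hlV using hkV
  choose lE hlE using hkE
  refine ⟨⟨lV, lE, fun e => hV ?_, fun e => hE ?_, fun e => ?_, hV ?_⟩, hlV, hlE⟩
  · exact (f.map_ι _).symm.trans ((congrArg Θ.ι (hlE e)).trans ((k.map_ι e).trans (hlV _).symm))
  · exact (f.map_inv _).symm.trans ((congrArg Θ.inv (hlE e)).trans ((k.map_inv e).trans (hlE _).symm))
  · exact (f.map_lab _).symm.trans ((congrArg Θ.lab (hlE e)).trans (k.map_lab e))
  · exact (hlV _).trans (k.map_base.trans hx.symm)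

/-- The map factors through an injection of the right cosets of `K ∩ R` in `R`. It turns the
condition on the number of bichromatic vertices into the size of an orbit of A. -/
theorem ncard_image_eq_relIndex {Q : Type u} [Group Q] {V : Type a} {K : Subgroup Q} {m : Q → V}
    (hm : ∀ k k', m k = m k' ↔ k' * k⁻¹ ∈ K) (R : Subgroup Q) :
    (m '' R).ncard = K.relIndex R := by
  rw [Subgroup.relIndex, Subgroup.index,
    ← Nat.card_congr (QuotientGroup.quotientRightRelEquivQuotientLeftRel (K.subgroupOf R)),
    ← Nat.card_coe_set_eq]
  let F : Quotient (QuotientGroup.rightRel (K.subgroupOf R)) → V :=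
    Quotient.lift (fun q => m q) (by
      intro p q h
      have h' := QuotientGroup.rightRel_apply.1 h
      exact (hm _ _).2 h')
  have hF : Function.Injective F := by
    intro p q
    induction p using Quotient.inductionOn
    induction q using Quotient.inductionOn
    intro h
    exact Quotient.sound (QuotientGroup.rightRel_apply.2 ((hm _ _).1 h))
  rw [Nat.card_congr (Equiv.ofInjective F hF)]
  congr 2
  ext x
  constructor
  · rintro ⟨k, hk, rfl⟩
    exact ⟨Quotient.mk _ ⟨k, hk⟩, rfl⟩
  · rintro ⟨q, rfl⟩
    induction q using Quotient.inductionOn with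
    | h q => exact ⟨q, q.2, rfl⟩

section Steps

variable {X : Fin 2 → Type v} {G : Fin 2 → Type u} [∀ i, Group (G i)] {A : Type c} [Group A]
  {φ : ∀ i, A →* G i} {gen : ∀ i, X i → G i} {H : Subgroup (PushoutI φ)}
  {Γ : AGraph.{v, a, b} X} {f : PGraph.Hom Γ (cayleyG φ gen H)}
  {B : Fin 2 → Set (cayleyG φ gen H).V}

/-- The vertices of a copy of `Cayley(G_i, K)`. -/
theorem exists_vertex_map (hφ : ∀ i, Function.Injective (φ i))
    (hgen : ∀ i, Subgroup.closure (Set.range (gen i)) = ⊤) {i : Fin 2} {K : Subgroup (G i)}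
    {x : Γ.V} {S : Set Γ.V} {T : Set Γ.E}
    (h : PGraph.IsoOnto (cayleyFactor gen i K) (Γ.rebase x) S T) :
    ∃ m : G i → Γ.V, (∀ k k', m k = m k' ↔ k' * k⁻¹ ∈ K) ∧ Set.range m = S ∧
      ∀ k, MonoAct φ gen Γ i x (PushoutI.of i k) (m k) := by
  obtain ⟨F, hFV, -, hS, -⟩ := h
  refine ⟨fun k => F.onV (factorVtx gen i K k), fun k k' => hFV.eq_iff.trans factorVtx_eq_iff,
    ?_, fun k => ?_⟩
  · exact ((factorVtx_surjective i K).range_comp F.onV).trans hS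
  · obtain ⟨p, hp, hp'⟩ := exists_word φ gen hgen i k
    obtain ⟨m, q, hm, hq, hq'⟩ := exists_path_cayleyFactor φ (gen := gen) K 1 hp
    obtain rfl : m = k := PushoutI.of_injective hφ i (hm.trans hp')
    rw [one_mul] at hq
    have h1 := (isMonoPath_cayleyFactor hq).map F
    have h2 : F.onV (factorVtx gen i K 1) = x := F.map_base
    rw [h2] at h1
    refine ⟨q.map F.onE, ⟨h1.1.of_rebase, h1.2⟩, ?_⟩
    have h3 : Γ.pathLab (q.map F.onE) = p := (F.map_pathLab q).trans hq'
    exact (congrArg (val φ gen) h3).trans hp'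

theorem MonoAct.onV_eq {i : Fin 2} {x y : Γ.V} {t : PushoutI φ} (h : MonoAct φ gen Γ i x t y)
    (f : PGraph.Hom Γ (cayleyG φ gen H)) {g : PushoutI φ} (hx : f.onV x = vtx φ gen H g) :
    f.onV y = vtx φ gen H (g * t) := by
  obtain ⟨p, hp, rfl⟩ := h
  exact hom_path f hp.1 hx

/-- The stabilizer in `G_i` of the vertex `H g`. -/
def stab (H : Subgroup (PushoutI φ)) (i : Fin 2) (g : PushoutI φ) : Subgroup (G i) :=
  (H.comap (MulAut.conj g).toMonoidHom).comap (PushoutI.of i)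

theorem mem_stab {i : Fin 2} {g : PushoutI φ} {k : G i} :
    k ∈ stab H i g ↔ g * PushoutI.of i k * g⁻¹ ∈ H := Iff.rfl

theorem of_mem_amalg_iff (hφ : ∀ i, Function.Injective (φ i)) {i : Fin 2} {k : G i} :
    PushoutI.of i k ∈ amalg φ ↔ k ∈ (φ i).range := by
  constructor
  · rintro ⟨α, hα⟩
    rw [← PushoutI.of_apply_eq_base φ i] at hα
    exact ⟨α, PushoutI.of_injective hφ i hα⟩
  · rintro ⟨α, rfl⟩
    exact ⟨α, (PushoutI.of_apply_eq_base φ i α).symm⟩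

namespace Represents

theorem mem_iff_of_vertex_map (h : Represents φ gen H Γ f B)
    {i : Fin 2} {K : Subgroup (G i)} {x : Γ.V} {m : G i → Γ.V}
    (hm : ∀ k k', m k = m k' ↔ k' * k⁻¹ ∈ K)
    (hact : ∀ k, MonoAct φ gen Γ i x (PushoutI.of i k) (m k))
    {g : PushoutI φ} (hx : f.onV x = vtx φ gen H g) (k : G i) :
    k ∈ K ↔ g * PushoutI.of i k * g⁻¹ ∈ H := by
  have h1 := (hact 1).onV_eq f hx
  rw [map_one, mul_one] at h1
  have h2 := hm 1 k
  rw [inv_one, mul_one] at h2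
  rw [← h2, ← h.injV.eq_iff, h1, (hact k).onV_eq f hx, vtx_eq_iff]

/-- Right multiplication by the factor is transitive on the component and has the stabilizer of the
vertex as its point stabilizer, so `K` can only be this stabilizer. -/
theorem isoOnto_comp (hgen : ∀ i, Subgroup.closure (Set.range (gen i)) = ⊤)
    (h : Represents φ gen H Γ f B)
    {i : Fin 2} {x : Γ.V} {g : PushoutI φ} (hx : f.onV x = vtx φ gen H g) (hi : f.onV x ∈ B i) :
    PGraph.IsoOnto (cayleyFactor gen i (stab H i g)) (Γ.rebase x) (compV Γ i x) (compE Γ i x) := by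
  have hg : g ∈ lifts φ gen H B i := by rwa [mem_lifts, ← hx]
  have hgk : ∀ k : G i, vtx φ gen H (g * PushoutI.of i k) ∈ B i := fun k =>
    h.subtree.mulMem hg ⟨k, rfl⟩
  obtain ⟨F, hFV, hFE⟩ := f.exists_lift_injective h.injV h.injE hx
    (factorHom (gen := gen) i (stab H i g) g fun k hk => hk)
    (by
      intro y
      obtain ⟨k, rfl⟩ := factorVtx_surjective i _ y
      exact (h.mem_rangeV _).2 (.inr ⟨i, hgk k⟩))
    (by
      rintro ⟨y, l⟩
      obtain ⟨k, hk⟩ := factorVtx_surjective (gen := gen) i _ y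
      subst hk
      exact (h.mem_rangeE _).2 (hgk k))
  have hFV' : ∀ k, f.onV (F.onV (factorVtx gen i _ k)) = vtx φ gen H (g * PushoutI.of i k) :=
    fun k => (hFV _).trans (factorHom_onV _ k)
  have hVinj : Function.Injective F.onV := by
    intro y y' hyy
    obtain ⟨k, rfl⟩ := factorVtx_surjective i _ y
    obtain ⟨k', rfl⟩ := factorVtx_surjective i _ y'
    have := (hFV' k).symm.trans ((congrArg f.onV hyy).trans (hFV' k'))
    rw [vtx_eq_iff] at this
    rw [factorVtx_eq_iff, mem_stab]
    simpa [mul_assoc] using this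
  refine ⟨F, hVinj, ?_, ?_, ?_⟩
  · intro e e' hee
    apply wellLabelled_cayleyFactor
    · apply hVinj
      rw [← F.map_ι, ← F.map_ι, hee]
    · rw [← F.map_lab, ← F.map_lab, hee]
  · refine Set.ext fun y => Iff.trans ?_ (h.mem_compV_iff hgen hx hi).symm
    constructor
    · rintro ⟨z, rfl⟩
      obtain ⟨k, rfl⟩ := factorVtx_surjective i _ z
      exact ⟨_, ⟨k, rfl⟩, hFV' k⟩
    · rintro ⟨_, ⟨k, rfl⟩, hy⟩
      exact ⟨factorVtx gen i _ k, h.injV ((hFV' k).trans hy.symm)⟩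
  · refine Set.ext fun e => ?_
    constructor
    · rintro ⟨d, rfl⟩
      refine ⟨(colour_map F d).trans (colour_cayleyFactor d), (h.mem_compV_iff hgen hx hi).2 ?_⟩
      obtain ⟨k, hk⟩ := factorVtx_surjective i _ ((cayleyFactor gen i (stab H i g)).ι d)
      refine ⟨_, ⟨k, rfl⟩, ?_⟩
      rw [← hFV' k, hk]
      exact congrArg f.onV (F.map_ι d)
    · rintro ⟨hc, he⟩
      obtain ⟨_, ⟨k, rfl⟩, hy⟩ := (h.mem_compV_iff hgen hx hi).1 he
      have hc' : (Γ.lab e).1.1 = i := hc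
      obtain ⟨l, hl⟩ : ∃ l : X i × Bool, ((⟨i, l.1⟩, l.2) : (Σ i, X i) × Bool) = Γ.lab e := by
        generalize Γ.lab e = l at hc'
        obtain ⟨⟨j, z⟩, t⟩ := l
        obtain rfl : j = i := hc'
        exact ⟨(z, t), rfl⟩
      let d : (cayleyFactor gen i (stab H i g)).E := (factorVtx gen i _ k, l)
      refine ⟨d, h.injE ?_⟩
      apply wellLabelled_cayleyG
      · exact (f.map_ι _).trans (((congrArg f.onV (F.map_ι d)).trans (hFV' k)).trans
          (hy.symm.trans (f.map_ι e).symm))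
      · exact (f.map_lab _).trans ((F.map_lab d).trans (hl.trans (f.map_lab e).symm))

theorem base_mem_compV_iff (hgen : ∀ i, Subgroup.closure (Set.range (gen i)) = ⊤)
    (h : Represents φ gen H Γ f B) {i : Fin 2} {x : Γ.V} {g : PushoutI φ}
    (hx : f.onV x = vtx φ gen H g) (hi : f.onV x ∈ B i) :
    Γ.base ∈ compV Γ i x ↔ ∃ t ∈ H, g⁻¹ * t ∈ factor φ i := by
  rw [h.mem_compV_iff hgen hx hi, h.onV_base]
  constructor
  · rintro ⟨k, hk, hk'⟩
    rw [vtx_eq_iff] at hk'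
    exact ⟨g * k, by simpa using hk', by simpa using hk⟩
  · rintro ⟨t, ht, ht'⟩
    refine ⟨_, ht', ?_⟩
    rw [vtx_eq_iff]
    simpa using ht

/-- The translates of the vertex by A are bichromatic, and the cardinality condition says that there
are no others. The component is then attached to the other colour along a single coset of A, which
is what being a leaf requires. -/
theorem isLeaf_of_isRemovable (hφ : ∀ i, Function.Injective (φ i))
    (hgen : ∀ i, Subgroup.closure (Set.range (gen i)) = ⊤) [Finite Γ.V]
    (h : Represents φ gen H Γ f B) {i j : Fin 2} (hij : i ≠ j) {x : Γ.V} {g : PushoutI φ}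
    (hx : f.onV x = vtx φ gen H g) (hr : IsRemovable φ gen Γ i x) :
    IsLeaf (factor φ) (amalg φ) H (lifts φ gen H B) i j g := by
  obtain ⟨hVB, K, hiso, hKA, hcard, hbase⟩ := hr
  obtain ⟨m, hm, hrange, hact⟩ := exists_vertex_map hφ hgen hiso
  have hB := h.mem_vb_iff.1 hVB
  have hi := hB i
  have hj := hB j
  have hK := h.mem_iff_of_vertex_map hm hact hx
  have hgi : g ∈ lifts φ gen H B i := by rwa [mem_lifts, ← hx]
  have hgj : g ∈ lifts φ gen H B j := by rwa [mem_lifts, ← hx]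
  have hmk := fun k => (hact k).onV_eq f hx
  have hmemV : ∀ k, m k ∈ compV Γ i x := fun k => hrange ▸ ⟨k, rfl⟩
  have hmemVB : ∀ k, vtx φ gen H (g * PushoutI.of i k) ∈ B j → m k ∈ VB Γ := by
    intro k hk
    rw [h.mem_vb_iff]
    intro l
    rw [hmk]
    obtain rfl | rfl : l = i ∨ l = j := by omega
    · exact h.subtree.mulMem hgi ⟨k, rfl⟩
    · exact hk
  -- One inclusion and equality of the cardinals suffice, the graph being finite.
  have heq : m '' (φ i).range = compV Γ i x ∩ VB Γ := by
    refine Set.eq_of_subset_of_ncard_le ?_ ?_ (Set.toFinite _)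
    · rintro _ ⟨_, ⟨α, rfl⟩, rfl⟩
      refine ⟨hmemV _, hmemVB _ (h.subtree.mulMem hgj ?_)⟩
      rw [PushoutI.of_apply_eq_base]
      exact ⟨φ j α, PushoutI.of_apply_eq_base φ j α⟩
    · rw [hcard, ncard_image_eq_relIndex hm]
  refine ⟨hgi, hgj, ?_, ?_, ?_⟩
  · rintro _ ⟨k, rfl⟩ hk
    exact (of_mem_amalg_iff hφ).2 (hKA ((hK k).2 hk))
  · rintro _ ⟨k, rfl⟩ hk
    have h1 : m k ∈ compV Γ i x ∩ VB Γ := ⟨hmemV k, hmemVB k hk⟩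
    rw [← heq] at h1
    obtain ⟨k', hk', hkk⟩ := h1
    rw [hm] at hkk
    rw [of_mem_amalg_iff hφ]
    simpa using mul_mem (hKA hkk) hk'
  · rw [Set.mem_inter_iff, h.base_mem_compV_iff hgen hx hi, h.mem_vm_iff hij, h.onV_base] at hbase
    refine hbase.imp ?_ ?_
    · rintro ⟨rfl, hb⟩
      refine ⟨?_, hb⟩
      rintro _ ⟨k, rfl⟩ hk
      obtain rfl : k = 1 := by simpa using (hK k).2 hk
      exact map_one _
    · rintro ⟨hK1, hb⟩
      refine ⟨?_, hb⟩
      obtain ⟨k, hk, hk1⟩ := K.bot_or_exists_ne_one.resolve_left hK1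
      refine ⟨_, ⟨k, rfl⟩, (hK k).1 hk, fun h1 => hk1 (PushoutI.of_injective hφ i ?_)⟩
      rw [h1, map_one]

theorem isRemovable_of_isLeaf (hφ : ∀ i, Function.Injective (φ i))
    (hgen : ∀ i, Subgroup.closure (Set.range (gen i)) = ⊤)
    (h : Represents φ gen H Γ f B) {i j : Fin 2} (hij : i ≠ j) {x : Γ.V} {g : PushoutI φ}
    (hx : f.onV x = vtx φ gen H g)
    (hl : IsLeaf (factor φ) (amalg φ) H (lifts φ gen H B) i j g) :
    IsRemovable φ gen Γ i x := by
  obtain ⟨hgi, hgj, hK, hZ, hbase⟩ := hl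
  have hi : f.onV x ∈ B i := by rw [hx]; exact hgi
  have hj : f.onV x ∈ B j := by rw [hx]; exact hgj
  have hl : ∀ l, l = i ∨ l = j := fun l => by omega
  have hiso := h.isoOnto_comp hgen hx hi
  refine ⟨h.mem_vb_iff.2 fun l => ?_, stab H i g, hiso, ?_, ?_, ?_⟩
  · rcases hl l with rfl | rfl
    · exact hi
    · exact hj
  · intro k hk
    exact (of_mem_amalg_iff hφ).1 (hK _ ⟨k, rfl⟩ hk)
  · obtain ⟨m, hm, hrange, hact⟩ := exists_vertex_map hφ hgen hiso
    have hmk := fun k => (hact k).onV_eq f hx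
    rw [← ncard_image_eq_relIndex hm]
    congr 1
    ext y
    constructor
    · rintro ⟨hy, hy'⟩
      obtain ⟨k, rfl⟩ := hrange ▸ hy
      refine ⟨k, ?_, rfl⟩
      rw [SetLike.mem_coe, ← of_mem_amalg_iff hφ]
      refine hZ _ ⟨k, rfl⟩ ?_
      rw [mem_lifts, ← hmk]
      exact h.mem_vb_iff.1 hy' j
    · rintro ⟨_, ⟨α, rfl⟩, rfl⟩
      refine ⟨hrange ▸ ⟨_, rfl⟩, h.mem_vb_iff.2 fun l => ?_⟩
      rw [hmk]
      have : (PushoutI.of i (φ i α) : PushoutI φ) ∈ factor φ l := by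
        rw [PushoutI.of_apply_eq_base]
        exact ⟨φ l α, PushoutI.of_apply_eq_base φ l α⟩
      rcases hl l with rfl | rfl
      · exact h.subtree.mulMem hgi this
      · exact h.subtree.mulMem hgj this
  · rw [Set.mem_inter_iff, h.base_mem_compV_iff hgen hx hi, h.mem_vm_iff hij, h.onV_base]
    refine hbase.imp ?_ ?_
    · rintro ⟨h1, hb⟩
      refine ⟨?_, hb⟩
      rw [Subgroup.eq_bot_iff_forall]
      intro k hk
      exact PushoutI.of_injective hφ i ((h1 _ ⟨k, rfl⟩ hk).trans (map_one _).symm)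
    · rintro ⟨⟨_, ⟨k, rfl⟩, hk, hk1⟩, hb⟩
      refine ⟨fun h1 => hk1 ?_, hb⟩
      have : k ∈ stab H i g := hk
      rw [h1, Subgroup.mem_bot] at this
      rw [this, map_one]

end Represents

end Steps

end Stallings

/-! ### Steps 5 and 6: trimming to the core and completing at the basepoint -/

namespace Stallings

open AGraph

section LastSteps

variable {X : Fin 2 → Type v} {G : Fin 2 → Type u} [∀ i, Group (G i)] {A : Type c} [Group A]
  {φ : ∀ i, A →* G i} {gen : ∀ i, X i → G i} {H : Subgroup (PushoutI φ)}
  {Γ : AGraph.{v, a, b} X} {f : PGraph.Hom Γ (cayleyG φ gen H)}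
  {B : Fin 2 → Set (cayleyG φ gen H).V}

namespace Represents

/-- The colour `i` is taken away from the coset of the component. Vertices that also carry the other
colour stay, and so does the basepoint. -/
theorem remove (hφ : ∀ i, Function.Injective (φ i))
    (hgen : ∀ i, Subgroup.closure (Set.range (gen i)) = ⊤) [Finite Γ.V]
    (h : Represents φ gen H Γ f B) {Δ : AGraph.{v, a, b} X} (hr : Remove φ gen Γ Δ) :
    ∃ f' B', Represents φ gen H Δ f' B' := by
  obtain ⟨i, x, hx, F, hFV, hFE, hV, hE⟩ := hr
  obtain ⟨j, hij⟩ : ∃ j, i ≠ j := (exists_ne i).imp fun _ h => h.symm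
  obtain ⟨g, hg⟩ := vtx_surjective (f.onV x)
  have hleaf := h.isLeaf_of_isRemovable hφ hgen hij hg.symm hx
  have hi : f.onV x ∈ B i := hg ▸ hleaf.1
  have hl : ∀ l, l = i ∨ l = j := fun l => by omega
  have hcomp := fun y => h.mem_compV_iff (y := y) hgen hg.symm hi
  have hbase : Γ.base ∉ compV Γ i x ∩ VM Γ i := by
    rcases hx.2.choose_spec.2.2.2 with hb | hb
    · exact hb.2
    · exact fun h => hb.2 h.1
  refine ⟨f.comp F, fun l => {y | y ∈ B l ∧ ¬ (l = i ∧ ∃ k ∈ factor φ i, y = vtx φ gen H (g * k))},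
    h.injV.comp hFV, h.injE.comp hFE, fun y => ?_, fun e => ?_, fun hy => h.nonempty hy.1, ?_⟩
  · have hrange : y ∈ Set.range (f.comp F).onV ↔
        ∃ z, z ∉ compV Γ i x ∩ VM Γ i ∧ f.onV z = y := by
      constructor
      · rintro ⟨z, rfl⟩
        have : F.onV z ∈ Set.range F.onV := ⟨z, rfl⟩
        rw [hV] at this
        exact ⟨_, this, rfl⟩
      · rintro ⟨z, hz, rfl⟩
        have : z ∈ Set.range F.onV := hV ▸ hz
        obtain ⟨z, rfl⟩ := this
        exact ⟨z, rfl⟩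
    rw [hrange]
    constructor
    · rintro ⟨z, hz, rfl⟩
      rcases (h.mem_rangeV _).1 ⟨z, rfl⟩ with hb | ⟨l, hl'⟩
      · exact .inl hb
      · rw [Set.mem_inter_iff, hcomp, h.mem_vm_iff hij] at hz
        right
        by_cases hj : f.onV z ∈ B j
        · exact ⟨j, hj, fun hji => hij hji.1.symm⟩
        · refine ⟨l, hl', fun hli => hz ⟨hli.2, hj⟩⟩
    · rintro (rfl | ⟨l, hyl, hy⟩)
      · exact ⟨Γ.base, hbase, h.onV_base⟩
      · obtain ⟨z, rfl⟩ := (h.mem_rangeV y).2 (.inr ⟨l, hyl⟩)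
        refine ⟨z, ?_, rfl⟩
        rw [Set.mem_inter_iff, hcomp, h.mem_vm_iff hij]
        rintro ⟨h1, h2⟩
        rcases hl l with rfl | rfl
        · exact hy ⟨rfl, h1⟩
        · exact h2 hyl
  · have hrange : e ∈ Set.range (f.comp F).onE ↔ ∃ d, d ∉ compE Γ i x ∧ f.onE d = e := by
      constructor
      · rintro ⟨z, rfl⟩
        have : F.onE z ∈ Set.range F.onE := ⟨z, rfl⟩
        rw [hE] at this
        exact ⟨_, this, rfl⟩
      · rintro ⟨z, hz, rfl⟩
        have : z ∈ Set.range F.onE := hE ▸ hz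
        obtain ⟨z, rfl⟩ := this
        exact ⟨z, rfl⟩
    rw [hrange]
    constructor
    · rintro ⟨d, hd, rfl⟩
      refine ⟨(h.mem_rangeE _).1 ⟨d, rfl⟩, ?_⟩
      rw [f.map_ι, colour_map]
      rintro ⟨h1, h2⟩
      exact hd ⟨h1, (hcomp _).2 h2⟩
    · rintro ⟨he, he'⟩
      obtain ⟨d, rfl⟩ := (h.mem_rangeE _).2 he
      refine ⟨d, ?_, rfl⟩
      rw [f.map_ι, colour_map] at he'
      rintro ⟨h1, h2⟩
      exact he' ⟨h1, (hcomp _).1 h2⟩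
  · refine h.subtree.remove hij hleaf (isAmalgam_pushout φ hφ) ?_ ?_
    · ext y
      exact ⟨fun hy => hy.1, fun hy => ⟨hy, fun hji => hij hji.1.symm⟩⟩
    · intro y
      refine and_congr_right fun _ => not_congr ?_
      constructor
      · rintro ⟨-, k, hk, hy⟩
        rw [vtx_eq_iff] at hy
        exact ⟨_, hy, by simpa using hk⟩
      · rintro ⟨t, ht, hk⟩
        refine ⟨rfl, _, hk, ?_⟩
        rw [mul_inv_cancel_left, vtx_mul_of_mem ht]

/-- All edges have one colour, so `H` lies in one factor; its elements there fix the basepoint of a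
copy of the Cayley graph of that factor, so they are trivial. -/
theorem eq_bot_of_isFreeFactorGraph (hφ : ∀ i, Function.Injective (φ i))
    (hgen : ∀ i, Subgroup.closure (Set.range (gen i)) = ⊤)
    (h : Represents φ gen H Γ f B) (hfree : IsFreeFactorGraph gen Γ) : H = ⊥ := by
  obtain ⟨-, i, hi⟩ := hfree
  obtain ⟨F', hF'V, hF'E⟩ := id hi
  obtain ⟨F, hFV, hFE⟩ := hi.symm
  have hiso : PGraph.IsoOnto (cayleyFactor gen i ⊥) (Γ.rebase Γ.base) Set.univ Set.univ :=
    ⟨F, hFV.1, hFE.1, hFV.2.range_eq, hFE.2.range_eq⟩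
  obtain ⟨m, hm, -, hact⟩ := exists_vertex_map hφ hgen hiso
  have hK := h.mem_iff_of_vertex_map hm hact (g := 1) h.onV_base
  have hreach : ∀ x y, Reach (mulAct (factor φ) (lifts φ gen H B)) 1 x y → x ∈ factor φ i := by
    intro x y hx
    induction hx with
    | one => exact one_mem _
    | @step l x y k z hx hk ih =>
      refine mul_mem ih ?_
      obtain ⟨z, hz⟩ := (h.mem_rangeV _).2 (.inr ⟨l, hk.1⟩)
      obtain ⟨e, -, he⟩ := h.hasEdge_iff.2 (show f.onV z ∈ B l from hz ▸ hk.1)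
      obtain rfl : l = i := by
        rw [← he, ← colour_map F' e]
        exact colour_cayleyFactor _
      exact hk.2.1
  rw [Subgroup.eq_bot_iff_forall]
  intro t ht
  obtain ⟨k, rfl⟩ := hreach t t (h.subtree.reach_of_mem ht)
  have := (hK k).2 (by simpa using ht)
  rw [Subgroup.mem_bot] at this
  rw [this, map_one]

theorem isFreeFactorGraph (hφ : ∀ i, Function.Injective (φ i))
    (h : Represents φ gen H Γ f B) {i j : Fin 2} (hij : i ≠ j) (hH : H = ⊥)
    (hj : lifts φ gen H B j = ∅) (hi : lifts φ gen H B i = factor φ i) :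
    IsFreeFactorGraph gen Γ := by
  have hj' : ∀ y, y ∉ B j := by
    intro y hy
    obtain ⟨g, rfl⟩ := vtx_surjective y
    have : g ∈ lifts φ gen H B j := hy
    rw [hj] at this
    exact this
  have hl : ∀ l, l = i ∨ l = j := fun l => by omega
  have hi' : ∀ y, y ∈ B i ↔ ∃ k : G i, y = vtx φ gen H (PushoutI.of i k) := by
    intro y
    constructor
    · intro hy
      obtain ⟨g, rfl⟩ := vtx_surjective y
      have : g ∈ lifts φ gen H B i := hy
      rw [hi] at this
      obtain ⟨k, rfl⟩ := this
      exact ⟨k, rfl⟩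
    · rintro ⟨k, rfl⟩
      rw [← mem_lifts, hi]
      exact ⟨k, rfl⟩
  refine ⟨?_, i, ?_⟩
  · rw [Set.eq_empty_iff_forall_notMem]
    exact fun y hy => hj' _ (h.mem_vb_iff.1 hy j)
  · have hK : ∀ k ∈ (⊥ : Subgroup (G i)), (1 : PushoutI φ) * PushoutI.of i k * 1⁻¹ ∈ H := by
      intro k hk
      obtain rfl : k = 1 := by simpa using hk
      simp
    let F : PGraph.Hom (cayleyFactor gen i ⊥) (cayleyG φ gen H) := factorHom i ⊥ 1 hK
    have hF : ∀ k, F.onV (factorVtx gen i ⊥ k) = vtx φ gen H (PushoutI.of i k) := fun k => by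
      rw [← one_mul (PushoutI.of i k)]
      exact factorHom_onV hK k
    have hFV : Function.Injective F.onV := by
      intro y y' hyy
      obtain ⟨k, rfl⟩ := factorVtx_surjective i _ y
      obtain ⟨k', rfl⟩ := factorVtx_surjective i _ y'
      rw [hF, hF, vtx_eq_iff, hH, Subgroup.mem_bot, mul_inv_eq_one] at hyy
      rw [PushoutI.of_injective hφ i hyy]
    refine PGraph.IsoOnto.iso (Θ := cayleyG φ gen H) ⟨f, h.injV, h.injE, rfl, rfl⟩
      ⟨F, hFV, ?_, ?_, ?_⟩
    · intro e e' hee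
      apply wellLabelled_cayleyFactor
      · apply hFV
        rw [← F.map_ι, ← F.map_ι, hee]
      · rw [← F.map_lab, ← F.map_lab, hee]
    · ext y
      rw [h.mem_rangeV]
      constructor
      · rintro ⟨z, rfl⟩
        obtain ⟨k, rfl⟩ := factorVtx_surjective i _ z
        exact .inr ⟨i, (hi' _).2 ⟨k, hF k⟩⟩
      · rintro (rfl | ⟨l, hy⟩)
        · exact ⟨_, F.map_base⟩
        · rcases hl l with rfl | rfl
          · obtain ⟨k, rfl⟩ := (hi' _).1 hy
            exact ⟨_, hF k⟩
          · exact absurd hy (hj' _)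
    · ext e
      rw [h.mem_rangeE]
      constructor
      · rintro ⟨d, rfl⟩
        obtain ⟨k, hk⟩ := factorVtx_surjective (gen := gen) i ⊥ ((cayleyFactor gen i ⊥).ι d)
        rw [F.map_ι, colour_map, colour_cayleyFactor, hi', ← hk]
        exact ⟨k, hF k⟩
      · intro he
        have hc : colour (cayleyG φ gen H) e = i := by
          rcases hl (colour (cayleyG φ gen H) e) with hc | hc
          · exact hc
          · rw [hc] at he
            exact absurd he (hj' _)
        rw [hc] at he
        obtain ⟨k, hk⟩ := (hi' _).1 he
        obtain ⟨q, ⟨n, z⟩, t⟩ := e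
        obtain rfl : n = i := hc
        refine ⟨(factorVtx gen n ⊥ k, (z, t)), ?_⟩
        apply wellLabelled_cayleyG
        · rw [hk, ← hF k]
          exact F.map_ι _
        · rfl

/-- What step 5 achieves: with nothing left to remove there are no leaves, and the exceptional
single free factor has been excluded. -/
theorem lifts_subset_core (hφ : ∀ i, Function.Injective (φ i))
    (hgen : ∀ i, Subgroup.closure (Set.range (gen i)) = ⊤) [Finite Γ.V]
    (h : Represents φ gen H Γ f B) (hrem : ∀ i x, ¬ IsRemovable φ gen Γ i x)
    (hfree : ¬ IsFreeFactorGraph gen Γ) (i : Fin 2) :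
    lifts φ gen H B i ⊆ core (factor φ) (amalg φ) H i := by
  have := Fintype.ofFinite Γ.V
  refine h.subtree.subset_core (isAmalgam_pushout φ hφ) ?_ ?_ ?_ i
  · classical
    -- One representative in the amalgam for each vertex of the finite graph gives finiteness modulo
    -- `H`.
    choose rep hrep using fun x : Γ.V => vtx_surjective (f.onV x)
    refine ⟨Finset.univ.image rep, fun i g hg => ?_⟩
    obtain ⟨x, hx⟩ := (h.mem_rangeV _).2 (.inr ⟨i, hg⟩)
    rw [← hrep, eq_comm, vtx_eq_iff] at hx
    exact ⟨_, hx, Finset.mem_image.2 ⟨x, Finset.mem_univ _, by simp⟩⟩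
  · intro i j hij g hg
    obtain ⟨x, hx⟩ := (h.mem_rangeV _).2 (.inr ⟨i, hg.1⟩)
    exact hrem i x (h.isRemovable_of_isLeaf hφ hgen hij hx hg)
  · rintro i j hij ⟨h1, h2, h3⟩
    exact hfree (h.isFreeFactorGraph hφ hij h1 h2 h3)

end Represents

/-- `Γ` is isomorphic to the subgraph of `Cayley(G, H)` described by the core. -/
def RepresentsCore (φ : ∀ i, A →* G i) (gen : ∀ i, X i → G i) (H : Subgroup (PushoutI φ))
    (Γ : AGraph.{v, a, b} X) : Prop :=
  ∃ f B, Represents φ gen H Γ f B ∧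
    ∀ i, lifts φ gen H B i = core (factor φ) (amalg φ) H i

/-- `Γ` is isomorphic to a subgraph of the one described by the core. -/
def RepresentsInCore (φ : ∀ i, A →* G i) (gen : ∀ i, X i → G i) (H : Subgroup (PushoutI φ))
    (Γ : AGraph.{v, a, b} X) : Prop :=
  ∃ f B, Represents φ gen H Γ f B ∧
    ∀ i, lifts φ gen H B i ⊆ core (factor φ) (amalg φ) H i

theorem representsInCore_of_subsingleton (hH : H = ⊥) [Subsingleton Γ.V] [IsEmpty Γ.E] :
    RepresentsInCore φ gen H Γ := by
  let f : PGraph.Hom Γ (cayleyG φ gen H) :=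
    ⟨fun _ => vtx φ gen H 1, isEmptyElim, isEmptyElim, isEmptyElim, isEmptyElim, rfl⟩
  refine ⟨f, fun _ => ∅, ⟨Function.injective_of_subsingleton _, Function.injective_of_subsingleton _,
    fun x => ?_, fun e => ?_, fun h => h.elim, fun h => h.elim, fun h => h.elim, fun h => h.elim,
    fun h => ?_⟩, fun i g h => h.elim⟩
  · constructor
    · rintro ⟨y, rfl⟩
      exact .inl rfl
    · rintro (rfl | ⟨i, h⟩)
      · exact ⟨Γ.base, rfl⟩
      · exact h.elim
  · exact ⟨fun ⟨d, _⟩ => isEmptyElim d, fun h => h.elim⟩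
  · rw [hH, Subgroup.mem_bot] at h
    subst h
    exact .one

theorem Reach.exists_one_mem {Q : Type*} [Group Q] {F : Fin 2 → Subgroup Q} {U : Fin 2 → Set Q}
    {g x : Q} (h : Reach (mulAct F U) 1 g x) (hg : g ≠ 1) : ∃ i, 1 ∈ U i := by
  by_contra! hno
  apply hg
  clear hg
  induction h with
  | one => rfl
  | @step i g x k y h hk ih =>
    obtain rfl := h.eq_of_mulAct
    subst ih
    exact absurd hk.1 (hno i)

/-- Only a factor contained in the core because of `H ∩ A` could be missing. The basepoint would
then be monochromatic with a stabilizer meeting A nontrivially, which is the situation in which step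
6 glues. -/
theorem RepresentsInCore.representsCore (hφ : ∀ i, Function.Injective (φ i))
    (hgen : ∀ i, Subgroup.closure (Set.range (gen i)) = ⊤)
    (h : RepresentsInCore φ gen H Γ) (hglue : ∀ i K, ¬ NeedsGluing φ gen Γ i K) :
    RepresentsCore φ gen H Γ := by
  obtain ⟨f, B, h, hcore⟩ := h
  refine ⟨f, B, h, fun i => (hcore i).antisymm
    (h.subtree.core_subset (isAmalgam_pushout φ hφ) ?_)⟩
  rintro ⟨t, ht, ⟨α, rfl⟩, ht1⟩
  by_contra h1
  obtain ⟨l, hl⟩ := (h.subtree.reach_of_mem ht).exists_one_mem ht1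
  have hli : l ≠ i := by
    rintro rfl
    exact h1 hl
  have hbl : f.onV Γ.base ∈ B l := h.onV_base ▸ hl
  obtain ⟨e, he, -⟩ := h.hasEdge_iff.2 hbl
  refine hglue l (stab H l 1) ⟨?_, ⟨e, he⟩, h.isoOnto_comp hgen h.onV_base hbl, ?_⟩
  · rw [h.mem_vm_iff hli, h.onV_base]
    exact h1
  · intro hbot
    have : α ∈ (stab H l 1).comap (φ l) := by
      rw [Subgroup.mem_comap, mem_stab, PushoutI.of_apply_eq_base]
      simpa using ht
    rw [hbot, Subgroup.mem_bot] at this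
    exact ht1 (by rw [this, map_one])

/-- The glued graph represents the old subtree together with the `H`-translates of the missing
factor. The gluing relation identifies all overlaps with the old subtree, since that subtree meets
the missing factor only along A; and the new coset belongs to the core because `H ∩ A` is not
trivial. -/
theorem RepresentsInCore.glueAtBase (hφ : ∀ i, Function.Injective (φ i))
    (hgen : ∀ i, Subgroup.closure (Set.range (gen i)) = ⊤)
    (h : RepresentsInCore φ gen H Γ) {Δ : AGraph.{v, a, b} X} {i j : Fin 2} (hij : i ≠ j)
    {K : Subgroup (G i)} (hn : NeedsGluing φ gen Γ i K) (hglue : GlueAtBase φ gen Γ Δ i j K) :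
    RepresentsCore φ gen H Δ := by
  have hA := isAmalgam_pushout φ hφ
  obtain ⟨f, B, h, hcore⟩ := h
  obtain ⟨hVM, ⟨e₁, he₁⟩, hiso, hK1⟩ := hn
  unfold GlueAtBase at hglue
  obtain ⟨L, hL⟩ : ∃ L, L = (K.comap (φ i)).map (φ j) := ⟨_, rfl⟩
  rw [← hL] at hglue
  obtain ⟨q, hq⟩ := hglue
  have hiso' : PGraph.IsoOnto (cayleyFactor gen i K) (Γ.rebase Γ.base)
    (compV Γ i Γ.base) (compE Γ i Γ.base) := hiso
  obtain ⟨m, hm, -, hact⟩ := exists_vertex_map hφ hgen hiso'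
  have hK : ∀ k, k ∈ K ↔ PushoutI.of i k ∈ H := fun k => by
    simpa using h.mem_iff_of_vertex_map hm hact (g := 1) h.onV_base k
  have hl : ∀ l, l = i ∨ l = j := fun l => by omega
  have h1i : 1 ∈ lifts φ gen H B i := by
    have := h.hasEdge_iff.1 ⟨e₁, he₁, hVM e₁ he₁⟩
    rwa [h.onV_base] at this
  have h1j : 1 ∉ lifts φ gen H B j := by
    rw [h.mem_vm_iff hij, h.onV_base] at hVM
    exact hVM
  -- the subgraph meets the coset of the other factor only along `A`
  have hmeet : ∀ t ∈ factor φ j, Reach (mulAct (factor φ) (lifts φ gen H B)) 1 t t →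
      t ∈ amalg φ := by
    intro t ht hr
    by_contra htA
    have := h.subtree.mem_of_reach hA hr (.single ht htA)
    have := h.subtree.mulMem this (inv_mem ht)
    rw [mul_inv_cancel] at this
    exact h1j this
  -- An element of `H` in the factor `j` already lies in A, so `L` is the full stabilizer of the
  -- base vertex in that factor.
  have hLmem : ∀ k, k ∈ L ↔ PushoutI.of j k ∈ H := by
    intro k
    rw [hL]
    constructor
    · rintro ⟨α, hα, rfl⟩
      rw [PushoutI.of_apply_eq_base, ← PushoutI.of_apply_eq_base φ i, ← hK]
      exact hα
    · intro hk
      obtain ⟨α, hα⟩ := hmeet _ ⟨k, rfl⟩ (h.subtree.reach_of_mem hk)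
      refine ⟨α, ?_, ?_⟩
      · rw [SetLike.mem_coe, Subgroup.mem_comap, hK, PushoutI.of_apply_eq_base, hα]
        exact hk
      · apply PushoutI.of_injective hφ j
        rw [PushoutI.of_apply_eq_base, hα]
  let F : PGraph.Hom (cayleyFactor gen j L) ((cayleyG φ gen H).rebase (vtx φ gen H 1)) :=
    factorHom j L 1 fun k hk => by simpa using (hLmem k).1 hk
  have hF : ∀ k, F.onV (factorVtx gen j L k) = vtx φ gen H (PushoutI.of j k) := fun k => by
    rw [← one_mul (PushoutI.of j k)]
    exact factorHom_onV _ k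
  obtain ⟨f', hf'V, hf'E⟩ := hq.exists_lift (PGraph.sumHom f F) (by
      rintro _ _ ⟨α, p, z, hp, hpα, rfl, rfl⟩
      have h1 := hom_path f hp.1 h.onV_base
      rw [one_mul, hpα, ← PushoutI.of_apply_eq_base φ j] at h1
      exact h1.trans (hF _).symm) (fun _ _ h => h.elim)
  have hVl : ∀ x, f'.onV (q.onV (Sum.inl x)) = f.onV x := fun x => hf'V (Sum.inl x)
  have hVr : ∀ k, f'.onV (q.onV (Sum.inr (factorVtx gen j L k))) =
    vtx φ gen H (PushoutI.of j k) := fun k => (hf'V (Sum.inr _)).trans (hF k)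
  have hEl : ∀ x, f'.onE (q.onE (Sum.inl x)) = f.onE x := fun x => hf'E (Sum.inl x)
  have hEr : ∀ x, f'.onE (q.onE (Sum.inr x)) = F.onE x := fun x => hf'E (Sum.inr x)
  have hFinj : ∀ k k', vtx φ gen H (PushoutI.of j k) = vtx φ gen H (PushoutI.of j k') →
      factorVtx gen j L k = factorVtx gen j L k' := by
    intro k k' hkk
    rw [vtx_eq_iff, ← map_inv, ← map_mul, ← hLmem] at hkk
    exact factorVtx_eq_iff.2 hkk
  -- Wherever the old graph and the new coset meet in Cayley(G,H), the point is a translate of the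
  -- basepoint by A and was identified by the gluing.
  have hlr : ∀ x k, f.onV x = vtx φ gen H (PushoutI.of j k) →
      PushoutI.of j k ∈ amalg φ ∧ q.onV (Sum.inl x) = q.onV (Sum.inr (factorVtx gen j L k)) := by
    intro x k hxk
    have hr : Reach (mulAct (factor φ) (lifts φ gen H B)) 1 (PushoutI.of j k)
        (PushoutI.of j k) := by
      rcases (h.mem_rangeV _).1 ⟨x, hxk⟩ with hb | ⟨l, hb⟩
      · rw [eq_comm, vtx_eq_iff] at hb
        exact h.subtree.reach_of_mem (by simpa using hb)
      · exact h.subtree.reach hb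
    have hamalg := hmeet _ ⟨k, rfl⟩ hr
    refine ⟨hamalg, ?_⟩
    obtain ⟨α, hα⟩ := hamalg
    obtain ⟨p, hp, hp'⟩ := exists_word φ gen hgen i (φ i α)
    obtain ⟨p', y, hpy, rfl, hy⟩ := h.exists_path h.onV_base (h.onV_base ▸ h1i) hp
    rw [PushoutI.of_apply_eq_base] at hp'
    obtain rfl : y = x := by
      apply h.injV
      rw [hy, hxk, one_mul, hp', hα]
    have hk : k = φ j α := by
      apply PushoutI.of_injective hφ j
      rw [PushoutI.of_apply_eq_base, hα]
    subst hk
    exact (hq.2.2.1 _ _).2 (.rel _ _ ⟨α, p', y, hpy, hp', rfl, rfl⟩)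
  have hinjV : Function.Injective f'.onV := by
    intro y y' hyy
    obtain ⟨y, rfl⟩ := hq.1 y
    obtain ⟨y', rfl⟩ := hq.1 y'
    rcases y with y | y <;> rcases y' with y' | y'
    · rw [hVl, hVl] at hyy
      rw [h.injV hyy]
    · obtain ⟨k, rfl⟩ := factorVtx_surjective j L y'
      rw [hVl, hVr] at hyy
      exact (hlr y k hyy).2
    · obtain ⟨k, rfl⟩ := factorVtx_surjective j L y
      rw [hVl, hVr] at hyy
      exact (hlr y' k hyy.symm).2.symm
    · obtain ⟨k, rfl⟩ := factorVtx_surjective j L y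
      obtain ⟨k', rfl⟩ := factorVtx_surjective j L y'
      rw [hVr, hVr] at hyy
      rw [hFinj k k' hyy]
  have hFE : Function.Injective F.onE := by
    intro e e' hee
    apply wellLabelled_cayleyFactor
    · have h1 := congrArg (cayleyG φ gen H).ι hee
      have h2 : F.onV ((cayleyFactor gen j L).ι e) = F.onV ((cayleyFactor gen j L).ι e') :=
        (F.map_ι e).symm.trans (h1.trans (F.map_ι e'))
      obtain ⟨k, hk⟩ := factorVtx_surjective j L ((cayleyFactor gen j L).ι e)
      obtain ⟨k', hk'⟩ := factorVtx_surjective j L ((cayleyFactor gen j L).ι e')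
      rw [← hk, ← hk'] at h2 ⊢
      exact hFinj k k' ((hF k).symm.trans (h2.trans (hF k')))
    · rw [← F.map_lab, ← F.map_lab, hee]
  -- No edge occurs twice: an old edge of colour `j` starting in the new coset would give the
  -- basepoint that colour.
  have hEne : ∀ e e', f.onE e ≠ F.onE e' := by
    intro e e' hee
    have hc : colour Γ e = j := by
      rw [← colour_map f e, hee]
      exact (colour_map F e').trans (colour_cayleyFactor e')
    obtain ⟨k, hk⟩ := factorVtx_surjective j L ((cayleyFactor gen j L).ι e')
    have h1 : f.onV (Γ.ι e) = vtx φ gen H (PushoutI.of j k) := by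
      rw [← f.map_ι, hee, ← hF k, hk]
      exact F.map_ι e'
    have h2 := h.colour_mem e
    rw [hc, h1] at h2
    have := h.subtree.mulMem (g := PushoutI.of j k) h2 (inv_mem ⟨k, rfl⟩)
    rw [mul_inv_cancel] at this
    exact h1j this
  let B' : Fin 2 → Set (cayleyG φ gen H).V := fun l =>
    {y | y ∈ B l ∨ (l = j ∧ ∃ k, y = vtx φ gen H (PushoutI.of j k))}
  have hmono : ∀ g x, Reach (mulAct (factor φ) (lifts φ gen H B)) 1 g x →
      Reach (mulAct (factor φ) (lifts φ gen H B')) 1 g x := by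
    intro g x hg
    induction hg with
    | one => exact .one
    | step _ hk ih => exact .step ih ⟨.inl hk.1, hk.2⟩
  have hsub : IsSubtree (factor φ) H (lifts φ gen H B') := by
    refine ⟨?_, ?_, ?_, fun ht => hmono _ _ (h.subtree.reach_of_mem ht)⟩
    · rintro l g t (hg | ⟨rfl, k, hk⟩) ht
      · exact .inl (h.subtree.mulMem hg ht)
      · obtain ⟨k', rfl⟩ := ht
        refine .inr ⟨rfl, k * k', ?_⟩
        rw [vtx_eq_iff] at hk ⊢
        simpa [mul_assoc] using hk
    · rintro l g t hg ht
      rw [mem_lifts, vtx_mul_of_mem ht]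
      exact hg
    · rintro l g (hg | ⟨rfl, k, hk⟩)
      · exact hmono _ _ (h.subtree.reach hg)
      · rw [eq_comm, vtx_eq_iff] at hk
        have h2 := hmono _ _ (h.subtree.reach_of_mem hk)
        have h3 : g = g * (PushoutI.of l k)⁻¹ * PushoutI.of l k := by simp
        rw [h3]
        refine .step (i := l) h2 ⟨.inr ⟨rfl, 1, ?_⟩, ⟨k, rfl⟩, rfl⟩
        rw [map_one, ← mul_one (g * (PushoutI.of l k)⁻¹), vtx_mul_of_mem hk]
  obtain ⟨α, hα, hα1⟩ := (Subgroup.bot_or_exists_ne_one (K.comap (φ i))).resolve_left hK1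
  have hαH : PushoutI.base φ α ∈ H := by
    rw [← PushoutI.of_apply_eq_base φ i, ← hK]
    exact hα
  have hα1' : PushoutI.base φ α ≠ 1 := fun h1 =>
    hα1 (PushoutI.base_injective hφ (h1.trans (map_one _).symm))
  refine ⟨f', B', ⟨hinjV, ?_, ?_, ?_, ?_, hsub⟩, fun l => ?_⟩
  · intro e e' hee
    obtain ⟨e, rfl⟩ := hq.2.1 e
    obtain ⟨e', rfl⟩ := hq.2.1 e'
    rcases e with e | e <;> rcases e' with e' | e'
    · rw [hEl, hEl] at hee
      rw [h.injE hee]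
    · rw [hEl, hEr] at hee
      exact absurd hee (hEne _ _)
    · rw [hEl, hEr] at hee
      exact absurd hee.symm (hEne _ _)
    · rw [hEr, hEr] at hee
      rw [hFE hee]
  · intro y
    constructor
    · rintro ⟨z, rfl⟩
      obtain ⟨z, rfl⟩ := hq.1 z
      rcases z with z | z
      · rw [hVl]
        exact ((h.mem_rangeV _).1 ⟨z, rfl⟩).imp_right fun ⟨l, hl⟩ => ⟨l, .inl hl⟩
      · obtain ⟨k, rfl⟩ := factorVtx_surjective j L z
        rw [hVr]
        exact .inr ⟨j, .inr ⟨rfl, k, rfl⟩⟩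
    · rintro (rfl | ⟨l, hl | ⟨rfl, k, rfl⟩⟩)
      · exact ⟨_, f'.map_base⟩
      · obtain ⟨z, rfl⟩ := (h.mem_rangeV _).2 (.inr ⟨l, hl⟩)
        exact ⟨_, hVl z⟩
      · exact ⟨_, hVr k⟩
  · intro e
    constructor
    · rintro ⟨d, rfl⟩
      obtain ⟨d, rfl⟩ := hq.2.1 d
      rcases d with d | d
      · rw [hEl]
        exact .inl ((h.mem_rangeE _).1 ⟨d, rfl⟩)
      · rw [hEr]
        obtain ⟨k, hk⟩ := factorVtx_surjective j L ((cayleyFactor gen j L).ι d)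
        refine .inr ⟨(colour_map F d).trans (colour_cayleyFactor d), k, ?_⟩
        rw [← hF k, hk]
        exact F.map_ι d
    · rintro (he | ⟨hc, k, hk⟩)
      · obtain ⟨d, rfl⟩ := (h.mem_rangeE _).2 he
        exact ⟨_, hEl d⟩
      · obtain ⟨t, ⟨n, z⟩, τ⟩ := e
        obtain rfl : n = j := hc
        let d : (cayleyFactor gen n L).E := (factorVtx gen n L k, (z, τ))
        refine ⟨q.onE (Sum.inr d), ?_⟩
        rw [hEr]
        apply wellLabelled_cayleyG
        · rw [hk, ← hF k]
          exact F.map_ι d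
        · rfl
  · rintro l y (hy | ⟨rfl, k, rfl⟩)
    · exact h.nonempty hy
    -- Without generators the factor `j` is trivial, hence so is A, against the nontrivial
    -- intersection.
    · by_contra hX
      have hX' : IsEmpty (X l) := not_nonempty_iff.1 hX
      have htriv : ∀ k : G l, k = 1 := by
        intro k
        have := hgen l
        rw [Set.range_eq_empty, Subgroup.closure_empty] at this
        have hk : k ∈ (⊥ : Subgroup (G l)) := this ▸ Subgroup.mem_top k
        simpa using hk
      exact hα1 (hφ l ((htriv _).trans (map_one _).symm))
  · refine Set.Subset.antisymm ?_ (hsub.core_subset hA fun _ => ?_)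
    · rintro g (hg | ⟨rfl, k, hk⟩)
      · exact hcore l hg
      · rw [vtx_eq_iff] at hk
        exact ⟨_, hk, 1, by simp, .inr ⟨rfl, _, hαH, ⟨α, rfl⟩, hα1'⟩⟩
    · rcases hl l with rfl | rfl
      · exact .inl h1i
      · exact .inr ⟨rfl, 1, by rw [map_one]⟩

end LastSteps

end Stallings

/-! ### The core describes the normal core -/

namespace Stallings

open AGraph

section NormalCore

variable {X : Fin 2 → Type v} {G : Fin 2 → Type u} [∀ i, Group (G i)] {A : Type c} [Group A]
  {φ : ∀ i, A →* G i} {gen : ∀ i, X i → G i} {H : Subgroup (PushoutI φ)}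

/-- Locates the syllable that contains a given letter. -/
theorem exists_split_of_flatten_eq {α β : Type*} {S : List (α × List β)} {u v : List β} {l : β}
    (h : (S.map Prod.snd).flatten = u ++ l :: v) :
    ∃ S₁ i w₁ w₂ S₂, S = S₁ ++ (i, w₁ ++ l :: w₂) :: S₂ ∧ u = (S₁.map Prod.snd).flatten ++ w₁ := by
  induction S generalizing u with
  | nil => simp at h
  | cons s S ih =>
    rw [List.map_cons, List.flatten_cons, List.append_eq_append_iff] at h
    rcases h with ⟨u', rfl, h⟩ | ⟨c, h, h'⟩
    · obtain ⟨S₁, i, w₁, w₂, S₂, rfl, rfl⟩ := ih h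
      exact ⟨s :: S₁, i, w₁, w₂, S₂, rfl, by simp⟩
    · cases c with
      | nil =>
        obtain ⟨S₁, i, w₁, w₂, S₂, rfl, h3⟩ := ih (u := []) (by simpa using h'.symm)
        exact ⟨s :: S₁, i, w₁, w₂, S₂, rfl, by simp [← h3, h]⟩
      | cons m c =>
        simp only [List.cons_append, List.cons.injEq] at h'
        obtain ⟨rfl, -⟩ := h'
        exact ⟨[], s.1, u, c, S, by simp [← h], by simp⟩

variable (φ gen) in
/-- The elements represented by the syllables of a word. -/
def syllableVals (S : List (Fin 2 × List ((Σ i, X i) × Bool))) : List (Fin 2 × PushoutI φ) :=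
  S.map fun s => (s.1, val φ gen s.2)

theorem prod_syllableVals (S : List (Fin 2 × List ((Σ i, X i) × Bool))) :
    ((syllableVals φ gen S).map Prod.snd).prod = val φ gen (S.map Prod.snd).flatten := by
  induction S with
  | nil => rfl
  | cons s S ih =>
    rw [List.map_cons, List.flatten_cons, val_append, ← ih]
    simp [syllableVals]

theorem IsReducedList.left {Q : Type*} [Group Q] {F : Fin 2 → Subgroup Q} {A : Subgroup Q}
    {L M : List (Fin 2 × Q)} (h : IsReducedList F A (L ++ M)) : IsReducedList F A L :=
  ⟨fun s hs => h.1 s (List.mem_append_left _ hs), (List.isChain_append.1 h.2).1⟩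

theorem IsReducedList.right {Q : Type*} [Group Q] {F : Fin 2 → Subgroup Q} {A : Subgroup Q}
    {L M : List (Fin 2 × Q)} (h : IsReducedList F A (L ++ M)) : IsReducedList F A M :=
  ⟨fun s hs => h.1 s (List.mem_append_right _ hs), (List.isChain_append.1 h.2).2.1⟩

theorem IsReducedList.endsIn_inv {Q : Type*} [Group Q] {F : Fin 2 → Subgroup Q} {A : Subgroup Q}
    {L : List (Fin 2 × Q)} {s : Fin 2 × Q} (h : IsReducedList F A (s :: L)) :
    EndsIn F A s.1 (s.2 * (L.map Prod.snd).prod)⁻¹ := by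
  have h' := h.inv
  rw [List.map_cons, List.reverse_cons] at h'
  have := h'.endsIn
  rw [prod_map_inv_reverse] at this
  simpa using this

theorem IsReducedList.not_endsIn {Q : Type*} [Group Q] {F : Fin 2 → Subgroup Q} {A : Subgroup Q}
    (hA : IsAmalgam F A) {L M : List (Fin 2 × Q)} {s : Fin 2 × Q}
    (h : IsReducedList F A (L ++ s :: M)) : ¬ EndsIn F A s.1 (L.map Prod.snd).prod := by
  rcases L.eq_nil_or_concat with rfl | ⟨L, t, rfl⟩
  · exact hA.not_endsIn_of_mem (by simp [one_mem])
  · rw [List.concat_eq_append] at h ⊢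
    have h1 := h.left.endsIn
    have h2 := (List.isChain_append.1 h.2).2.2 t (by simp) s (by simp)
    simpa using hA.not_endsIn_of_ne h1 h2

/-- The syllables before the one containing the edge give the entry into its coset, and the rest of
the loop leaves it by a reduced expression. -/
theorem mem_core_of_isNormalLoop (hφ : ∀ i, Function.Injective (φ i))
    {p : List (cayleyG φ gen H).E} (hp : IsNormalLoop φ gen (cayleyG φ gen H) p)
    {e : (cayleyG φ gen H).E} (he : e ∈ p) {g : PushoutI φ}
    (hg : (cayleyG φ gen H).ι e = vtx φ gen H g) :
    g ∈ core (factor φ) (amalg φ) H (colour (cayleyG φ gen H) e) := by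
  have hA := isAmalgam_pushout φ hφ
  obtain ⟨hp, S, hS, hlet, hchain, hne, hnA⟩ := hp
  obtain ⟨p₁, p₂, rfl⟩ := List.append_of_mem he
  have hpH := isPath_cayleyG hp
  rw [base_cayleyG, one_mul, vtx_eq_iff, inv_one, mul_one] at hpH
  obtain ⟨y, hp₁, hp₂⟩ := PGraph.isPath_append.1 hp
  have hy := isPath_cayleyG hp₁
  rw [← hp₂.1, hg, one_mul, vtx_eq_iff] at hy
  rw [hS] at hpH
  rw [PGraph.pathLab_append] at hS
  obtain ⟨S₁, i, w₁, w₂, S₂, rfl, hS₁⟩ := exists_split_of_flatten_eq hS.symm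
  have hi : ∀ l ∈ w₁ ++ (cayleyG φ gen H).lab e :: w₂, l.1.1 = i := (hlet (i, _) (by simp)).2
  obtain rfl : colour (cayleyG φ gen H) e = i := hi _ (by simp)
  have hw₁ : val φ gen w₁ ∈ factor φ (colour (cayleyG φ gen H) e) :=
    val_mem_factor fun l hl => hi l (by simp [hl])
  rw [hS₁, val_append] at hy
  rw [List.map_append, List.flatten_append, val_append, List.map_cons, List.flatten_cons,
    val_append] at hpH
  -- A loop that is a single syllable in A is normal but not reduced; it accounts for the second
  -- clause of the core.
  by_cases hcase : S₁ = [] ∧ S₂ = [] ∧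
    val φ gen (w₁ ++ (cayleyG φ gen H).lab e :: w₂) ∈ amalg φ
  · obtain ⟨rfl, rfl, hcA⟩ := hcase
    refine ⟨_, hy, 1, by simpa using hw₁, .inr ⟨rfl, _, ?_, hcA,
      hne (colour (cayleyG φ gen H) e, _) (by simp)⟩⟩
    simpa using hpH
  · have hred : IsReducedList (factor φ) (amalg φ) (syllableVals φ gen
        (S₁ ++ (colour (cayleyG φ gen H) e, w₁ ++ (cayleyG φ gen H).lab e :: w₂) :: S₂)) := by
      refine ⟨?_, ?_⟩
      · intro s₀ hs₀
        obtain ⟨s, hs, rfl⟩ := List.mem_map.1 hs₀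
        refine ⟨val_mem_factor (hlet s hs).2, ?_⟩
        by_cases hlen : (S₁ ++ (colour (cayleyG φ gen H) e,
          w₁ ++ (cayleyG φ gen H).lab e :: w₂) :: S₂).length = 1
        · simp only [List.length_append, List.length_cons] at hlen
          obtain rfl : S₁ = [] := List.length_eq_zero_iff.1 (by omega)
          obtain rfl : S₂ = [] := List.length_eq_zero_iff.1 (by omega)
          simp only [List.nil_append, List.mem_singleton] at hs
          subst hs
          exact fun h => hcase ⟨rfl, rfl, h⟩
        · exact hnA hlen s hs
      · rw [syllableVals, List.isChain_map]
        exact hchain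
    rw [syllableVals, List.map_append, List.map_cons] at hred
    have h1 := hred.not_endsIn hA
    have h2 := hred.right.endsIn_inv
    rw [← syllableVals, prod_syllableVals] at h1 h2
    exact ⟨_, hy, val φ gen (S₁.map Prod.snd).flatten, by simpa [mul_assoc] using hw₁,
      .inl ⟨_, hpH, h1, h2⟩⟩

theorem exists_syllables (hgen : ∀ i, Subgroup.closure (Set.range (gen i)) = ⊤)
    {L : List (Fin 2 × PushoutI φ)} (hL : ∀ s ∈ L, s.2 ∈ factor φ s.1 ∧ s.2 ∉ amalg φ) :
    ∃ S, syllableVals φ gen S = L ∧ ∀ s ∈ S, s.2 ≠ [] ∧ ∀ l ∈ s.2, l.1.1 = s.1 := by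
  induction L with
  | nil => exact ⟨[], rfl, by simp⟩
  | cons s L ih =>
    obtain ⟨S, rfl, hS⟩ := ih fun t ht => hL t (List.mem_cons_of_mem _ ht)
    obtain ⟨hs, hsA⟩ := hL s (by simp)
    obtain ⟨p, hp, hps⟩ := exists_word_of_mem φ gen hgen hs
    refine ⟨(s.1, p) :: S, by simp [syllableVals, hps], ?_⟩
    intro t ht
    rcases List.mem_cons.1 ht with rfl | ht
    · refine ⟨?_, hp⟩
      rintro rfl
      exact hsA (by rw [← hps, val_nil]; exact one_mem _)
    · exact hS t ht

theorem isNormalWord_of_isReducedList {S : List (Fin 2 × List ((Σ i, X i) × Bool))}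
    (hS : IsReducedList (factor φ) (amalg φ) (syllableVals φ gen S))
    (hlet : ∀ s ∈ S, s.2 ≠ [] ∧ ∀ l ∈ s.2, l.1.1 = s.1) :
    IsNormalWord φ gen (S.map Prod.snd).flatten := by
  have hnA : ∀ s ∈ S, val φ gen s.2 ∉ amalg φ := fun s hs =>
    (hS.1 (s.1, val φ gen s.2) (List.mem_map.2 ⟨s, hs, rfl⟩)).2
  refine ⟨S, rfl, hlet, ?_, fun s hs h => hnA s hs (h ▸ one_mem _), fun _ => hnA⟩
  have := hS.2
  rwa [syllableVals, List.isChain_map] at this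

theorem exists_isNormalLoop_of_word {p₁ p₂ : List ((Σ i, X i) × Bool)} {e : (cayleyG φ gen H).E}
    {g h : PushoutI φ} (hg : (cayleyG φ gen H).ι e = vtx φ gen H g) (hh : h ∈ H)
    (hp₁ : val φ gen p₁ = h * g)
    (hH : val φ gen (p₁ ++ (cayleyG φ gen H).lab e :: p₂) ∈ H)
    (hn : IsNormalWord φ gen (p₁ ++ (cayleyG φ gen H).lab e :: p₂)) :
    ∃ p, IsNormalLoop φ gen (cayleyG φ gen H) p ∧ e ∈ p := by
  obtain ⟨q, hq, hq'⟩ := exists_path_cayleyG (gen := gen) (H := H) 1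
    (p₁ ++ (cayleyG φ gen H).lab e :: p₂)
  have hend : vtx φ gen H (1 * val φ gen (p₁ ++ (cayleyG φ gen H).lab e :: p₂)) =
      vtx φ gen H 1 := by
    rw [one_mul, ← mul_one (val φ gen _), vtx_mul_of_mem hH]
  rw [hend] at hq
  refine ⟨q, ⟨hq, hq' ▸ hn⟩, ?_⟩
  obtain ⟨q₁, q₂, rfl, h1, h2⟩ := List.map_eq_append_iff.1 hq'
  obtain ⟨d, q₃, rfl, h3, -⟩ := List.map_eq_cons_iff.1 h2
  obtain ⟨y, hy, hy'⟩ := PGraph.isPath_append.1 hq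
  have hd := isPath_cayleyG hy
  rw [PGraph.pathLab, h1, one_mul, hp₁, vtx_mul_of_mem hh, ← hg, ← hy'.1] at hd
  rw [wellLabelled_cayleyG _ _ hd.symm h3.symm]
  simp

/-- Normal form restricts the values of syllables, not their spelling. A syllable in the right coset
can be respelled so as to pass through any given edge of that coset. -/
theorem exists_isNormalLoop (hφ : ∀ i, Function.Injective (φ i))
    (hgen : ∀ i, Subgroup.closure (Set.range (gen i)) = ⊤)
    {e : (cayleyG φ gen H).E} {g : PushoutI φ} (hg : (cayleyG φ gen H).ι e = vtx φ gen H g)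
    (hcore : g ∈ core (factor φ) (amalg φ) H (colour (cayleyG φ gen H) e)) :
    ∃ p, IsNormalLoop φ gen (cayleyG φ gen H) p ∧ e ∈ p := by
  have hA := isAmalgam_pushout φ hφ
  obtain ⟨i, hi⟩ : ∃ i, colour (cayleyG φ gen H) e = i := ⟨_, rfl⟩
  rw [hi] at hcore
  obtain ⟨h, hh, g', hk, hcore⟩ := hcore
  -- words for the elements of the factor that pass through the given edge
  have key : ∀ k ∈ factor φ i, ∀ t ∈ factor φ i, ∃ p₁ p₂ : List ((Σ i, X i) × Bool),
      (∀ l ∈ p₁ ++ (cayleyG φ gen H).lab e :: p₂, l.1.1 = i) ∧ val φ gen p₁ = k ∧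
        val φ gen (p₁ ++ (cayleyG φ gen H).lab e :: p₂) = t := by
    intro k hk t ht
    obtain ⟨p₁, hp₁, rfl⟩ := exists_word_of_mem φ gen hgen hk
    obtain ⟨q, hq, rfl⟩ := exists_word_of_mem φ gen hgen ht
    have h1 : ∀ l ∈ p₁ ++ [(cayleyG φ gen H).lab e], l.1.1 = i :=
      mono_append hp₁ fun l hl => by rw [List.mem_singleton.1 hl]; exact hi
    -- After the edge has been crossed the word runs all the way back and only then spells the
    -- required element.
    refine ⟨p₁, invWord (p₁ ++ [(cayleyG φ gen H).lab e]) ++ q, ?_, rfl, ?_⟩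
    · have := mono_append h1 (mono_append (mono_invWord h1) hq)
      simpa using this
    · have : p₁ ++ (cayleyG φ gen H).lab e :: (invWord (p₁ ++ [(cayleyG φ gen H).lab e]) ++ q) =
        (p₁ ++ [(cayleyG φ gen H).lab e]) ++ (invWord (p₁ ++ [(cayleyG φ gen H).lab e]) ++ q) := by
        simp
      rw [this, val_append, val_append (invWord _), val_invWord, mul_inv_cancel_left]
  rcases hcore with ⟨t, ht, hg', hti⟩ | ⟨rfl, t, ht, htA, ht1⟩
  -- An entry lying in A is moved into the other part, so that the entry becomes an honest, possibly
  -- empty, list of syllables.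
  · obtain ⟨g', t, L, hk, ht, hti, hL, rfl, hLi⟩ : ∃ g' t L, g'⁻¹ * (h * g) ∈ factor φ i ∧
        g' * t ∈ H ∧ EndsIn (factor φ) (amalg φ) i t⁻¹ ∧ IsReducedList (factor φ) (amalg φ) L ∧
        (L.map Prod.snd).prod = g' ∧ ∀ s ∈ L.getLast?, s.1 ≠ i := by
      rcases hA.total g' with hgA | ⟨j, hj⟩
      · refine ⟨1, g' * t, [], ?_, by simpa using ht, ?_, ⟨by simp, by simp⟩, rfl, by simp⟩
        · have := mul_mem (hA.le i hgA) hk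
          simpa using this
        · rw [mul_inv_rev]
          exact hti.mul_right (hA.le i) (inv_mem hgA)
      · obtain ⟨L, s, hL, hs⟩ := hj.exists_list
        refine ⟨g', t, L ++ [(j, s)], hk, ht, hti, hL, by simpa using hs, ?_⟩
        simp only [List.getLast?_append, List.getLast?_singleton, Option.some_or,
          Option.mem_some_iff]
        rintro _ rfl
        rintro rfl
        exact hg' hj
    -- A reduced expression of the inverse, reversed, is one of `t` whose first syllable lies in `F
    -- i`.
    obtain ⟨M, s, hM, hs⟩ := hti.exists_list
    have hM' := hM.inv
    have hprod := prod_map_inv_reverse (M ++ [(i, s)])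
    have hs' : ((M ++ [(i, s)]).map Prod.snd).prod = t⁻¹ := by simpa using hs
    rw [hs', inv_inv] at hprod
    rw [List.map_append, List.reverse_append] at hM' hprod
    obtain ⟨N, hN⟩ : ∃ N, N = (M.map fun s => (s.1, s.2⁻¹)).reverse := ⟨_, rfl⟩
    simp only [List.map_cons, List.map_nil, List.reverse_singleton, List.singleton_append,
      ← hN, List.prod_cons] at hM' hprod
    have hred : IsReducedList (factor φ) (amalg φ) (L ++ (i, s⁻¹) :: N) := by
      refine ⟨fun x hx => (List.mem_append.1 hx).elim (hL.1 x) (hM'.1 x), ?_⟩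
      rw [List.isChain_append]
      refine ⟨hL.2, hM'.2, fun x hx y hy => ?_⟩
      simp only [List.head?_cons, Option.mem_some_iff] at hy
      subst hy
      exact hLi x hx
    obtain ⟨S₁, hS₁, hl₁⟩ := exists_syllables (gen := gen) hgen hL.1
    obtain ⟨S₂, hS₂, hl₂⟩ := exists_syllables (gen := gen) hgen
      (L := N) fun x hx => hM'.1 x (List.mem_cons_of_mem _ hx)
    obtain ⟨p₁, p₂, hp, hp₁, hp₂⟩ := key _ hk s⁻¹ (hM'.1 (i, s⁻¹) (by simp)).1
    have hvals : syllableVals φ gen (S₁ ++ (i, p₁ ++ (cayleyG φ gen H).lab e :: p₂) :: S₂) =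
        L ++ (i, s⁻¹) :: N := by
      rw [← hS₁, ← hS₂]
      simp [syllableVals, hp₂]
    have hword := isNormalWord_of_isReducedList (gen := gen)
      (S := S₁ ++ (i, p₁ ++ (cayleyG φ gen H).lab e :: p₂) :: S₂) (hvals ▸ hred) (by
        intro x hx
        rcases List.mem_append.1 hx with hx | hx
        · exact hl₁ x hx
        · rcases List.mem_cons.1 hx with rfl | hx
          · exact ⟨by simp, hp⟩
          · exact hl₂ x hx)
    have hval := prod_syllableVals (φ := φ) (gen := gen)
      (S₁ ++ (i, p₁ ++ (cayleyG φ gen H).lab e :: p₂) :: S₂)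
    rw [hvals, List.map_append, List.prod_append, List.map_cons, List.prod_cons, hprod] at hval
    have hflat : ((S₁ ++ (i, p₁ ++ (cayleyG φ gen H).lab e :: p₂) :: S₂).map Prod.snd).flatten =
        ((S₁.map Prod.snd).flatten ++ p₁) ++ (cayleyG φ gen H).lab e ::
          (p₂ ++ (S₂.map Prod.snd).flatten) := by simp
    rw [hflat] at hword hval
    refine exists_isNormalLoop_of_word hg hh ?_ (hval ▸ ht) hword
    rw [val_append, ← prod_syllableVals, hS₁, hp₁, mul_inv_cancel_left]
  · obtain ⟨p₁, p₂, hp, hp₁, hp₂⟩ := key _ hk t (hA.le i htA)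
    refine exists_isNormalLoop_of_word (p₂ := p₂) hg hh (by simpa using hp₁) (hp₂ ▸ ht)
      ⟨[(i, p₁ ++ (cayleyG φ gen H).lab e :: p₂)], by simp, ?_, by simp, ?_, by simp⟩
    · simp only [List.mem_singleton]
      rintro _ rfl
      exact ⟨by simp, hp⟩
    · simp only [List.mem_singleton]
      rintro _ rfl
      exact hp₂ ▸ ht1

/-- Both graphs embed in Cayley(G,H) with the same edges, and their vertices are the basepoint and
the ends of these edges. -/
theorem RepresentsCore.iso {Γ : AGraph.{v, a, b} X} (hφ : ∀ i, Function.Injective (φ i))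
    (hgen : ∀ i, Subgroup.closure (Set.range (gen i)) = ⊤) (h : RepresentsCore φ gen H Γ) :
    Γ.Iso (normalCore φ gen H) := by
  obtain ⟨f, B, h, hcore⟩ := h
  have hloop : ∀ e, e ∈ Set.range f.onE ↔
      ∃ p, IsNormalLoop φ gen (cayleyG φ gen H) p ∧ e ∈ p := by
    intro e
    obtain ⟨g, hg⟩ := vtx_surjective ((cayleyG φ gen H).ι e)
    rw [h.mem_rangeE, ← hg, ← mem_lifts, hcore]
    exact ⟨exists_isNormalLoop hφ hgen hg.symm,
      fun ⟨p, hp, he⟩ => mem_core_of_isNormalLoop hφ hp he hg.symm⟩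
  have hinv : ∀ e, (cayleyG φ gen H).inv e ∈ Set.range f.onE → e ∈ Set.range f.onE := by
    rintro e ⟨d, hd⟩
    exact ⟨Γ.inv d, by rw [← f.map_inv, hd, PGraph.inv_inv]⟩
  let F : PGraph.Hom (normalCore φ gen H) (cayleyG φ gen H) :=
    ⟨Subtype.val, Subtype.val, fun _ => rfl, fun _ => rfl, fun _ => rfl, rfl⟩
  refine PGraph.IsoOnto.iso (Θ := cayleyG φ gen H) ⟨f, h.injV, h.injE, rfl, rfl⟩
    ⟨F, Subtype.val_injective, Subtype.val_injective, ?_, ?_⟩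
  · refine Subtype.range_val.trans ?_
    ext x
    constructor
    · rintro ⟨p, hp, rfl | ⟨e, he, hx⟩⟩
      · exact ⟨_, f.map_base⟩
      · obtain ⟨d, rfl⟩ := (hloop e).2 ⟨p, hp, he⟩
        rcases hx with rfl | rfl
        · exact ⟨_, (f.map_ι d).symm⟩
        · exact ⟨_, (f.map_τ d).symm⟩
    · intro hx
      rcases (h.mem_rangeV x).1 hx with rfl | ⟨i, hx⟩
      · exact (normalCore φ gen H).base.2
      · obtain ⟨z⟩ := h.nonempty hx
        obtain ⟨p, hp, he⟩ := (hloop (edgeAt x (⟨i, z⟩, true))).1 ((h.mem_rangeE _).2 hx)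
        exact ⟨p, hp, .inr ⟨_, he, .inl rfl⟩⟩
  · refine Subtype.range_val.trans ?_
    ext e
    constructor
    · rintro ⟨p, hp, he | he⟩
      · exact (hloop e).2 ⟨p, hp, he⟩
      · exact hinv e ((hloop _).2 ⟨p, hp, he⟩)
    · intro he
      obtain ⟨p, hp, he⟩ := (hloop e).1 he
      exact ⟨p, hp, .inl he⟩

end NormalCore

end Stallings

/-! ### Termination, progress and the invariant of the algorithm -/

namespace Stallings

open AGraph

section Finiteness

variable {α β : Type*} [Finite α]

theorem card_lt_of_surjective_of_ne {f : α → β} (hf : Function.Surjective f) {x y : α}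
    (hxy : x ≠ y) (h : f x = f y) : Nat.card β < Nat.card α := by
  refine lt_of_le_of_ne (Nat.card_le_card_of_surjective f hf) fun hc => hxy ?_
  exact (hf.bijective_of_nat_card_le hc.ge).1 h

theorem card_lt_of_injective_of_notMem_range [Finite β] {f : β → α} (hf : Function.Injective f)
    {x : α} (hx : x ∉ Set.range f) : Nat.card β < Nat.card α := by
  refine lt_of_le_of_ne (Nat.card_le_card_of_injective f hf) fun hc => hx ?_
  exact (hf.bijective_of_nat_card_le hc.ge).2 x

theorem exists_representatives (s : Setoid α) :
    ∃ l : List α, l.Pairwise (fun x y => ¬ s x y) ∧ ∀ x, ∃ y ∈ l, s x y := by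
  have := Fintype.ofFinite (Quotient s)
  refine ⟨(Finset.univ : Finset (Quotient s)).toList.map Quotient.out, ?_, fun x => ?_⟩
  · rw [List.pairwise_map]
    refine (Finset.nodup_toList _).imp fun {q q'} hq h => hq ?_
    exact (Quotient.out_equiv_out).1 h
  · exact ⟨Quotient.out (Quotient.mk s x), List.mem_map.2 ⟨_, by simp, rfl⟩,
      s.symm (Quotient.mk_out x)⟩

end Finiteness

section Algorithm

variable {X : Fin 2 → Type v} {G : Fin 2 → Type u} [∀ i, Group (G i)] {A : Type c} [Group A]
  {φ : ∀ i, A →* G i} {gen : ∀ i, X i → G i} {H : Subgroup (PushoutI φ)}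

theorem exists_picksEdges (Γ : AGraph.{v, a, b} X) [Finite Γ.E] : ∃ l, PicksEdges Γ l := by
  refine exists_representatives ⟨SameComp Γ, sameComp_refl, ?_, ?_⟩
  · rintro e e' ⟨h, p, hp⟩
    exact ⟨h.symm, _, h ▸ hp.reverse⟩
  · rintro e e' e'' ⟨h, p, hp⟩ ⟨h', p', hp'⟩
    rw [h] at h' hp'
    exact ⟨h', _, hp.append hp'⟩

/-- The graph of a configuration. -/
def Config.graph : Config.{v, w} X → AGraph.{v, w, w} X
  | .step2 Γ => Γ
  | .step3 Γ _ => Γ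
  | .step4 Γ _ => Γ
  | .step5 Γ => Γ
  | .step6 Γ => Γ
  | .done Γ => Γ

/-- The graph of the configuration is finite. -/
def Config.IsFinite (c : Config.{v, w} X) : Prop := Finite c.graph.V ∧ Finite c.graph.E

/-- The invariant of the algorithm. -/
def Config.Invariant (φ : ∀ i, A →* G i) (gen : ∀ i, X i → G i) (H : Subgroup (PushoutI φ)) :
    Config.{v, w} X → Prop
  | .step2 Γ => Realizes φ gen H Γ
  | .step3 Γ l => Realizes φ gen H Γ ∧ Seeded φ gen Γ l
  | .step4 Γ S => IsPrecover φ gen H Γ S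
  | .step5 Γ => ∃ f B, Represents φ gen H Γ f B
  | .step6 Γ => RepresentsInCore φ gen H Γ
  | .done Γ => RepresentsCore φ gen H Γ

/-- The number of steps still to come, the number of Cayley graphs still to be glued in the present
step, and the size of the graph. -/
noncomputable def Config.measure : Config.{v, w} X → ℕ ×ₗ ℕ ×ₗ ℕ
  | .step2 Γ => toLex (5, toLex (0, Nat.card Γ.V + Nat.card Γ.E))
  | .step3 Γ l => toLex (4, toLex (l.length, Nat.card Γ.V + Nat.card Γ.E))
  | .step4 Γ _ => toLex (3, toLex (0, Nat.card Γ.V + Nat.card Γ.E))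
  | .step5 Γ => toLex (2, toLex (0, Nat.card Γ.V + Nat.card Γ.E))
  | .step6 _ => toLex (1, toLex (0, 0))
  | .done _ => toLex (0, toLex (0, 0))

instance finite_v_cayleyFactor [∀ i, Finite (G i)] (i : Fin 2) (K : Subgroup (G i)) :
    Finite (cayleyFactor gen i K).V :=
  inferInstanceAs (Finite (Quotient (QuotientGroup.rightRel K)))

instance finite_e_cayleyFactor [∀ i, Finite (G i)] [∀ i, Finite (X i)] (i : Fin 2)
    (K : Subgroup (G i)) : Finite (cayleyFactor gen i K).E :=
  inferInstanceAs (Finite (Quotient (QuotientGroup.rightRel K) × (X i × Bool)))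

instance finite_v_sum {X : Type v} (Γ : PGraph.{v, a, b} X) (Δ : PGraph.{v, c, d} X) [Finite Γ.V]
    [Finite Δ.V] : Finite (Γ.sum Δ).V :=
  inferInstanceAs (Finite (Γ.V ⊕ Δ.V))

instance finite_e_sum {X : Type v} (Γ : PGraph.{v, a, b} X) (Δ : PGraph.{v, c, d} X) [Finite Γ.E]
    [Finite Δ.E] : Finite (Γ.sum Δ).E :=
  inferInstanceAs (Finite (Γ.E ⊕ Δ.E))

instance finite_v_segments {X : Type v} (W : List (List (X × Bool))) : Finite (segments W).V :=
  inferInstanceAs (Finite (Unit ⊕ (Σ k : Fin W.length, Fin ((W.get k).length + 1))))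

instance finite_e_segments {X : Type v} (W : List (List (X × Bool))) : Finite (segments W).E :=
  inferInstanceAs (Finite ((Σ k : Fin W.length, Fin (W.get k).length) × Bool))

theorem PGraph.Hom.IsQuotient.finite {X : Type v} {Γ : PGraph.{v, a, b} X} {Δ : PGraph.{v, r, s} X}
    {f : Hom Γ Δ} {r s} (hf : f.IsQuotient r s) [Finite Γ.V] [Finite Γ.E] :
    Finite Δ.V ∧ Finite Δ.E :=
  ⟨.of_surjective _ hf.1, .of_surjective _ hf.2.1⟩

theorem PGraph.IsoOnto.finite {X : Type v} {Γ : PGraph.{v, a, b} X} {Δ : PGraph.{v, r, s} X}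
    {S T} (h : Δ.IsoOnto Γ S T) [Finite Γ.V] [Finite Γ.E] : Finite Δ.V ∧ Finite Δ.E := by
  obtain ⟨f, hV, hE, -⟩ := h
  exact ⟨.of_injective _ hV, .of_injective _ hE⟩

theorem PGraph.Hom.IsFold.size_lt {X : Type v} {Γ : PGraph.{v, a, b} X} {Δ : PGraph.{v, r, s} X}
    {f : Hom Γ Δ} (hf : f.IsFold) [Finite Γ.V] [Finite Γ.E] :
    Nat.card Δ.V + Nat.card Δ.E < Nat.card Γ.V + Nat.card Γ.E := by
  obtain ⟨e₁, e₂, hne, -, -, hq⟩ := hf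
  exact add_lt_add_of_le_of_lt (Nat.card_le_card_of_surjective _ hq.1)
    (card_lt_of_surjective_of_ne hq.2.1 hne ((hq.2.2.2 _ _).2 (.rel _ _ (.inl ⟨rfl, rfl⟩))))

theorem PGraph.IsoOnto.size_lt {X : Type v} {Γ : PGraph.{v, a, b} X} {Δ : PGraph.{v, r, s} X}
    {S T} (h : Δ.IsoOnto Γ S T) [Finite Γ.V] [Finite Γ.E] {e : Γ.E} (he : e ∉ T) :
    Nat.card Δ.V + Nat.card Δ.E < Nat.card Γ.V + Nat.card Γ.E := by
  obtain ⟨_, _⟩ := h.finite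
  obtain ⟨f, hV, hE, -, rfl⟩ := h
  exact add_lt_add_of_le_of_lt (Nat.card_le_card_of_injective _ hV)
    (card_lt_of_injective_of_notMem_range hE he)

theorem Trans.isFinite [∀ i, Finite (G i)] [∀ i, Finite (X i)] {c₁ c₂ : Config.{v, w} X}
    (h : Trans φ gen c₁ c₂) (hc : c₁.IsFinite) : c₂.IsFinite := by
  obtain ⟨hV, hE⟩ := hc
  cases h with
  | fold₂ f hf | fold₃ l f hf | fold₄ S f hf =>
    simp only [Config.graph] at hV hE
    obtain ⟨_, _, -, -, -, hq⟩ := hf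
    exact hq.finite
  | cut₂ h =>
    simp only [Config.graph] at hV hE
    obtain ⟨_, -, h⟩ := h
    exact h.finite
  | end₂ | end₃ | end₄ | end₅ | end₆ => exact ⟨hV, hE⟩
  | glue₃ e l i f hf =>
    simp only [Config.graph] at hV hE
    obtain ⟨_, -, -, hq⟩ := hf
    exact hq.finite
  | identify₄ S x y₀ y₁ hx h f hf =>
    simp only [Config.graph] at hV hE
    exact hf.finite
  | remove₅ h =>
    simp only [Config.graph] at hV hE
    obtain ⟨_, _, -, h⟩ := h
    exact h.finite
  | collapse₅ h h' hV' hE' =>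
    exact ⟨@Finite.of_subsingleton _ hV', @Finite.of_subsingleton _ (@IsEmpty.instSubsingleton _ hE')⟩
  | glue₆ i j hij K h h' =>
    simp only [Config.graph] at hV hE
    obtain ⟨_, hq⟩ := h'
    exact hq.finite

/-- Gluing in step 3 enlarges the graph but shortens the list of edges to be treated; the other
operations that stay within a step lose an edge or a vertex. -/
theorem Trans.measure_lt {c₁ c₂ : Config.{v, w} X} (h : Trans φ gen c₁ c₂) (hc : c₁.IsFinite) :
    c₂.measure < c₁.measure := by
  obtain ⟨hV, hE⟩ := hc
  cases h with
  | fold₂ f hf | fold₃ l f hf | fold₄ S f hf =>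
    simp only [Config.graph] at hV hE
    simpa [Config.measure, Prod.Lex.toLex_lt_toLex] using hf.size_lt
  | cut₂ h =>
    simp only [Config.graph] at hV hE
    obtain ⟨e, -, h⟩ := h
    simpa [Config.measure, Prod.Lex.toLex_lt_toLex] using h.size_lt (e := e) fun he => he.1 rfl
  | end₂ | end₃ | end₄ | end₅ | end₆ | glue₃ | collapse₅ | glue₆ =>
    simp [Config.measure, Prod.Lex.toLex_lt_toLex]
  | identify₄ S x y₀ y₁ hx h f hf =>
    simp only [Config.graph] at hV hE
    have := add_lt_add_of_lt_of_le
      (card_lt_of_surjective_of_ne hf.1 h.1 ((hf.2.2.1 _ _).2 (.rel _ _ ⟨rfl, rfl⟩)))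
      (Nat.card_le_card_of_surjective _ hf.2.1)
    simpa [Config.measure, Prod.Lex.toLex_lt_toLex] using this
  | remove₅ h =>
    simp only [Config.graph] at hV hE
    obtain ⟨i, x, hx, h⟩ := h
    -- The bichromatic vertex of the component starts an edge of colour `i`, which disappears.
    obtain ⟨e, he, he'⟩ := hx.1 i
    have := h.size_lt (e := e) fun hmem => hmem ⟨he', [], he ▸ .nil _ _⟩
    simpa [Config.measure, Prod.Lex.toLex_lt_toLex] using this

theorem Config.IsFinite.acc [∀ i, Finite (G i)] [∀ i, Finite (X i)] {c : Config.{v, w} X}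
    (hc : c.IsFinite) : Acc (fun c₂ c₁ => Trans φ gen c₁ c₂) c := by
  induction hm : c.measure using WellFoundedLT.induction generalizing c with
  | ind m ih =>
    subst hm
    exact ⟨_, fun c' h => ih _ (h.measure_lt hc) (h.isFinite hc) rfl⟩

theorem exists_fold {X : Type v} {Γ : PGraph.{v, a, b} X} [Finite Γ.V] [Finite Γ.E]
    (h : ¬ Γ.WellLabelled) : ∃ (Δ : PGraph.{v, w, w} X) (f : PGraph.Hom Γ Δ), f.IsFold := by
  simp only [PGraph.WellLabelled, not_forall] at h
  obtain ⟨e₁, e₂, hι, hlab, hne⟩ := h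
  obtain ⟨Δ, f, hf⟩ := PGraph.exists_isQuotient.{v, w} Γ (fun x y => x = Γ.τ e₁ ∧ y = Γ.τ e₂)
    (fun e e' => (e = e₁ ∧ e' = e₂) ∨ (e = Γ.inv e₁ ∧ e' = Γ.inv e₂))
    (by
      rintro _ _ (⟨rfl, rfl⟩ | ⟨rfl, rfl⟩)
      · rw [hι]
        exact .refl _
      · exact .rel _ _ ⟨rfl, rfl⟩)
    (by
      rintro _ _ (⟨rfl, rfl⟩ | ⟨rfl, rfl⟩)
      · exact .rel _ _ (.inr ⟨rfl, rfl⟩)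
      · rw [Γ.inv_inv, Γ.inv_inv]
        exact .rel _ _ (.inl ⟨rfl, rfl⟩))
    (by
      rintro _ _ (⟨rfl, rfl⟩ | ⟨rfl, rfl⟩)
      · exact hlab
      · rw [Γ.lab_inv, Γ.lab_inv, hlab])
  exact ⟨Δ, f, e₁, e₂, hne, hι, hlab, hf⟩

theorem exists_cutHair {X : Type v} {Γ : PGraph.{v, a, b} X} {e : Γ.E} (he : Γ.IsHair e) :
    ∃ Δ : PGraph.{v, a, b} X, Γ.CutHair Δ := by
  obtain ⟨Δ, hΔ⟩ := PGraph.exists_isoOnto Γ {x | x ≠ Γ.τ e} {e' | e' ≠ e ∧ e' ≠ Γ.inv e}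
    he.1.symm (fun e' he' h => he'.2 (he.2 e' h)) (by
      rintro e' ⟨h1, h2⟩
      refine ⟨fun h => h2 ?_, fun h => h1 ?_⟩
      · rw [← h, Γ.inv_inv]
      · rw [← Γ.inv_inv e', h, Γ.inv_inv])
  exact ⟨Δ, e, he, hΔ⟩

theorem exists_isGlueAlong [∀ i, Finite (G i)] [∀ i, Finite (X i)] (gen : ∀ i, X i → G i)
    (Γ : AGraph.{v, w, w} X) [Finite Γ.V] [Finite Γ.E] (e : Γ.E) :
    ∃ i Δ f, IsGlueAlong gen Γ Δ e i f := by
  obtain ⟨⟨⟨i, x⟩, t⟩, hl⟩ : ∃ l, Γ.lab e = l := ⟨_, rfl⟩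
  let e₀ : (cayleyFactor gen i ⊥).E := (factorVtx gen i ⊥ 1, (x, t))
  have he₀ : (cayleyFactor gen i ⊥).lab e₀ = Γ.lab e := hl.symm
  obtain ⟨Δ, f, hf⟩ := PGraph.exists_isQuotient.{v, w} (Γ.sum (cayleyFactor gen i ⊥))
    (fun x y => (x = Sum.inl (Γ.ι e) ∧ y = Sum.inr ((cayleyFactor gen i ⊥).ι e₀)) ∨
      (x = Sum.inl (Γ.τ e) ∧ y = Sum.inr ((cayleyFactor gen i ⊥).τ e₀)))
    (fun d d' => (d = Sum.inl e ∧ d' = Sum.inr e₀) ∨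
      (d = Sum.inl (Γ.inv e) ∧ d' = Sum.inr ((cayleyFactor gen i ⊥).inv e₀)))
    (by
      rintro _ _ (⟨rfl, rfl⟩ | ⟨rfl, rfl⟩)
      · exact .rel _ _ (.inl ⟨rfl, rfl⟩)
      · exact .rel _ _ (.inr ⟨rfl, rfl⟩))
    (by
      rintro _ _ (⟨rfl, rfl⟩ | ⟨rfl, rfl⟩)
      · exact .rel _ _ (.inr ⟨rfl, rfl⟩)
      · refine .rel _ _ (.inl ⟨?_, ?_⟩)
        · exact congrArg Sum.inl (Γ.inv_inv e)
        · exact congrArg Sum.inr ((cayleyFactor gen i ⊥).inv_inv e₀))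
    (by
      rintro _ _ (⟨rfl, rfl⟩ | ⟨rfl, rfl⟩)
      · exact he₀.symm
      · refine (Γ.lab_inv e).trans (Eq.trans ?_ ((cayleyFactor gen i ⊥).lab_inv e₀).symm)
        rw [he₀])
  exact ⟨i, Δ, f, e₀, rfl, he₀, hf⟩

theorem exists_remove {Γ : AGraph.{v, a, b} X} {i : Fin 2} {x : Γ.V}
    (h : IsRemovable φ gen Γ i x) : ∃ Δ, Remove φ gen Γ Δ := by
  obtain ⟨Δ, hΔ⟩ := PGraph.exists_isoOnto Γ {y | y ∉ compV Γ i x ∩ VM Γ i} {e | e ∉ compE Γ i x}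
    (by
      obtain ⟨-, K, -, -, -, hb | hb⟩ := h
      · exact hb.2
      · exact fun h => hb.2 h.1)
    (fun e he hmem => he ⟨hmem.2 e rfl, hmem.1⟩)
    (by
      rintro e he ⟨hc, p, hp⟩
      rw [colour_inv] at hc
      refine he ⟨hc, p ++ [Γ.inv e], hp.append ⟨⟨rfl, PGraph.τ_inv e⟩, ?_⟩⟩
      simp [colour_inv, hc])
  exact ⟨Δ, i, x, h, hΔ⟩

/-- In each step either some operation applies and its result can be constructed, or the conditions
for ending the step hold. -/
theorem exists_trans [∀ i, Finite (G i)] [∀ i, Finite (X i)] (φ : ∀ i, A →* G i)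
    (gen : ∀ i, X i → G i) {c : Config.{v, w} X} (hc : c.IsFinite) :
    (∃ Γ, c = .done Γ) ∨ ∃ c', Trans φ gen c c' := by
  obtain ⟨hV, hE⟩ := hc
  cases c with
  | step2 Γ =>
    simp only [Config.graph] at hV hE
    right
    by_cases hw : Γ.WellLabelled
    · by_cases hh : ∃ e, Γ.IsHair e
      · obtain ⟨Δ, hΔ⟩ := exists_cutHair hh.choose_spec
        exact ⟨_, .cut₂ hΔ⟩
      · obtain ⟨l, hl⟩ := exists_picksEdges Γ
        exact ⟨_, .end₂ hw (not_exists.1 hh) l hl⟩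
    · obtain ⟨Δ, f, hf⟩ := exists_fold.{v, w} hw
      exact ⟨_, .fold₂ f hf⟩
  | step3 Γ l =>
    simp only [Config.graph] at hV hE
    right
    cases l with
    | nil =>
      by_cases hw : Γ.WellLabelled
      · exact ⟨_, .end₃ hw⟩
      · obtain ⟨Δ, f, hf⟩ := exists_fold.{v, w} hw
        exact ⟨_, .fold₃ _ f hf⟩
    | cons e l =>
      obtain ⟨i, Δ, f, hf⟩ := exists_isGlueAlong gen Γ e
      exact ⟨_, .glue₃ e l i f hf⟩
  | step4 Γ S =>
    simp only [Config.graph] at hV hE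
    right
    by_cases hw : Γ.WellLabelled
    · by_cases hS : ∃ x ∈ S, ∃ y₀ y₁, Incompatible φ gen Γ x y₀ y₁
      · obtain ⟨x, hx, y₀, y₁, h⟩ := hS
        obtain ⟨Δ, f, hf⟩ := PGraph.exists_isQuotient.{v, w} Γ (fun y z => y = y₀ ∧ z = y₁)
          (fun _ _ => False) (fun _ _ => False.elim) (fun _ _ => False.elim) (fun _ _ => False.elim)
        exact ⟨_, .identify₄ S x y₀ y₁ hx h f hf⟩
      · push Not at hS
        exact ⟨_, .end₄ S hw hS⟩
    · obtain ⟨Δ, f, hf⟩ := exists_fold.{v, w} hw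
      exact ⟨_, .fold₄ S f hf⟩
  | step5 Γ =>
    right
    by_cases hr : ∃ i x, IsRemovable φ gen Γ i x
    · obtain ⟨i, x, h⟩ := hr
      obtain ⟨Δ, hΔ⟩ := exists_remove h
      exact ⟨_, .remove₅ hΔ⟩
    · push Not at hr
      by_cases hf : IsFreeFactorGraph gen Γ
      · let Δ : AGraph.{v, w, w} X :=
          { V := PUnit
            E := PEmpty
            ι := fun _ => ⟨⟩
            inv := id
            lab := PEmpty.elim
            base := ⟨⟩
            inv_inv := fun _ => rfl
            lab_inv := fun e => e.elim }
        exact ⟨_, .collapse₅ (Δ := Δ) hr hf (inferInstanceAs (Subsingleton PUnit))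
          (inferInstanceAs (IsEmpty PEmpty))⟩
      · exact ⟨_, .end₅ hr hf⟩
  | step6 Γ =>
    simp only [Config.graph] at hV hE
    right
    by_cases hn : ∃ i K, NeedsGluing φ gen Γ i K
    · obtain ⟨i, K, h⟩ := hn
      obtain ⟨j, hij⟩ : ∃ j, i ≠ j := (exists_ne i).imp fun _ h => h.symm
      obtain ⟨Δ, f, hf⟩ := PGraph.exists_isQuotient.{v, w}
        (Γ.sum (cayleyFactor gen j ((K.comap (φ i)).map (φ j))))
        (fun x y => ∃ (α : A) (p : List Γ.E) (z : Γ.V), IsMonoPath Γ i Γ.base p z ∧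
          val φ gen (Γ.pathLab p) = PushoutI.base φ α ∧
          x = Sum.inl z ∧ y = Sum.inr (Quotient.mk'' (φ j α)))
        (fun _ _ => False) (fun _ _ => False.elim) (fun _ _ => False.elim) (fun _ _ => False.elim)
      exact ⟨_, .glue₆ i j hij K h ⟨f, hf⟩⟩
    · push Not at hn
      exact ⟨_, .end₆ hn⟩
  | done Γ => exact .inl ⟨Γ, rfl⟩

theorem Trans.invariant (hφ : ∀ i, Function.Injective (φ i))
    (hgen : ∀ i, Subgroup.closure (Set.range (gen i)) = ⊤) {c₁ c₂ : Config.{v, w} X}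
    (h : Trans φ gen c₁ c₂) (hc : c₁.IsFinite) (hi : c₁.Invariant φ gen H) :
    c₂.Invariant φ gen H := by
  obtain ⟨hV, -⟩ := hc
  cases h with
  | fold₂ f hf => exact Realizes.fold hi hf
  | cut₂ h => exact Realizes.cutHair hi h
  | end₂ h h' l hl =>
    refine ⟨hi, fun e => ?_⟩
    obtain ⟨e', he', h⟩ := hl.2 e
    exact ⟨e', h, .inl he'⟩
  | fold₃ l f hf =>
    refine ⟨hi.1.fold hf, hi.2.map f ?_⟩
    obtain ⟨_, _, -, -, -, hq⟩ := hf
    exact hq.2.1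
  | glue₃ e l i f hf => exact ⟨hf.realizes hgen hφ hi.1, hf.seeded hφ hi.2⟩
  | end₃ h => exact .of_vb hi.1 (hi.2.coveredAt h)
  | fold₄ S f hf => exact IsPrecover.fold hi hf
  | identify₄ S x y₀ y₁ hx h f hf => exact IsPrecover.identify hi hx h hf
  | end₄ S h h' =>
    obtain ⟨f⟩ := hi.realizes.hom
    exact ⟨f, _, hi.represents hφ hgen h h' f⟩
  | remove₅ h =>
    simp only [Config.graph] at hV
    obtain ⟨f, B, hi⟩ := hi
    exact hi.remove hφ hgen h
  | collapse₅ h h' hV' hE' =>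
    obtain ⟨f, B, hi⟩ := hi
    exact representsInCore_of_subsingleton (hi.eq_bot_of_isFreeFactorGraph hφ hgen h')
  | end₅ h h' =>
    simp only [Config.graph] at hV
    obtain ⟨f, B, hi⟩ := hi
    exact ⟨f, B, hi, hi.lifts_subset_core hφ hgen h h'⟩
  | glue₆ i j hij K h h' => exact hi.glueAtBase hφ hgen hij h h'
  | end₆ h => exact hi.representsCore hφ hgen h

theorem exists_isInitial (hgen : ∀ i, Subgroup.closure (Set.range (gen i)) = ⊤)
    {Y : Set (PushoutI φ)} (hY : Y.Finite) : ∃ Γ : AGraph.{v, w, w} X, IsInitial φ gen Y Γ := by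
  choose word hword using val_surjective φ gen hgen
  obtain ⟨Γ, f, hf⟩ := PGraph.exists_isQuotient.{v, w} (segments (hY.toFinset.toList.map word))
    (fun x y => y = Sum.inl () ∧ ∃ k, x = Sum.inr ⟨k, 0⟩ ∨ x = Sum.inr ⟨k, Fin.last _⟩)
    (fun _ _ => False) (fun _ _ => False.elim) (fun _ _ => False.elim) (fun _ _ => False.elim)
  refine ⟨Γ, _, ?_, f, hf⟩
  ext g
  simp [hword]

theorem Reachable.invariant [∀ i, Finite (G i)] [∀ i, Finite (X i)]
    (hφ : ∀ i, Function.Injective (φ i))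
    (hgen : ∀ i, Subgroup.closure (Set.range (gen i)) = ⊤) {Y : Set (PushoutI φ)}
    {c : Config.{v, w} X} (h : Reachable φ gen Y c) :
    c.IsFinite ∧ c.Invariant φ gen (Subgroup.closure Y) := by
  obtain ⟨Γ, ⟨W, rfl, hW⟩, h⟩ := h
  induction h with
  | refl =>
    refine ⟨?_, hW.realizes⟩
    obtain ⟨f, hf⟩ := hW
    exact hf.finite
  | tail _ h ih => exact ⟨h.isFinite ih.1, h.invariant hφ hgen ih.1 ih.2⟩

theorem terminates [∀ i, Finite (G i)] [∀ i, Finite (X i)]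
    (hφ : ∀ i, Function.Injective (φ i))
    (hgen : ∀ i, Subgroup.closure (Set.range (gen i)) = ⊤) {Y : Set (PushoutI φ)}
    (hY : Y.Finite) : Terminates.{u, v, w, c} φ X gen Y :=
  ⟨exists_isInitial hgen hY, fun _ hc =>
    have hfin := (hc.invariant hφ hgen).1
    ⟨hfin.acc, exists_trans φ gen hfin⟩⟩

theorem IsOutput.iso_normalCore [∀ i, Finite (G i)] [∀ i, Finite (X i)]
    (hφ : ∀ i, Function.Injective (φ i))
    (hgen : ∀ i, Subgroup.closure (Set.range (gen i)) = ⊤) {Y : Set (PushoutI φ)}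
    {Γ : AGraph.{v, w, w} X} (h : IsOutput φ gen Y Γ) :
    Γ.Iso (normalCore φ gen (Subgroup.closure Y)) :=
  RepresentsCore.iso hφ hgen (Reachable.invariant hφ hgen h).2

end Algorithm

end Stallings

open Stallings in
theorem mainTheorem2 {G : Fin 2 → Type u} [∀ i, Group (G i)] [∀ i, Finite (G i)]
    {A : Type c} [Group A] (φ : ∀ i, A →* G i) (hφ : ∀ i, Function.Injective (φ i))
    {X : Fin 2 → Type v} [∀ i, Finite (X i)] (gen : ∀ i, X i → G i)
    (hgen : ∀ i, Subgroup.closure (Set.range (gen i)) = ⊤)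
    (Y : Set (PushoutI φ)) (hY : Y.Finite)
    (H : Subgroup (PushoutI φ)) (hH : H = Subgroup.closure Y) :
    -- the algorithm always stops with an output
    Terminates.{u, v, w, c} φ X gen Y ∧
    -- every output is the normal core
    (∀ Γ : AGraph.{v, w, w} X, IsOutput φ gen Y Γ → Γ.Iso (normalCore φ gen H)) ∧
    -- the output depends on the subgroup only
    (∀ Y' : Set (PushoutI φ), Y'.Finite → Subgroup.closure Y' = H →
      ∀ Γ Γ' : AGraph.{v, w, w} X, IsOutput φ gen Y Γ → IsOutput φ gen Y' Γ' → Γ.Iso Γ') := by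
  subst hH
  refine ⟨terminates hφ hgen hY, fun Γ h => h.iso_normalCore hφ hgen, ?_⟩
  intro Y' _ hY' Γ Γ' h h'
  exact (h.iso_normalCore hφ hgen).trans (hY' ▸ h'.iso_normalCore hφ hgen).symm
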